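/- A \emph{double-wedge} is the closure of the symmetric difference of two half-planes in $\mathbb{R}^2$ that are bounded by non-parallel, non-vertical lines. A family $\mathcal{D}$ of double-wedges \emph{covers} a slope $a\in\mathbb{R}\cup\{\infty\}$ if some member of $\mathcal{D}$ contains a line of slope $a$ (slope $\infty=-\infty$ meaning vertical). \textbf{Theorem.} There is an algorithm (a single program for the real RAM, with unit-cost arithmetic and comparison of real numbers) that, given any family $\mathcal{D}$ of $n\ge 1$ double-wedges that does not cover all slopes in $\mathbb{R}\cup\{\infty\}$, computes the intersection $\bigcap\mathcal{D}$ in $O(n\log n)$ time. The output is a list of (possibly unbounded, possibly degenerate) convex polygons, each given by its vertices, and the directions of its unbounded edges, in counterclockwise order; any two of these polygons have at most one point in common, and their union is $\bigcap\mathcal{D}$. -/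

import Mathlib

/-! ## Double-wedges in the plane -/

/-- The Euclidean plane with Cartesian coordinates. -/
abbrev Plane : Type := ℝ × ℝ

/-- A half-plane bounded by the non-vertical line `y = slope * x + icpt`.
It lies above the line if `above = true` and below the line otherwise. -/
structure HalfPlane where
  slope : ℝ
  icpt : ℝ
  above : Bool

/-- The set of points of a (closed) half-plane. -/
def HalfPlane.toSet (h : HalfPlane) : Set Plane :=
  {p | if h.above = true then h.slope * p.1 + h.icpt ≤ p.2 else p.2 ≤ h.slope * p.1 + h.icpt}

/-- A double-wedge `⟨h₁, h₂⟩` is given by two half-planes with non-parallel bounding lines. -/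
structure DoubleWedge where
  h₁ : HalfPlane
  h₂ : HalfPlane
  not_parallel : h₁.slope ≠ h₂.slope

/-- The double-wedge as a set: the closure of the symmetric difference of the two half-planes. -/
def DoubleWedge.toSet (d : DoubleWedge) : Set Plane :=
  closure (symmDiff d.h₁.toSet d.h₂.toSet)

/-- The line of slope `a ∈ ℝ ∪ {∞}` through the point `q`; slope `∞` means vertical. -/
def lineThrough (q : Plane) : OnePoint ℝ → Set Plane
  | none => {p | p.1 = q.1}
  | some m => {p | p.2 - q.2 = m * (p.1 - q.1)}

/-- A family of double-wedges covers the slope `a` if one of its members contains a line of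
slope `a`. -/
def Covers {ι : Type*} (D : ι → DoubleWedge) (a : OnePoint ℝ) : Prop :=
  ∃ i, ∃ q : Plane, lineThrough q a ⊆ (D i).toSet

/-! ## The output: convex polygonal regions given by their boundaries -/

/-- A corner of a convex polygonal region: a vertex, or the direction of an unbounded edge
(a "vertex at infinity"). -/
inductive Corner where
  | vertex (p : Plane)
  | direction (u : Plane)

/-- Homogeneous coordinates of a corner. -/
def Corner.homog : Corner → Fin 3 → ℝ
  | .vertex p => ![p.1, p.2, 1]
  | .direction u => ![u.1, u.2, 0]

/-- The region with the given corners: all sums of a convex combination of the vertices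
and a nonnegative combination of the directions. -/
def regionSet (l : List Corner) : Set Plane :=
  {p | ∃ q ∈ convexHull ℝ {v : Plane | Corner.vertex v ∈ l},
    ∃ u ∈ PointedCone.hull ℝ {u : Plane | Corner.direction u ∈ l}, p = q + u}

/-- The list `l` is the list of the corners of a (possibly unbounded, possibly degenerate) convex
polygon in counterclockwise order: there is at least one vertex, the corners are distinct points
of the projective plane, and any three corners, in the order of the list, make a strict left turn.
Lists with one or two corners are points, segments and rays. -/
def IsConvexPolygon (l : List Corner) : Prop :=
  (∃ v, Corner.vertex v ∈ l) ∧
  l.Pairwise (fun a b => LinearIndependent ℝ ![a.homog, b.homog]) ∧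
  l.Triplewise (fun a b c => 0 < Matrix.det (Matrix.of ![a.homog, b.homog, c.homog]))

/-- The list of regions `L` is an explicit description of the planar set `S`: every entry is a
convex polygon, given by its corners in counterclockwise order, any two of these polygons have at
most one point in common, and `S` is their union. -/
def Describes (L : List (List Corner)) (S : Set Plane) : Prop :=
  (∀ l ∈ L, IsConvexPolygon l) ∧
  L.Pairwise (fun l l' => (regionSet l ∩ regionSet l').Subsingleton) ∧
  (⋃ l ∈ L, regionSet l) = S

/-! ## The real RAM

The memory consists of unbounded arrays of natural numbers (used for indices and counters) and
unbounded arrays of real numbers.  A program is a fixed finite piece of code; arrays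
are addressed by constant names and computed indices.  The operations are `+`, `-` on natural
numbers and `+`, `-`, `*`, `/` and comparison on real numbers.  Real numbers cannot
be rounded or converted to natural numbers, and the only real constants are rational. -/

namespace RealRAM

/-- A memory state: `nat a i` is cell `i` of the `a`-th array of natural numbers, and `real a i` is
cell `i` of the `a`-th array of real numbers. -/
structure State where
  nat : ℕ → ℕ → ℕ
  real : ℕ → ℕ → ℝ

/-- Overwrite one natural-number cell. -/
def State.setNat (σ : State) (a i v : ℕ) : State :=
  { σ with nat := Function.update σ.nat a (Function.update (σ.nat a) i v) }

/-- Overwrite one real-number cell. -/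
def State.setReal (σ : State) (a i : ℕ) (v : ℝ) : State :=
  { σ with real := Function.update σ.real a (Function.update (σ.real a) i v) }

/-- Natural-number expressions: constants, array access, addition, truncated subtraction. -/
inductive NExp where
  | const (k : ℕ)
  | get (a : ℕ) (i : NExp)
  | add (e f : NExp)
  | sub (e f : NExp)

def NExp.eval (σ : State) : NExp → ℕ
  | .const k => k
  | .get a i => σ.nat a (i.eval σ)
  | .add e f => e.eval σ + f.eval σ
  | .sub e f => e.eval σ - f.eval σ

/-- The number of steps for evaluating an expression: one for each of its nodes. -/
def NExp.cost : NExp → ℕ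
  | .const _ => 1
  | .get _ i => i.cost + 1
  | .add e f => e.cost + f.cost + 1
  | .sub e f => e.cost + f.cost + 1

/-- Real expressions: rational constants, array access and the four arithmetic operations
(a quotient by `0` evaluates to `0`). -/
inductive RExp where
  | const (q : ℚ)
  | get (a : ℕ) (i : NExp)
  | add (e f : RExp)
  | sub (e f : RExp)
  | mul (e f : RExp)
  | div (e f : RExp)

noncomputable def RExp.eval (σ : State) : RExp → ℝ
  | .const q => (q : ℝ)
  | .get a i => σ.real a (i.eval σ)
  | .add e f => e.eval σ + f.eval σ
  | .sub e f => e.eval σ - f.eval σ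
  | .mul e f => e.eval σ * f.eval σ
  | .div e f => e.eval σ / f.eval σ

/-- The number of steps for evaluating an expression: one for each of its nodes. -/
def RExp.cost : RExp → ℕ
  | .const _ => 1
  | .get _ i => i.cost + 1
  | .add e f => e.cost + f.cost + 1
  | .sub e f => e.cost + f.cost + 1
  | .mul e f => e.cost + f.cost + 1
  | .div e f => e.cost + f.cost + 1

/-- Tests. -/
inductive Test where
  | natLT (e f : NExp)
  | realLT (e f : RExp)
  | not (b : Test)
  | and (b c : Test)

/-- The truth value of a test in a state. -/
def Test.Holds (σ : State) : Test → Prop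
  | .natLT e f => e.eval σ < f.eval σ
  | .realLT e f => e.eval σ < f.eval σ
  | .not b => ¬ b.Holds σ
  | .and b c => b.Holds σ ∧ c.Holds σ

/-- The number of steps for evaluating a test: one for each of its nodes. -/
def Test.cost : Test → ℕ
  | .natLT e f => e.cost + f.cost + 1
  | .realLT e f => e.cost + f.cost + 1
  | .not b => b.cost + 1
  | .and b c => b.cost + c.cost + 1

/-- Programs. -/
inductive Prog where
  | skip
  | setNat (a : ℕ) (i e : NExp)
  | setReal (a : ℕ) (i : NExp) (e : RExp)
  | seq (p q : Prog)
  | ite (b : Test) (p q : Prog)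
  | while (b : Test) (p : Prog)

/-- `Runs p σ t τ`: started in state `σ`, the program `p` halts after exactly `t` steps in
state `τ`. -/
inductive Runs : Prog → State → ℕ → State → Prop where
  | skip (σ : State) : Runs .skip σ 1 σ
  | setNat (a : ℕ) (i e : NExp) (σ : State) :
      Runs (.setNat a i e) σ (i.cost + e.cost + 1) (σ.setNat a (i.eval σ) (e.eval σ))
  | setReal (a : ℕ) (i : NExp) (e : RExp) (σ : State) :
      Runs (.setReal a i e) σ (i.cost + e.cost + 1) (σ.setReal a (i.eval σ) (e.eval σ))
  | seq {p q : Prog} {σ τ υ : State} {s t : ℕ} (hp : Runs p σ s τ) (hq : Runs q τ t υ) :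
      Runs (.seq p q) σ (s + t) υ
  | ite_true {b : Test} {p : Prog} (q : Prog) {σ τ : State} {t : ℕ} (hb : b.Holds σ)
      (hp : Runs p σ t τ) : Runs (.ite b p q) σ (b.cost + t) τ
  | ite_false {b : Test} (p : Prog) {q : Prog} {σ τ : State} {t : ℕ} (hb : ¬ b.Holds σ)
      (hq : Runs q σ t τ) : Runs (.ite b p q) σ (b.cost + t) τ
  | while_false {b : Test} (p : Prog) {σ : State} (hb : ¬ b.Holds σ) :
      Runs (.while b p) σ b.cost σ
  | while_true {b : Test} {p : Prog} {σ τ υ : State} {s t : ℕ} (hb : b.Holds σ)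
      (hp : Runs p σ s τ) (hw : Runs (.while b p) τ t υ) :
      Runs (.while b p) σ (b.cost + s + t) υ

/-- The initial state for the input `D₀, …, Dₙ₋₁`.  Cell `0` of natural array `0` holds `n`.
Cells `i` of real arrays `0, 1` hold slope and intercept of the line bounding the first half-plane
of `Dᵢ`, and cell `i` of natural array `1` tells whether this half-plane lies above (`1`) or below
(`0`) the line; real arrays `2, 3` and natural array `2` hold the same for the second half-plane.
All other cells are `0`. -/
def inputState {n : ℕ} (D : Fin n → DoubleWedge) : State where
  nat a i :=
    if a = 0 ∧ i = 0 then n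
    else if h : i < n then
      if a = 1 then (if (D ⟨i, h⟩).h₁.above = true then 1 else 0)
      else if a = 2 then (if (D ⟨i, h⟩).h₂.above = true then 1 else 0)
      else 0
    else 0
  real a i :=
    if h : i < n then
      if a = 0 then (D ⟨i, h⟩).h₁.slope
      else if a = 1 then (D ⟨i, h⟩).h₁.icpt
      else if a = 2 then (D ⟨i, h⟩).h₂.slope
      else if a = 3 then (D ⟨i, h⟩).h₂.icpt
      else 0
    else 0

/-- The `k`-th corner on the output: cells `k` of real arrays `0, 1` hold its coordinates, and
cell `k` of natural array `2` tells whether it is a direction (`0`) or a vertex (nonzero). -/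
def State.corner (σ : State) (k : ℕ) : Corner :=
  if σ.nat 2 k = 0 then .direction (σ.real 0 k, σ.real 1 k)
  else .vertex (σ.real 0 k, σ.real 1 k)

/-- The list of regions on the output.  Cell `0` of natural array `0` holds the number of
regions, and cell `j` of natural array `1` the number of corners of region `j`.  The corners of
the regions are written out consecutively, one region after the other. -/
def State.regions (σ : State) : List (List Corner) :=
  (List.range (σ.nat 0 0)).map fun j =>
    (List.range (σ.nat 1 j)).map fun k =>
      σ.corner ((∑ i ∈ Finset.range j, σ.nat 1 i) + k)

end RealRAM

/-!
A slope `a` is covered by a double-wedge with bounding lines of slopes `lo < hi` exactly if it lies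
in the closed interval `[lo, hi]`, or exactly if it does not lie in the open interval `(lo, hi)`,
depending on whether the wedge contains vertical lines. If any slope is left uncovered, then so is
a finite slope `s` (`exists_uncovered`). In the coordinates of `shear s`, in which the lines of
slope `s` are vertical, every double-wedge meets every vertical line in the segment between its two
bounding lines `l₁` and `l₂`. Hence the intersection of the family is the set of all points with
`U ≤ y ≤ L` (`iInter_eq_shear`), where `U` is the maximum of the functions `min l₁ l₂` and `L` is
the minimum of the functions `max l₁ l₂`; in the text, `L = -V` for a maximum `V` of minima.

*The envelopes are small.* An upper envelope `F` of `n` functions, each the minimum of two lines,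
has `O(n)` pieces (`card_pieces_le`). At a concave kink of `F`, one of the functions has its apex
(`exists_apex`), so that there are at most `n` such kinks. Every piece lies on one of the `2 * n`
lines, and this line stays below `F` on the side on which it is active (`exists_label`). At a convex
kink with a piece on the right that stays below `F` to the right, the line of the piece on its left
does not reappear further to the right, and symmetrically; at all other convex kinks, the line on the
left stays below `F` to the right, and the line on the right stays below `F` to the left, and such
changes alternate with changes in the other direction, which have been counted already.

*The envelopes are computed by divide and conquer.* Two piecewise linear functions are overlaid by a
sweep over their breakpoints and crossings (`ends_overlay`), and the cells of the overlay are
compressed to the pieces of the maximum (`ends_compress`). The merges are organized as a queue, in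
which node `N + t` of a binary tree has the children `2 * t` and `2 * t + 1`. By induction, node
`N + t` has at most `2 * N / (N - 1 - t)` leaves (`card_leaves_le`), so that the total work is
bounded by `N` times a harmonic sum (`ends_envelope`, `mergeWork_le`). The slope `s` is found by the
same algorithm: the slopes that are not covered are those at which the maximum of `2 * n` such
functions is negative (`slopeHats`).

*The regions are convex.* At a concave kink of `U`, both lines of some double-wedge pass through the
point of the graph, so that `L ≤ U` there; the same holds at a convex kink of `L`. Over a maximal
run of cells on which `U < L` in the interior, `U` is therefore convex and `L` is concave
(`wedgeHats_kink`), and the region is the convex polygon whose corners are the kinks and the ends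
(`Run.isConvexPolygon`, `Run.regionSet_eq`). A run cannot extend over the whole line, because
`L ≤ U` at the crossing of the two lines of a double-wedge (`wedgeHats_touch`). Neighbouring regions
share at most the point at which `U = L`. A sweep over the overlay of `U` and `L` writes out all
regions and isolated points (`ends_trace`).

The programs are verified in a total-correctness logic with running times: `Ends P σ T Q` says that
`P`, started in `σ`, halts within `T` steps in a state satisfying `Q`.
-/

/-! ### A total-correctness logic for the real RAM -/

namespace RealRAM

/-- `Ends P σ T Q`: started in `σ`, the program `P` halts within `T` steps in a state satisfying
`Q`. -/
def Ends (P : Prog) (σ : State) (T : ℕ) (Q : State → Prop) : Prop :=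
  ∃ t τ, Runs P σ t τ ∧ t ≤ T ∧ Q τ

theorem Ends.mono {P : Prog} {σ : State} {T T' : ℕ} {Q Q' : State → Prop}
    (h : Ends P σ T Q) (hT : T ≤ T') (hQ : ∀ τ, Q τ → Q' τ) : Ends P σ T' Q' := by
  obtain ⟨t, τ, hr, ht, hq⟩ := h
  exact ⟨t, τ, hr, ht.trans hT, hQ τ hq⟩

theorem Ends.seq {P P' : Prog} {σ : State} {s t : ℕ} {R Q : State → Prop}
    (h : Ends P σ s R) (h' : ∀ τ, R τ → Ends P' τ t Q) : Ends (.seq P P') σ (s + t) Q := by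
  obtain ⟨s', τ, hr, hs, hR⟩ := h
  obtain ⟨t', υ, hr', ht, hQ⟩ := h' τ hR
  exact ⟨s' + t', υ, .seq hr hr', add_le_add hs ht, hQ⟩

theorem Ends.ite {b : Test} {P P' : Prog} {σ : State} {T : ℕ} {Q : State → Prop}
    (h : b.Holds σ → Ends P σ T Q) (h' : ¬ b.Holds σ → Ends P' σ T Q) :
    Ends (.ite b P P') σ (b.cost + T) Q := by
  by_cases hb : b.Holds σ
  · obtain ⟨t, τ, hr, ht, hQ⟩ := h hb
    exact ⟨_, τ, .ite_true _ hb hr, by omega, hQ⟩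
  · obtain ⟨t, τ, hr, ht, hQ⟩ := h' hb
    exact ⟨_, τ, .ite_false _ hb hr, by omega, hQ⟩

/-- The natural-number arrays that a program may write. -/
def Prog.natWrites : Prog → List ℕ
  | .skip => []
  | .setNat a _ _ => [a]
  | .setReal _ _ _ => []
  | .seq p q => p.natWrites ++ q.natWrites
  | .ite _ p q => p.natWrites ++ q.natWrites
  | .while _ p => p.natWrites

/-- The real-number arrays that a program may write. -/
def Prog.realWrites : Prog → List ℕ
  | .skip => []
  | .setNat _ _ _ => []
  | .setReal a _ _ => [a]
  | .seq p q => p.realWrites ++ q.realWrites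
  | .ite _ p q => p.realWrites ++ q.realWrites
  | .while _ p => p.realWrites

/-- The state `τ` agrees with `σ` on all arrays outside the given lists. -/
structure Frame (A B : List ℕ) (σ τ : State) : Prop where
  nat : ∀ a, a ∉ A → τ.nat a = σ.nat a
  real : ∀ a, a ∉ B → τ.real a = σ.real a

theorem Frame.refl (A B : List ℕ) (σ : State) : Frame A B σ σ := ⟨fun _ _ => rfl, fun _ _ => rfl⟩

theorem Frame.trans {A B : List ℕ} {σ τ υ : State} (h : Frame A B σ τ) (h' : Frame A B τ υ) :
    Frame A B σ υ :=
  ⟨fun a ha => (h'.nat a ha).trans (h.nat a ha), fun a ha => (h'.real a ha).trans (h.real a ha)⟩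

theorem Frame.weaken {A B A' B' : List ℕ} {σ τ : State} (h : Frame A B σ τ) (hA : A ⊆ A')
    (hB : B ⊆ B') : Frame A' B' σ τ :=
  ⟨fun a ha => h.nat a fun h' => ha (hA h'), fun a ha => h.real a fun h' => ha (hB h')⟩

theorem Runs.frame {P : Prog} {σ τ : State} {t : ℕ} (h : Runs P σ t τ) :
    Frame P.natWrites P.realWrites σ τ := by
  induction h with
  | skip => exact .refl _ _ _
  | setNat a i e σ =>
    refine ⟨fun b hb => ?_, fun _ _ => rfl⟩
    simp only [Prog.natWrites, List.mem_singleton] at hb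
    simp [State.setNat, hb]
  | setReal a i e σ =>
    refine ⟨fun _ _ => rfl, fun b hb => ?_⟩
    simp only [Prog.realWrites, List.mem_singleton] at hb
    simp [State.setReal, hb]
  | seq _ _ h₁ h₂ =>
    exact (h₁.weaken (by simp [Prog.natWrites]) (by simp [Prog.realWrites])).trans
      (h₂.weaken (by simp [Prog.natWrites]) (by simp [Prog.realWrites]))
  | ite_true _ _ _ h => exact h.weaken (by simp [Prog.natWrites]) (by simp [Prog.realWrites])
  | ite_false _ _ _ h => exact h.weaken (by simp [Prog.natWrites]) (by simp [Prog.realWrites])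
  | while_false => exact .refl _ _ _
  | while_true _ _ _ h₁ h₂ => exact h₁.trans h₂

theorem Ends.frame {P : Prog} {σ : State} {T : ℕ} {Q : State → Prop} (h : Ends P σ T Q) :
    Ends P σ T fun τ => Q τ ∧ Frame P.natWrites P.realWrites σ τ := by
  obtain ⟨t, τ, hr, ht, hq⟩ := h
  exact ⟨t, τ, hr, ht, hq, hr.frame⟩

/-- The rule for loops: `I` is an invariant, and the potential `Φ` pays for the tests and for the
executions of the body. -/
theorem Ends.while {b : Test} {P : Prog} {σ : State} (I : State → Prop) (Φ : State → ℕ)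
    (h₀ : I σ)
    (step : ∀ τ, I τ → Frame P.natWrites P.realWrites σ τ → b.Holds τ →
      ∃ T, Ends P τ T fun υ => I υ ∧ b.cost + T + Φ υ ≤ Φ τ) :
    Ends (.while b P) σ (Φ σ + b.cost)
      fun τ => I τ ∧ ¬ b.Holds τ ∧ Frame P.natWrites P.realWrites σ τ := by
  have cost_pos : 0 < b.cost := by cases b <;> simp [Test.cost]
  have key : ∀ N τ, Φ τ ≤ N → I τ → Frame P.natWrites P.realWrites σ τ →
      Ends (.while b P) τ (Φ τ + b.cost)
        fun υ => I υ ∧ ¬ b.Holds υ ∧ Frame P.natWrites P.realWrites σ υ := by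
    intro N
    induction N with
    | zero =>
      intro τ hN hI hf
      by_cases hb : b.Holds τ
      · obtain ⟨T, t, υ, -, -, -, h⟩ := step τ hI hf hb
        omega
      · exact ⟨_, τ, .while_false _ hb, by omega, hI, hb, hf⟩
    | succ N ih =>
      intro τ hN hI hf
      by_cases hb : b.Holds τ
      · obtain ⟨T, t, υ, hr, ht, hI', h⟩ := step τ hI hf hb
        obtain ⟨t', ω, hr', ht', hQ⟩ := ih υ (by omega) hI' (hf.trans hr.frame)
        exact ⟨_, ω, .while_true hb hr hr', by omega, hQ⟩
      · exact ⟨_, τ, .while_false _ hb, by omega, hI, hb, hf⟩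
  exact key _ σ le_rfl h₀ (.refl _ _ _)

/-- Programs without loops. -/
def Prog.straight : Prog → Bool
  | .skip => true
  | .setNat _ _ _ => true
  | .setReal _ _ _ => true
  | .seq p q => p.straight && q.straight
  | .ite _ p q => p.straight && q.straight
  | .while _ _ => false

/-- A bound for the running time of a program without loops; both branches of a conditional are
counted, and the value at a loop is irrelevant. -/
def Prog.bound : Prog → ℕ
  | .skip => 1
  | .setNat _ i e => i.cost + e.cost + 1
  | .setReal _ i e => i.cost + e.cost + 1
  | .seq p q => p.bound + q.bound
  | .ite b p q => b.cost + (p.bound + q.bound)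
  | .while _ _ => 0

/-- The weakest precondition of a program without loops. It is `False` for loops, which are handled
by the rule `Ends.while` instead. -/
def wp : Prog → (State → Prop) → State → Prop
  | .skip, Q, σ => Q σ
  | .setNat a i e, Q, σ => Q (σ.setNat a (i.eval σ) (e.eval σ))
  | .setReal a i e, Q, σ => Q (σ.setReal a (i.eval σ) (e.eval σ))
  | .seq p q, Q, σ => wp p (wp q Q) σ
  | .ite b p q, Q, σ => (b.Holds σ → wp p Q σ) ∧ (¬ b.Holds σ → wp q Q σ)
  | .while _ _, _, _ => False

theorem Ends.of_wp {P : Prog} {σ : State} {Q : State → Prop} (h : wp P Q σ) :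
    Ends P σ P.bound Q := by
  induction P generalizing σ Q with
  | skip => exact ⟨_, _, .skip σ, le_rfl, h⟩
  | setNat a i e => exact ⟨_, _, .setNat a i e σ, le_rfl, h⟩
  | setReal a i e => exact ⟨_, _, .setReal a i e σ, le_rfl, h⟩
  | seq p q ihp ihq => exact (ihp h).seq fun τ hτ => ihq hτ
  | ite b p q ihp ihq =>
    refine Ends.ite (fun hb => ?_) (fun hb => ?_)
    · exact (ihp (h.1 hb)).mono (by omega) fun _ h => h
    · exact (ihq (h.2 hb)).mono (by omega) fun _ h => h
  | _ => exact h.elim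

/-! ### Notation for programs -/

/-- A natural-number variable: cell `0` of its own array. -/
abbrev nv (a : ℕ) : NExp := .get a (.const 0)

/-- A real variable: cell `0` of its own array. -/
abbrev rv (a : ℕ) : RExp := .get a (.const 0)

/-- Disjunction of tests. -/
abbrev Test.or (b c : Test) : Test := .not (.and (.not b) (.not c))

theorem Test.holds_or (b c : Test) (σ : State) :
    (Test.or b c).Holds σ ↔ b.Holds σ ∨ c.Holds σ := by
  simp only [Test.Holds]; tauto

infixr:30 " ;; " => Prog.seq
infixl:65 " +ₙ " => NExp.add
infixl:65 " -ₙ " => NExp.sub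
infixl:65 " +ᵣ " => RExp.add
infixl:65 " -ᵣ " => RExp.sub
infixl:70 " *ᵣ " => RExp.mul
infixl:70 " /ᵣ " => RExp.div
infix:50 " <ₙ " => Test.natLT
infix:50 " <ᵣ " => Test.realLT

/-- Assignment to a natural-number variable. -/
abbrev setN (a : ℕ) (e : NExp) : Prog := .setNat a (.const 0) e

/-- Assignment to a real variable. -/
abbrev setR (a : ℕ) (e : RExp) : Prog := .setReal a (.const 0) e

section simp

variable (σ : State) (a b i j v : ℕ) (r : ℝ)

@[simp] theorem setNat_real : (σ.setNat a i v).real = σ.real := rfl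
@[simp] theorem setReal_nat : (σ.setReal a i r).nat = σ.nat := rfl
@[simp] theorem setNat_nat_self : (σ.setNat a i v).nat a = Function.update (σ.nat a) i v := by
  simp [State.setNat]
@[simp] theorem setReal_real_self :
    (σ.setReal a i r).real a = Function.update (σ.real a) i r := by
  simp [State.setReal]
@[simp] theorem setNat_nat_of_ne (h : b ≠ a) : (σ.setNat a i v).nat b = σ.nat b := by
  simp [State.setNat, h]
@[simp] theorem setReal_real_of_ne (h : b ≠ a) : (σ.setReal a i r).real b = σ.real b := by
  simp [State.setReal, h]

end simp

attribute [simp] wp NExp.eval RExp.eval Test.Holds Prog.bound NExp.cost RExp.cost Test.cost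
  Prog.natWrites Prog.realWrites

end RealRAM

/-! ### Piecewise linear functions -/

/-- The pieces `s, …, e - 1` describe the function `F`: piece `k` is the line with slope `m k` and
intercept `c k`, and starts at `x k`; the first piece extends to `-∞`, so that `x s` is irrelevant.
The last piece is claimed to agree with `F` only where `ub` holds.  Both ends of a piece are
included, so that `F` is continuous. -/
structure IsPLTo (s e : ℕ) (m c x : ℕ → ℝ) (ub : ℝ → Prop) (F : ℝ → ℝ) : Prop where
  lt : s < e
  mono : ∀ k, s < k → k + 1 < e → x k < x (k + 1)
  eval : ∀ k, s ≤ k → k < e → ∀ t, (s < k → x k ≤ t) → (k + 1 < e → t ≤ x (k + 1)) →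
    (k + 1 = e → ub t) → F t = m k * t + c k

/-- The pieces `s, …, e - 1` describe the function `F` on the whole line. -/
abbrev IsPL (s e : ℕ) (m c x : ℕ → ℝ) (F : ℝ → ℝ) : Prop := IsPLTo s e m c x (fun _ => True) F

theorem IsPLTo.mono_ub {s e : ℕ} {m c x : ℕ → ℝ} {ub ub' : ℝ → Prop} {F : ℝ → ℝ}
    (h : IsPLTo s e m c x ub F) (hub : ∀ t, ub' t → ub t) : IsPLTo s e m c x ub' F :=
  ⟨h.lt, h.mono, fun k h₁ h₂ t h₃ h₄ h₅ => h.eval k h₁ h₂ t h₃ h₄ fun h' => hub t (h₅ h')⟩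

theorem IsPLTo.congr {s e : ℕ} {m c x m' c' x' : ℕ → ℝ} {ub : ℝ → Prop} {F : ℝ → ℝ}
    (h : IsPLTo s e m c x ub F)
    (hag : ∀ k, s ≤ k → k < e → m' k = m k ∧ c' k = c k ∧ x' k = x k) :
    IsPLTo s e m' c' x' ub F := by
  refine ⟨h.lt, fun k h₁ h₂ => ?_, fun k h₁ h₂ t h₃ h₄ h₅ => ?_⟩
  · rw [(hag k (by omega) (by omega)).2.2, (hag (k + 1) (by omega) (by omega)).2.2]
    exact h.mono k h₁ h₂
  · rw [(hag k h₁ h₂).1, (hag k h₁ h₂).2.1]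
    refine h.eval k h₁ h₂ t (fun hk => ?_) (fun hk => ?_) h₅
    · rw [← (hag k h₁ h₂).2.2]; exact h₃ hk
    · rw [← (hag (k + 1) (by omega) hk).2.2]; exact h₄ hk

/-- Appending a piece. -/
theorem IsPLTo.push {s e : ℕ} {m c x : ℕ → ℝ} {ub ub' : ℝ → Prop} {F : ℝ → ℝ}
    (h : IsPLTo s e m c x ub F) {a b y : ℝ} (hlt : s + 1 < e → x (e - 1) < y)
    (hub : ∀ t, (s + 1 < e → x (e - 1) ≤ t) → t ≤ y → ub t)
    (hnew : ∀ t, y ≤ t → ub' t → F t = a * t + b) :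
    IsPLTo s (e + 1) (Function.update m e a) (Function.update c e b) (Function.update x e y)
      ub' F := by
  have hse := h.lt
  refine ⟨by omega, fun k h₁ h₂ => ?_, fun k h₁ h₂ t h₃ h₄ h₅ => ?_⟩
  · rw [Function.update_of_ne (show k ≠ e by omega)]
    rcases eq_or_ne (k + 1) e with rfl | hk
    · simpa using hlt (by omega)
    · rw [Function.update_of_ne hk]
      exact h.mono k h₁ (by omega)
  · rcases eq_or_ne k e with rfl | hk
    · simp only [Function.update_self] at h₃ ⊢
      exact hnew t (h₃ (by omega)) (h₅ rfl)
    · rw [Function.update_of_ne hk, Function.update_of_ne hk]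
      rw [Function.update_of_ne hk] at h₃
      refine h.eval k h₁ (by omega) t h₃ (fun hk' => ?_) (fun hk' => ?_)
      · have := h₄ (by omega)
        rwa [Function.update_of_ne (by omega)] at this
      · subst hk'
        have h₆ := h₄ (by omega)
        rw [Function.update_self] at h₆
        exact hub t (fun _ => by simpa using h₃ (by omega)) h₆

/-- A single piece. -/
theorem IsPLTo.single {s : ℕ} {m c x : ℕ → ℝ} {ub : ℝ → Prop} {F : ℝ → ℝ}
    (h : ∀ t, ub t → F t = m s * t + c s) : IsPLTo s (s + 1) m c x ub F := by
  refine ⟨by omega, fun k h₁ h₂ => by omega, fun k h₁ h₂ t _ _ h₅ => ?_⟩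
  obtain rfl : k = s := by omega
  exact h t (h₅ rfl)

/-- Two pieces. -/
theorem IsPL.pair {s : ℕ} {m c x : ℕ → ℝ} {F : ℝ → ℝ}
    (h : ∀ t, t ≤ x (s + 1) → F t = m s * t + c s)
    (h' : ∀ t, x (s + 1) ≤ t → F t = m (s + 1) * t + c (s + 1)) : IsPL s (s + 2) m c x F := by
  refine ⟨by omega, fun k h₁ h₂ => by omega, fun k h₁ h₂ t h₃ h₄ _ => ?_⟩
  obtain rfl | rfl : k = s ∨ k = s + 1 := by omega
  · exact h t (h₄ (by omega))
  · exact h' t (h₃ (by omega))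

theorem IsPLTo.mono_lt {s e : ℕ} {m c x : ℕ → ℝ} {ub : ℝ → Prop} {F : ℝ → ℝ}
    (h : IsPLTo s e m c x ub F) {i j : ℕ} (hi : s < i) (hij : i < j) (hj : j < e) :
    x i < x j := by
  induction j, hij using Nat.le_induction with
  | base => exact h.mono i hi hj
  | succ j hij ih => exact (ih (by omega)).trans (h.mono j (by omega) hj)

/-- Every point lies in a piece. -/
theorem IsPLTo.exists_piece {s e : ℕ} {m c x : ℕ → ℝ} {ub : ℝ → Prop} {F : ℝ → ℝ}
    (h : IsPLTo s e m c x ub F) (t : ℝ) :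
    ∃ k, s ≤ k ∧ k < e ∧ (s < k → x k ≤ t) ∧ (k + 1 < e → t < x (k + 1)) := by
  have hse := h.lt
  have key : ∀ d, s + d < e → (s + d = s ∨ x (s + d) ≤ t) →
      ∃ k, s ≤ k ∧ k < e ∧ (s < k → x k ≤ t) ∧ (k + 1 < e → t < x (k + 1)) := by
    intro d hd hx
    obtain ⟨r, hr⟩ : ∃ r, e = s + d + 1 + r := ⟨e - (s + d + 1), by omega⟩
    induction r generalizing d with
    | zero => exact ⟨s + d, by omega, by omega, fun h => hx.resolve_left (by omega), by omega⟩
    | succ r ih =>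
      by_cases hlt : t < x (s + d + 1)
      · exact ⟨s + d, by omega, by omega, fun h => hx.resolve_left (by omega), fun _ => hlt⟩
      · exact ih (d + 1) (by omega) (.inr (not_lt.1 hlt)) (by omega)
  exact key 0 (by omega) (.inl rfl)

/-- Consecutive pieces meet. -/
theorem IsPL.meet {s e : ℕ} {m c x : ℕ → ℝ} {F : ℝ → ℝ} (h : IsPL s e m c x F) {k : ℕ}
    (hs : s ≤ k) (he : k + 1 < e) :
    m k * x (k + 1) + c k = m (k + 1) * x (k + 1) + c (k + 1) := by
  rw [← h.eval k hs (by omega) (x (k + 1)) (fun hk => (h.mono k hk he).le) (fun _ => le_rfl)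
    fun _ => trivial]
  exact h.eval (k + 1) (by omega) he _ (fun _ => le_rfl)
    (fun hk => (h.mono (k + 1) (by omega) hk).le) fun _ => trivial

/-- The signs on a common subdivision of `F` and `G` into `K` cells with starts `x`: the flag `w k`
is `0` if `G ≤ F` on cell `k`, and otherwise `F < G` inside cell `k`. The last cell is considered
only where `ub` holds. -/
def SignsTo (K : ℕ) (w : ℕ → ℕ) (x : ℕ → ℝ) (ub : ℝ → Prop) (F G : ℝ → ℝ) : Prop :=
  ∀ k < K, (w k = 0 → ∀ t, (0 < k → x k ≤ t) → (k + 1 < K → t ≤ x (k + 1)) →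
      (k + 1 = K → ub t) → G t ≤ F t) ∧
    (w k ≠ 0 → ∀ t, (0 < k → x k < t) → (k + 1 < K → t < x (k + 1)) →
      (k + 1 = K → ub t) → F t < G t)

theorem SignsTo.push {K : ℕ} {w : ℕ → ℕ} {x : ℕ → ℝ} {ub ub' : ℝ → Prop} {F G : ℝ → ℝ}
    (h : SignsTo K w x ub F G) {v : ℕ} {y : ℝ}
    (hub : ∀ t, (1 < K → x (K - 1) ≤ t) → t ≤ y → w (K - 1) = 0 → G t ≤ F t)
    (hub' : ∀ t, (1 < K → x (K - 1) < t) → t < y → w (K - 1) ≠ 0 → F t < G t)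
    (h0 : v = 0 → ∀ t, y ≤ t → ub' t → G t ≤ F t)
    (h1 : v ≠ 0 → ∀ t, y < t → ub' t → F t < G t) (hK : 0 < K) :
    SignsTo (K + 1) (Function.update w K v) (Function.update x K y) ub' F G := by
  intro k hk
  rcases eq_or_ne k K with rfl | hne
  · simp only [Function.update_self]
    exact ⟨fun h' t ht _ hu => h0 h' t (ht hK) (hu trivial),
      fun h' t ht _ hu => h1 h' t (ht hK) (hu trivial)⟩
  · rw [Function.update_of_ne hne, Function.update_of_ne hne]
    rcases eq_or_ne (k + 1) K with rfl | hne'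
    · simp only [Function.update_self]
      refine ⟨fun h' t ht hu _ => hub t (fun h => ?_) (hu (by omega)) h',
        fun h' t ht hu _ => hub' t (fun h => ?_) (hu (by omega)) h'⟩
      · exact ht (by omega)
      · exact ht (by omega)
    · rw [Function.update_of_ne hne']
      refine ⟨fun h' t ht hu _ => (h k (by omega)).1 h' t ht (fun hk' => hu (by omega)) (by omega),
        fun h' t ht hu _ => (h k (by omega)).2 h' t ht (fun hk' => hu (by omega)) (by omega)⟩

/-- Completing the claim about the last cell. -/
theorem SignsTo.finish {K : ℕ} {w : ℕ → ℕ} {x : ℕ → ℝ} {ub ub' : ℝ → Prop} {F G : ℝ → ℝ}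
    (h : SignsTo (K + 1) w x ub F G)
    (h0 : w K = 0 → ∀ t, (0 < K → x K ≤ t) → ub' t → G t ≤ F t)
    (h1 : w K ≠ 0 → ∀ t, (0 < K → x K < t) → ub' t → F t < G t) :
    SignsTo (K + 1) w x ub' F G := by
  intro k hk
  rcases eq_or_ne k K with rfl | hne
  · exact ⟨fun h' t ht _ hu => h0 h' t ht (hu rfl), fun h' t ht _ hu => h1 h' t ht (hu rfl)⟩
  · exact ⟨fun h' t ht hu _ => (h k hk).1 h' t ht hu (by omega),
      fun h' t ht hu _ => (h k hk).2 h' t ht hu (by omega)⟩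

/-! ### Overlaying two piecewise linear functions -/

namespace RealRAM

/-!
The arrays of the memory; names that begin with `a` stand for arrays, and names that begin with `v`
for variables. Arrays of real numbers and of natural numbers are numbered independently.

* `aM`, `aC`, `aX`: slopes, intercepts and left ends of the pieces of all piecewise linear functions
  that have been computed; the variable `vO` counts these pieces.
* `aS`: the functions are stored in consecutive blocks of pieces, and block `b` starts at piece
  `aS b`; the variable `vN` counts the input functions, and `vT` the merges.
* `aE`, `aFM`, `aFC`, `aGM`, `aGC`, `aW`: the cells of an overlay of two functions `F` and `G`, that
  is, their left ends, slope and intercept of `F` and of `G` on them, and the signs as in `SignsTo`;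
  the variable `vK` counts the cells.
* `vP`, `vPE`, `vQ`, `vQE`: the current piece of `F` and the end of its block, and the same for `G`.
* `vE`, `vHas`: the next event of the sweep, and whether there is any.
* `vXC`, `vCross`: the next crossing of `F` and `G`, and whether there is any.
* `vI`, `vJ`: loop counters.
-/

@[simp] abbrev aM : ℕ := 10
@[simp] abbrev aC : ℕ := 11
@[simp] abbrev aX : ℕ := 12
@[simp] abbrev aE : ℕ := 13
@[simp] abbrev aFM : ℕ := 14
@[simp] abbrev aFC : ℕ := 15
@[simp] abbrev aGM : ℕ := 16
@[simp] abbrev aGC : ℕ := 17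
@[simp] abbrev vE : ℕ := 18
@[simp] abbrev vXC : ℕ := 19
@[simp] abbrev vN : ℕ := 10
@[simp] abbrev aS : ℕ := 11
@[simp] abbrev vT : ℕ := 12
@[simp] abbrev vI : ℕ := 13
@[simp] abbrev vO : ℕ := 15
@[simp] abbrev vP : ℕ := 20
@[simp] abbrev vPE : ℕ := 21
@[simp] abbrev vQ : ℕ := 22
@[simp] abbrev vQE : ℕ := 23
@[simp] abbrev vK : ℕ := 24
@[simp] abbrev aW : ℕ := 25
@[simp] abbrev vCross : ℕ := 26
@[simp] abbrev vHas : ℕ := 27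
@[simp] abbrev vJ : ℕ := 28

abbrev one : NExp := .const 1

/-! The current pieces of `F` and `G`, and their right ends if they have any. -/

abbrev hasF : Test := nv vP +ₙ one <ₙ nv vPE
abbrev hasG : Test := nv vQ +ₙ one <ₙ nv vQE
abbrev nextF : RExp := .get aX (nv vP +ₙ one)
abbrev nextG : RExp := .get aX (nv vQ +ₙ one)
abbrev slF : RExp := .get aM (nv vP)
abbrev icF : RExp := .get aC (nv vP)
abbrev slG : RExp := .get aM (nv vQ)
abbrev icG : RExp := .get aC (nv vQ)

/-- Write the lines of the current cell. -/
def recordCell : Prog :=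
  .setReal aFM (nv vK) slF ;; .setReal aFC (nv vK) icF ;;
  .setReal aGM (nv vK) slG ;; .setReal aGC (nv vK) icG

/-- Find out whether the two lines cross further to the right, and where. The sign of the cell tells
which line is above; if the lines are parallel, then `vXC` is set to a junk value that is not
used. -/
def findCross : Prog :=
  .ite (.get aW (nv vK) <ₙ one)
    (.ite (slF <ᵣ slG) (setN vCross one) (setN vCross (.const 0)))
    (.ite (slG <ᵣ slF) (setN vCross one) (setN vCross (.const 0))) ;;
  setR vXC ((icG -ᵣ icF) /ᵣ (slF -ᵣ slG))

/-- Record the leftmost cell, whose sign is determined by the slopes, and by the intercepts if the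
slopes agree. -/
def overlayInit : Prog :=
  setN vK (.const 0) ;; recordCell ;;
  .ite (.or (slF <ᵣ slG) (.and (.not (slG <ᵣ slF)) (.not (icF <ᵣ icG))))
    (.setNat aW (nv vK) (.const 0)) (.setNat aW (nv vK) one) ;;
  findCross

/-- Find the next event: the first of the next breakpoints of `F` and `G` and the next crossing. -/
def nextEvent : Prog :=
  setN vHas (.const 0) ;;
  .ite (.const 0 <ₙ nv vCross) (setR vE (rv vXC) ;; setN vHas one) .skip ;;
  .ite (.and hasF (.not (.and (.const 0 <ₙ nv vHas) (rv vE <ᵣ nextF))))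
    (setR vE nextF ;; setN vHas one) .skip ;;
  .ite (.and hasG (.not (.and (.const 0 <ₙ nv vHas) (rv vE <ᵣ nextG))))
    (setR vE nextG ;; setN vHas one) .skip

/-- Advance the pointers whose pieces end at the event. -/
def advance : Prog :=
  .ite (.and hasF (.not (rv vE <ᵣ nextF))) (setN vP (nv vP +ₙ one)) .skip ;;
  .ite (.and hasG (.not (rv vE <ᵣ nextG))) (setN vQ (nv vQ +ₙ one)) .skip

abbrev valF : RExp := slF *ᵣ rv vE +ᵣ icF
abbrev valG : RExp := slG *ᵣ rv vE +ᵣ icG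

/-- Record the cell that starts at the event. Its sign is determined by the values at the event, and
by the slopes if the values agree. -/
def startCell : Prog :=
  setN vK (nv vK +ₙ one) ;; .setReal aE (nv vK) (rv vE) ;; recordCell ;;
  .ite (.or (valG <ᵣ valF) (.and (.not (valF <ᵣ valG)) (.not (slF <ᵣ slG))))
    (.setNat aW (nv vK) (.const 0)) (.setNat aW (nv vK) one) ;;
  findCross

def overlayLoop : Prog :=
  .while (.or (.or hasF hasG) (.const 0 <ₙ nv vCross)) (nextEvent ;; advance ;; startCell)

/-- Compute the common subdivision of two blocks into cells without sign changes of `F - G`. -/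
def overlay : Prog := overlayInit ;; overlayLoop

/-- The part of the loop invariant that concerns the current cell: `k` is its index, it starts at
`y`, and the current pieces of `F` and `G` are `p` and `q`. The flag `cross` tells whether the two
lines cross to the right of `y`, and `xc` is the crossing. -/
structure OverlayCell (eF eG : ℕ) (M C X : ℕ → ℝ) (p q k : ℕ) (y : ℝ) (w cross : ℕ) (xc : ℝ) :
    Prop where
  ltF : 0 < k → p + 1 < eF → y < X (p + 1)
  ltG : 0 < k → q + 1 < eG → y < X (q + 1)
  ge : w = 0 → ∀ t, (0 < k → y ≤ t) → (0 < cross → t ≤ xc) → M q * t + C q ≤ M p * t + C p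
  lt : w ≠ 0 → ∀ t, (0 < k → y < t) → (0 < cross → t < xc) → M p * t + C p < M q * t + C q
  cross_lt : 0 < k → 0 < cross → y < xc
  cross_le : cross ≤ 1
  cross_eq : 0 < cross → M p * xc + C p = M q * xc + C q

/-- The invariant of the overlay loop. The current cell is known to be correct only up to the next
breakpoint. Every breakpoint can create one crossing, so that it counts twice in `size`. -/
structure OverlayInv (sF eF sG eG : ℕ) (M C X : ℕ → ℝ) (F G : ℝ → ℝ) (σ : State) : Prop where
  arrM : σ.real aM = M
  arrC : σ.real aC = C
  arrX : σ.real aX = X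
  endF : σ.nat vPE 0 = eF
  endG : σ.nat vQE 0 = eG
  leF : sF ≤ σ.nat vP 0
  ltF : σ.nat vP 0 < eF
  leG : sG ≤ σ.nat vQ 0
  ltG : σ.nat vQ 0 < eG
  startF : sF < σ.nat vP 0 → 0 < σ.nat vK 0 ∧ X (σ.nat vP 0) ≤ σ.real aE (σ.nat vK 0)
  startG : sG < σ.nat vQ 0 → 0 < σ.nat vK 0 ∧ X (σ.nat vQ 0) ≤ σ.real aE (σ.nat vK 0)
  plF : IsPLTo 0 (σ.nat vK 0 + 1) (σ.real aFM) (σ.real aFC) (σ.real aE)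
    (fun t => (σ.nat vP 0 + 1 < eF → t ≤ X (σ.nat vP 0 + 1))) F
  plG : IsPLTo 0 (σ.nat vK 0 + 1) (σ.real aGM) (σ.real aGC) (σ.real aE)
    (fun t => (σ.nat vQ 0 + 1 < eG → t ≤ X (σ.nat vQ 0 + 1))) G
  signs : SignsTo (σ.nat vK 0 + 1) (σ.nat aW) (σ.real aE) (fun _ => False) F G
  cell : OverlayCell eF eG M C X (σ.nat vP 0) (σ.nat vQ 0) (σ.nat vK 0)
    (σ.real aE (σ.nat vK 0)) (σ.nat aW (σ.nat vK 0)) (σ.nat vCross 0) (σ.real vXC 0)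
  size : σ.nat vK 0 + (2 * (eF - 1 - σ.nat vP 0) + 2 * (eG - 1 - σ.nat vQ 0) + σ.nat vCross 0) ≤
    2 * (eF - 1 - sF) + 2 * (eG - 1 - sG) + 1

theorem OverlayInv.congr {sF eF sG eG : ℕ} {M C X : ℕ → ℝ} {F G : ℝ → ℝ} {σ τ : State}
    (h : OverlayInv sF eF sG eG M C X F G σ) (hf : Frame [vHas] [vE] σ τ) :
    OverlayInv sF eF sG eG M C X F G τ := by
  have n : ∀ a, a ∉ [vHas] → τ.nat a = σ.nat a := hf.nat
  have r : ∀ a, a ∉ [vE] → τ.real a = σ.real a := hf.real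
  cases h
  constructor <;>
  simpa only [n vP (by simp), n vPE (by simp), n vQ (by simp), n vQE (by simp), n vK (by simp),
    n aW (by simp), n vCross (by simp), r aM (by simp), r aC (by simp), r aX (by simp),
    r aE (by simp), r aFM (by simp), r aFC (by simp), r aGM (by simp), r aGC (by simp),
    r vXC (by simp)]

/-- The next event `e` is the first of the next breakpoints and the next crossing. -/
structure IsNextEvent (eF eG : ℕ) (X : ℕ → ℝ) (p q cross : ℕ) (xc e : ℝ) : Prop where
  leF : p + 1 < eF → e ≤ X (p + 1)
  leG : q + 1 < eG → e ≤ X (q + 1)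
  le_cross : 0 < cross → e ≤ xc
  eq : (p + 1 < eF ∧ e = X (p + 1)) ∨ (q + 1 < eG ∧ e = X (q + 1)) ∨ (0 < cross ∧ e = xc)

theorem wp_nextEvent {σ : State}
    (h : σ.nat vP 0 + 1 < σ.nat vPE 0 ∨ σ.nat vQ 0 + 1 < σ.nat vQE 0 ∨ 0 < σ.nat vCross 0) :
    wp nextEvent (fun τ => IsNextEvent (σ.nat vPE 0) (σ.nat vQE 0) (σ.real aX) (σ.nat vP 0)
      (σ.nat vQ 0) (σ.nat vCross 0) (σ.real vXC 0) (τ.real vE 0)) σ := by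
  simp [nextEvent]
  refine ⟨fun h1 => ⟨fun h2 h3 => ⟨fun h4 h5 => ?_, fun h4 => ?_⟩,
    fun h2 => ⟨fun h4 h5 => ?_, fun h4 => ?_⟩⟩, fun h1 =>
    ⟨fun h2 => ⟨fun h4 h5 => ?_, fun h4 => ?_⟩, fun h2 => ⟨fun h4 => ?_, fun h4 => ?_⟩⟩⟩
  all_goals
    simp only [vP, vPE, vQ, vQE, vCross] at h
    constructor <;> grind

/-- The state between two cells of the overlay: the cell `k` ends at the event `e`, and the
pointers have been advanced. -/
structure OverlayMid (sF eF sG eG : ℕ) (M C X : ℕ → ℝ) (F G : ℝ → ℝ) (σ : State) : Prop where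
  arrM : σ.real aM = M
  arrC : σ.real aC = C
  arrX : σ.real aX = X
  endF : σ.nat vPE 0 = eF
  endG : σ.nat vQE 0 = eG
  leF : sF ≤ σ.nat vP 0
  ltF : σ.nat vP 0 < eF
  leG : sG ≤ σ.nat vQ 0
  ltG : σ.nat vQ 0 < eG
  startF : sF < σ.nat vP 0 → X (σ.nat vP 0) ≤ σ.real vE 0
  startG : sG < σ.nat vQ 0 → X (σ.nat vQ 0) ≤ σ.real vE 0
  nextF : σ.nat vP 0 + 1 < eF → σ.real vE 0 < X (σ.nat vP 0 + 1)
  nextG : σ.nat vQ 0 + 1 < eG → σ.real vE 0 < X (σ.nat vQ 0 + 1)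
  plF : IsPLTo 0 (σ.nat vK 0 + 1) (σ.real aFM) (σ.real aFC) (σ.real aE)
    (fun t => t ≤ σ.real vE 0) F
  plG : IsPLTo 0 (σ.nat vK 0 + 1) (σ.real aGM) (σ.real aGC) (σ.real aE)
    (fun t => t ≤ σ.real vE 0) G
  signs : SignsTo (σ.nat vK 0 + 1) (σ.nat aW) (σ.real aE) (fun _ => False) F G
  lt : 0 < σ.nat vK 0 → σ.real aE (σ.nat vK 0) < σ.real vE 0
  sign_zero : σ.nat aW (σ.nat vK 0) = 0 → ∀ t, (0 < σ.nat vK 0 → σ.real aE (σ.nat vK 0) ≤ t) →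
    t ≤ σ.real vE 0 → G t ≤ F t
  sign_one : σ.nat aW (σ.nat vK 0) ≠ 0 → ∀ t, (0 < σ.nat vK 0 → σ.real aE (σ.nat vK 0) < t) →
    t < σ.real vE 0 → F t < G t
  size : σ.nat vK 0 + 1 + (2 * (eF - 1 - σ.nat vP 0) + 2 * (eG - 1 - σ.nat vQ 0) + 1) ≤
      2 * (eF - 1 - sF) + 2 * (eG - 1 - sG) + 1 ∨
    (M (σ.nat vP 0) * σ.real vE 0 + C (σ.nat vP 0) = M (σ.nat vQ 0) * σ.real vE 0 + C (σ.nat vQ 0)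
      ∧ σ.nat vK 0 + 1 + (2 * (eF - 1 - σ.nat vP 0) + 2 * (eG - 1 - σ.nat vQ 0)) ≤
        2 * (eF - 1 - sF) + 2 * (eG - 1 - sG) + 1)

theorem wp_advance {sF eF sG eG : ℕ} {M C X : ℕ → ℝ} {F G : ℝ → ℝ} {σ : State}
    (hF : IsPL sF eF M C X F) (hG : IsPL sG eG M C X G)
    (h : OverlayInv sF eF sG eG M C X F G σ)
    (he : IsNextEvent eF eG X (σ.nat vP 0) (σ.nat vQ 0) (σ.nat vCross 0) (σ.real vXC 0)
      (σ.real vE 0)) :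
    wp advance (OverlayMid sF eF sG eG M C X F G) σ := by
  have hc := h.cell
  have hsz := h.size
  have hple : 0 < σ.nat vK 0 → σ.real aE (σ.nat vK 0) < σ.real vE 0 := by
    intro hk
    rcases he.eq with ⟨h1, h2⟩ | ⟨h1, h2⟩ | ⟨h1, h2⟩
    · rw [h2]; exact hc.ltF hk h1
    · rw [h2]; exact hc.ltG hk h1
    · rw [h2]; exact hc.cross_lt hk h1
  have evF : ∀ t, (0 < σ.nat vK 0 → σ.real aE (σ.nat vK 0) ≤ t) → t ≤ σ.real vE 0 →
      F t = M (σ.nat vP 0) * t + C (σ.nat vP 0) := fun t ht ht' =>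
    hF.eval _ h.leF h.ltF t (fun hs => (h.startF hs).2.trans (ht (h.startF hs).1))
      (fun hs => ht'.trans (he.leF hs)) fun _ => trivial
  have evG : ∀ t, (0 < σ.nat vK 0 → σ.real aE (σ.nat vK 0) ≤ t) → t ≤ σ.real vE 0 →
      G t = M (σ.nat vQ 0) * t + C (σ.nat vQ 0) := fun t ht ht' =>
    hG.eval _ h.leG h.ltG t (fun hs => (h.startG hs).2.trans (ht (h.startG hs).1))
      (fun hs => ht'.trans (he.leG hs)) fun _ => trivial
  have hE0 : σ.nat vK 0 = 0 ∨ 0 < σ.nat vK 0 := by omega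
  -- the conditions on the new pointers, separately for the two functions
  have key : ∀ p q, (p = σ.nat vP 0 ∧ (p + 1 < eF → σ.real vE 0 < X (p + 1)) ∨
        p = σ.nat vP 0 + 1 ∧ p < eF ∧ X p ≤ σ.real vE 0) →
      (q = σ.nat vQ 0 ∧ (q + 1 < eG → σ.real vE 0 < X (q + 1)) ∨
        q = σ.nat vQ 0 + 1 ∧ q < eG ∧ X q ≤ σ.real vE 0) →
      ∀ τ : State, τ.nat vP 0 = p → τ.nat vQ 0 = q → (∀ a, a ∉ [vP, vQ] → τ.nat a = σ.nat a) →
        τ.real = σ.real → OverlayMid sF eF sG eG M C X F G τ := by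
    intro p q hp hq τ tp tq tn tr
    have n := fun a => tn a
    have hpF : p < eF := by have := h.ltF; omega
    have hqG : q < eG := by have := h.ltG; omega
    constructor <;> simp only [tr, tp, tq, n vPE (by simp), n vQE (by simp), n vK (by simp),
      n aW (by simp)]
    · exact h.arrM
    · exact h.arrC
    · exact h.arrX
    · exact h.endF
    · exact h.endG
    · have := h.leF; omega
    · exact hpF
    · have := h.leG; omega
    · exact hqG
    · rcases hp with ⟨rfl, -⟩ | ⟨-, -, hp⟩
      · exact fun hs => (h.startF hs).2.trans (hple (h.startF hs).1).le
      · exact fun _ => hp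
    · rcases hq with ⟨rfl, -⟩ | ⟨-, -, hq⟩
      · exact fun hs => (h.startG hs).2.trans (hple (h.startG hs).1).le
      · exact fun _ => hq
    · rcases hp with ⟨-, hp⟩ | ⟨hp1, -, hp⟩
      · exact hp
      · have h1 := he.leF (by omega)
        have := h.leF
        exact fun hs => lt_of_le_of_lt (by rwa [← hp1] at h1) (hF.mono p (by omega) hs)
    · rcases hq with ⟨-, hq⟩ | ⟨hq1, -, hq⟩
      · exact hq
      · have h1 := he.leG (by omega)
        have := h.leG
        exact fun hs => lt_of_le_of_lt (by rwa [← hq1] at h1) (hG.mono q (by omega) hs)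
    · exact h.plF.mono_ub fun t ht hs => ht.trans (he.leF hs)
    · exact h.plG.mono_ub fun t ht hs => ht.trans (he.leG hs)
    · exact h.signs
    · exact hple
    · intro hw t ht ht'
      rw [evF t ht ht', evG t ht ht']
      exact hc.ge hw t ht fun hcr => ht'.trans (he.le_cross hcr)
    · intro hw t ht ht'
      rw [evF t (fun hk => (ht hk).le) ht'.le, evG t (fun hk => (ht hk).le) ht'.le]
      exact hc.lt hw t ht fun hcr => ht'.trans_le (he.le_cross hcr)
    · have := hc.cross_le
      rcases he.eq with ⟨h1, h2⟩ | ⟨h1, h2⟩ | ⟨h1, h2⟩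
      · have : p = σ.nat vP 0 + 1 := by
          rcases hp with ⟨rfl, h3⟩ | ⟨h3, -⟩
          · exact absurd (h3 h1) (by rw [h2]; exact lt_irrefl _)
          · exact h3
        left; omega
      · have : q = σ.nat vQ 0 + 1 := by
          rcases hq with ⟨rfl, h3⟩ | ⟨h3, -⟩
          · exact absurd (h3 h1) (by rw [h2]; exact lt_irrefl _)
          · exact h3
        left; omega
      · rcases hp with ⟨rfl, -⟩ | ⟨hp, -⟩
        · rcases hq with ⟨rfl, -⟩ | ⟨hq, -⟩
          · right
            refine ⟨?_, by omega⟩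
            rw [h2]
            exact hc.cross_eq h1
          · left; omega
        · left; omega
  have e1 := h.endF
  have e2 := h.endG
  have e3 := h.arrX
  simp only [vP, vQ, vE, vPE, vQE, aX] at key e1 e2 e3
  simp [advance, e1, e2, e3]
  refine ⟨fun h1 h2 => ⟨fun h3 h4 => ?_, fun h3 => ?_⟩, fun h1 => ⟨fun h3 h4 => ?_, fun h3 => ?_⟩⟩
  · refine key _ _ (.inr ⟨rfl, h1, h2⟩) (.inr ⟨rfl, h3, h4⟩) _ (by simp) (by simp) ?_ (by simp)
    intro a ha; simp at ha; simp [ha]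
  · refine key _ _ (.inr ⟨rfl, h1, h2⟩) (.inl ⟨rfl, h3⟩) _ (by simp) (by simp) ?_ (by simp)
    intro a ha; simp at ha; simp [ha]
  · refine key _ _ (.inl ⟨rfl, h1⟩) (.inr ⟨rfl, h3, h4⟩) _ (by simp) (by simp) ?_ (by simp)
    intro a ha; simp at ha; simp [ha]
  · exact key _ _ (.inl ⟨rfl, h1⟩) (.inl ⟨rfl, h3⟩) _ rfl rfl (fun _ _ => rfl) rfl

theorem crossing {a b a' b' : ℝ} (h : a ≠ a') :
    a * ((b' - b) / (a - a')) + b = a' * ((b' - b) / (a - a')) + b' := by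
  have : a - a' ≠ 0 := sub_ne_zero.2 h
  field_simp
  ring

/-- A cell with sign `0`, by the criterion of `startCell` if `0 < k`, and by the criterion of
`overlayInit` if `k = 0`. -/
theorem overlayCell_zero {eF eG : ℕ} {M C X : ℕ → ℝ} {p q k : ℕ} {y : ℝ} {cross : ℕ}
    (ltF : 0 < k → p + 1 < eF → y < X (p + 1)) (ltG : 0 < k → q + 1 < eG → y < X (q + 1))
    (hk : 0 < k → M q * y + C q ≤ M p * y + C p ∧
      (M p * y + C p ≤ M q * y + C q → M q ≤ M p))
    (h0 : k = 0 → M p < M q ∨ M q ≤ M p ∧ M p ≤ M q ∧ C q ≤ C p)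
    (hc : cross = 1 ∧ M p < M q ∨ cross = 0 ∧ M q ≤ M p) :
    OverlayCell eF eG M C X p q k y 0 cross ((C q - C p) / (M p - M q)) := by
  have cr := fun h : M p < M q => crossing (b := C p) (b' := C q) h.ne
  refine ⟨ltF, ltG, fun _ t h1 h2 => ?_, by simp, fun h1 h2 => ?_, by omega, fun h1 => ?_⟩
  · rcases hc with ⟨rfl, hc⟩ | ⟨rfl, hc⟩
    · nlinarith [cr hc, mul_nonneg (sub_nonneg.2 hc.le) (sub_nonneg.2 (h2 one_pos))]
    · rcases Nat.eq_zero_or_pos k with hk0 | hk0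
      · rcases h0 hk0 with h | ⟨-, h, h'⟩
        · linarith
        · rw [le_antisymm hc h]; linarith
      · nlinarith [(hk hk0).1, mul_nonneg (sub_nonneg.2 hc) (sub_nonneg.2 (h1 hk0))]
  · rcases hc with ⟨rfl, hc⟩ | ⟨rfl, hc⟩
    · obtain ⟨h3, h4⟩ := hk h1
      have h5 : M q * y + C q < M p * y + C p := by
        rcases h3.lt_or_eq with h | h
        · exact h
        · exact absurd (h4 h.ge) (not_le.2 hc)
      by_contra h6
      nlinarith [cr hc, mul_nonneg (sub_nonneg.2 hc.le) (sub_nonneg.2 (not_lt.1 h6))]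
    · omega
  · rcases hc with ⟨rfl, hc⟩ | ⟨rfl, hc⟩
    · exact cr hc
    · omega

/-- A cell with sign `1`, by the same criteria. -/
theorem overlayCell_one {eF eG : ℕ} {M C X : ℕ → ℝ} {p q k : ℕ} {y : ℝ} {cross : ℕ}
    (ltF : 0 < k → p + 1 < eF → y < X (p + 1)) (ltG : 0 < k → q + 1 < eG → y < X (q + 1))
    (hk : 0 < k → M p * y + C p ≤ M q * y + C q ∧
      (M q * y + C q ≤ M p * y + C p → M p < M q))
    (h0 : k = 0 → M q ≤ M p ∧ (M p ≤ M q → C p < C q))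
    (hc : cross = 1 ∧ M q < M p ∨ cross = 0 ∧ M p ≤ M q) :
    OverlayCell eF eG M C X p q k y 1 cross ((C q - C p) / (M p - M q)) := by
  have cr := fun h : M q < M p => crossing (b := C p) (b' := C q) h.ne'
  refine ⟨ltF, ltG, by simp, fun _ t h1 h2 => ?_, fun h1 h2 => ?_, by omega, fun h1 => ?_⟩
  · rcases hc with ⟨rfl, hc⟩ | ⟨rfl, hc⟩
    · nlinarith [cr hc, mul_pos (sub_pos.2 hc) (sub_pos.2 (h2 one_pos))]
    · rcases Nat.eq_zero_or_pos k with hk0 | hk0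
      · have h := (h0 hk0).2 hc
        rw [le_antisymm hc (h0 hk0).1]
        linarith
      · obtain ⟨h3, h4⟩ := hk hk0
        rcases h3.lt_or_eq with h | h
        · nlinarith [mul_nonneg (sub_nonneg.2 hc) (sub_nonneg.2 (h1 hk0).le)]
        · nlinarith [mul_pos (sub_pos.2 (h4 h.ge)) (sub_pos.2 (h1 hk0))]
  · rcases hc with ⟨rfl, hc⟩ | ⟨rfl, hc⟩
    · obtain ⟨h3, h4⟩ := hk h1
      have h5 : M p * y + C p < M q * y + C q := by
        rcases h3.lt_or_eq with h | h
        · exact h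
        · exact absurd (h4 h.ge) (not_lt.2 hc.le)
      by_contra h6
      nlinarith [cr hc, mul_nonneg (sub_nonneg.2 hc.le) (sub_nonneg.2 (not_lt.1 h6))]
    · omega
  · rcases hc with ⟨rfl, hc⟩ | ⟨rfl, hc⟩
    · exact cr hc
    · omega

theorem wp_startCell {sF eF sG eG : ℕ} {M C X : ℕ → ℝ} {F G : ℝ → ℝ} {σ : State}
    (hF : IsPL sF eF M C X F) (hG : IsPL sG eG M C X G)
    (h : OverlayMid sF eF sG eG M C X F G σ) :
    wp startCell (fun τ => OverlayInv sF eF sG eG M C X F G τ ∧ τ.nat vK 0 = σ.nat vK 0 + 1) σ := by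
  have key : ∀ w cross, OverlayCell eF eG M C X (σ.nat vP 0) (σ.nat vQ 0) (σ.nat vK 0 + 1)
        (σ.real vE 0) w cross ((C (σ.nat vQ 0) - C (σ.nat vP 0)) /
          (M (σ.nat vP 0) - M (σ.nat vQ 0))) →
      (cross = 1 → M (σ.nat vP 0) * σ.real vE 0 + C (σ.nat vP 0) =
        M (σ.nat vQ 0) * σ.real vE 0 + C (σ.nat vQ 0) → False) → w ≤ 1 →
      OverlayInv sF eF sG eG M C X F G
        (((((((((σ.setNat vK 0 (σ.nat vK 0 + 1)).setReal aE (σ.nat vK 0 + 1) (σ.real vE 0)).setReal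
          aFM (σ.nat vK 0 + 1) (M (σ.nat vP 0))).setReal aFC (σ.nat vK 0 + 1)
          (C (σ.nat vP 0))).setReal aGM (σ.nat vK 0 + 1) (M (σ.nat vQ 0))).setReal
          aGC (σ.nat vK 0 + 1) (C (σ.nat vQ 0))).setNat aW (σ.nat vK 0 + 1) w).setNat
          vCross 0 cross).setReal vXC 0 ((C (σ.nat vQ 0) - C (σ.nat vP 0)) /
          (M (σ.nat vP 0) - M (σ.nat vQ 0)))) := by
    intro w cross hcell hcr hw
    have hev := hcell.cross_le
    have evF : ∀ t, σ.real vE 0 ≤ t → (σ.nat vP 0 + 1 < eF → t ≤ X (σ.nat vP 0 + 1)) →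
        F t = M (σ.nat vP 0) * t + C (σ.nat vP 0) := fun t ht ht' =>
      hF.eval _ h.leF h.ltF t (fun hs => (h.startF hs).trans ht) ht' fun _ => trivial
    have evG : ∀ t, σ.real vE 0 ≤ t → (σ.nat vQ 0 + 1 < eG → t ≤ X (σ.nat vQ 0 + 1)) →
        G t = M (σ.nat vQ 0) * t + C (σ.nat vQ 0) := fun t ht ht' =>
      hG.eval _ h.leG h.ltG t (fun hs => (h.startG hs).trans ht) ht' fun _ => trivial
    constructor <;> simp
    · exact h.arrM
    · exact h.arrC
    · exact h.arrX
    · exact h.endF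
    · exact h.endG
    · exact h.leF
    · exact h.ltF
    · exact h.leG
    · exact h.ltG
    · exact h.startF
    · exact h.startG
    · exact h.plF.push (fun h' => by simpa using h.lt (by omega)) (fun t _ ht => ht) evF
    · exact h.plG.push (fun h' => by simpa using h.lt (by omega)) (fun t _ ht => ht) evG
    · refine h.signs.push (fun t h1 h2 h3 => ?_) (fun t h1 h2 h3 => ?_) (by simp) (by simp)
        (by omega)
      · exact h.sign_zero (by simpa using h3) t (fun hk => by simpa using h1 (by omega)) h2
      · exact h.sign_one (by simpa using h3) t (fun hk => by simpa using h1 (by omega)) h2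
    · exact hcell
    · rcases h.size with h1 | ⟨h1, h2⟩
      · simp only [vP, vQ, vK] at h1; omega
      · have : cross ≠ 1 := fun h3 => hcr h3 h1
        simp only [vP, vQ, vK] at h2; omega
  have e1 := h.arrM
  have e2 := h.arrC
  have hF' := h.nextF
  have hG' := h.nextG
  simp only [vP, vQ, vE, vK, aM, aC, aFM, aFC, aGM, aGC, aE, aW, vCross, vXC] at key e1 e2 hF' hG'
  simp [startCell, recordCell, findCross, e1, e2]
  refine ⟨fun h1 => ⟨fun h2 => ?_, fun h2 => ?_⟩, fun h0 h1 => ⟨fun h2 => ?_, fun h2 => ?_⟩⟩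
  · refine key 0 1 (overlayCell_zero (fun _ => hF') (fun _ => hG') (fun _ => ?_) (by omega)
      (.inl ⟨rfl, h2⟩)) (fun _ h3 => ?_) (by omega)
    · by_cases h3 : M (σ.nat 20 0) * σ.real 18 0 + C (σ.nat 20 0) ≤
        M (σ.nat 22 0) * σ.real 18 0 + C (σ.nat 22 0)
      · exact ⟨(h1 h3).1, fun _ => (h1 h3).2⟩
      · exact ⟨(not_le.1 h3).le, fun h => absurd h h3⟩
    · exact absurd (h1 h3.le).2 (not_le.2 h2)
  · refine key 0 0 (overlayCell_zero (fun _ => hF') (fun _ => hG') (fun _ => ?_) (by omega)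
      (.inr ⟨rfl, h2⟩)) (by omega) (by omega)
    by_cases h3 : M (σ.nat 20 0) * σ.real 18 0 + C (σ.nat 20 0) ≤
        M (σ.nat 22 0) * σ.real 18 0 + C (σ.nat 22 0)
    · exact ⟨(h1 h3).1, fun _ => (h1 h3).2⟩
    · exact ⟨(not_le.1 h3).le, fun h => absurd h h3⟩
  · refine key 1 1 (overlayCell_one (fun _ => hF') (fun _ => hG') (fun _ => ⟨h0, h1⟩) (by omega)
      (.inl ⟨rfl, h2⟩)) (fun _ h3 => ?_) (by omega)
    exact absurd (h1 h3.ge) (not_lt.2 h2.le)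
  · exact key 1 0 (overlayCell_one (fun _ => hF') (fun _ => hG') (fun _ => ⟨h0, h1⟩) (by omega)
      (.inr ⟨rfl, h2⟩)) (by omega) (by omega)

theorem wp_overlayInit {sF eF sG eG : ℕ} {M C X : ℕ → ℝ} {F G : ℝ → ℝ} {σ : State}
    (hF : IsPL sF eF M C X F) (hG : IsPL sG eG M C X G)
    (arrM : σ.real aM = M) (arrC : σ.real aC = C) (arrX : σ.real aX = X)
    (hp : σ.nat vP 0 = sF) (hpe : σ.nat vPE 0 = eF) (hq : σ.nat vQ 0 = sG)
    (hqe : σ.nat vQE 0 = eG) :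
    wp overlayInit (fun τ => OverlayInv sF eF sG eG M C X F G τ ∧ τ.nat vK 0 = 0) σ := by
  have key : ∀ w cross, OverlayCell eF eG M C X sF sG 0 (σ.real aE 0) w cross
        ((C sG - C sF) / (M sF - M sG)) →
      OverlayInv sF eF sG eG M C X F G
        ((((((((σ.setNat vK 0 0).setReal aFM 0 (M sF)).setReal aFC 0 (C sF)).setReal aGM 0
          (M sG)).setReal aGC 0 (C sG)).setNat aW 0 w).setNat vCross 0 cross).setReal vXC 0
          ((C sG - C sF) / (M sF - M sG))) := by
    intro w cross hcell
    have hev := hcell.cross_le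
    simp only [vP, vPE, vQ, vQE] at hp hpe hq hqe
    constructor <;> simp [hp, hq, hpe, hqe]
    · exact arrM
    · exact arrC
    · exact arrX
    · exact hF.lt
    · exact hG.lt
    · refine IsPLTo.single fun t ht => ?_
      simpa using hF.eval sF le_rfl hF.lt t (by omega) ht fun _ => trivial
    · refine IsPLTo.single fun t ht => ?_
      simpa using hG.eval sG le_rfl hG.lt t (by omega) ht fun _ => trivial
    · intro k hk
      obtain rfl : k = 0 := by omega
      simp
    · exact hcell
    · omega
  simp only [vP, vPE, vQ, vQE, vK, aM, aC, aX, aFM, aFC, aGM, aGC, aE, aW, vCross, vXC]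
    at key arrM arrC arrX hp hpe hq hqe
  simp [overlayInit, recordCell, findCross, arrM, arrC, hp, hq]
  refine ⟨fun h1 => ⟨fun h2 => ?_, fun h2 => ?_⟩, fun h0 h1 => ⟨fun h2 => ?_, fun h2 => ?_⟩⟩
  · exact key 0 1 (overlayCell_zero (by omega) (by omega) (by omega) (fun _ => .inl h2)
      (.inl ⟨rfl, h2⟩))
  · exact key 0 0 (overlayCell_zero (by omega) (by omega) (by omega)
      (fun _ => .inr ⟨h2, h1 h2⟩) (.inr ⟨rfl, h2⟩))
  · exact key 1 1 (overlayCell_one (by omega) (by omega) (by omega) (fun _ => ⟨h0, h1⟩)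
      (.inl ⟨rfl, h2⟩))
  · exact key 1 0 (overlayCell_one (by omega) (by omega) (by omega) (fun _ => ⟨h0, h1⟩)
      (.inr ⟨rfl, h2⟩))

/-- The cost of the overlay, per cell. -/
def overlayCost : ℕ :=
  overlayInit.bound + (Test.or (.or hasF hasG) (.const 0 <ₙ nv vCross)).cost +
    (nextEvent.bound + (advance.bound + startCell.bound))

/-- Overlaying `F` and `G` yields a common subdivision into cells without sign changes of `F - G`;
their number is linear. -/
theorem ends_overlay {sF eF sG eG : ℕ} {M C X : ℕ → ℝ} {F G : ℝ → ℝ} {σ : State}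
    (hF : IsPL sF eF M C X F) (hG : IsPL sG eG M C X G)
    (arrM : σ.real aM = M) (arrC : σ.real aC = C) (arrX : σ.real aX = X)
    (hp : σ.nat vP 0 = sF) (hpe : σ.nat vPE 0 = eF) (hq : σ.nat vQ 0 = sG)
    (hqe : σ.nat vQE 0 = eG) :
    Ends overlay σ (overlayCost * (2 * (eF - sF) + 2 * (eG - sG)))
      (fun τ => IsPL 0 (τ.nat vK 0 + 1) (τ.real aFM) (τ.real aFC) (τ.real aE) F ∧
        IsPL 0 (τ.nat vK 0 + 1) (τ.real aGM) (τ.real aGC) (τ.real aE) G ∧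
        SignsTo (τ.nat vK 0 + 1) (τ.nat aW) (τ.real aE) (fun _ => True) F G ∧
        τ.nat vK 0 + 1 ≤ 2 * (eF - sF) + 2 * (eG - sG)) := by
  have hFl := hF.lt
  have hGl := hG.lt
  set B := 2 * (eF - 1 - sF) + 2 * (eG - 1 - sG) + 1 with hB
  set b := Test.or (.or hasF hasG) (.const 0 <ₙ nv vCross) with hb
  set bd := nextEvent.bound + (advance.bound + startCell.bound) with hbd
  refine ((Ends.of_wp (wp_overlayInit hF hG arrM arrC arrX hp hpe hq hqe)).seq
    (t := (b.cost + bd) * B + b.cost) fun τ hτ =>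
    (Ends.while (OverlayInv sF eF sG eG M C X F G)
      (fun υ => (b.cost + bd) * (B - υ.nat vK 0)) hτ.1
      fun υ hI _ hb' => ⟨bd, ?_⟩).mono ?_ ?_).mono ?_ fun _ h => h
  · have hb'' : υ.nat vP 0 + 1 < υ.nat vPE 0 ∨ υ.nat vQ 0 + 1 < υ.nat vQE 0 ∨
        0 < υ.nat vCross 0 := by
      rw [Test.holds_or, Test.holds_or, or_assoc] at hb'
      exact hb'
    refine (Ends.of_wp (wp_nextEvent hb'')).frame.seq fun ω hω => ?_
    have hfr : Frame [vHas] [vE] υ ω :=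
      hω.2.weaken (by simp [nextEvent]) (by simp [nextEvent])
    have hI' := hI.congr hfr
    have n : ∀ a, a ∉ [vHas] → ω.nat a = υ.nat a := hfr.nat
    have r : ∀ a, a ∉ [vE] → ω.real a = υ.real a := hfr.real
    have hk := n vK (by simp)
    have he := hω.1
    rw [← n vP (by simp), ← n vQ (by simp), ← n vPE (by simp), ← n vQE (by simp),
      ← n vCross (by simp), ← r vXC (by simp), ← r aX (by simp), hI'.endF, hI'.endG,
      hI'.arrX] at he
    refine (Ends.of_wp (wp_advance hF hG hI' he)).frame.seq fun ω₁ h₁ => ?_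
    have hk₁ := h₁.2.nat vK (by simp [advance])
    refine (Ends.of_wp (wp_startCell hF hG h₁.1)).mono le_rfl fun ω₂ h₂ => ⟨h₂.1, ?_⟩
    have hsz := h₂.1.size
    rw [h₂.2, hk₁, hk] at hsz ⊢
    rw [← hB] at hsz
    obtain ⟨d, hd⟩ : ∃ d, B - υ.nat vK 0 = d + 1 := ⟨B - υ.nat vK 0 - 1, by omega⟩
    rw [show B - (υ.nat vK 0 + 1) = d by omega, hd, mul_add, mul_one]
    exact (Nat.add_comm _ _).le
  · simp only [hτ.2]
    exact le_rfl
  · rintro υ ⟨hI, hn, -⟩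
    rw [Test.holds_or, Test.holds_or] at hn
    simp only [not_or] at hn
    have h1 : ¬ υ.nat vP 0 + 1 < υ.nat vPE 0 := hn.1.1
    have h2 : ¬ υ.nat vQ 0 + 1 < υ.nat vQE 0 := hn.1.2
    have h3 : ¬ 0 < υ.nat vCross 0 := hn.2
    rw [hI.endF] at h1
    rw [hI.endG] at h2
    refine ⟨hI.plF.mono_ub fun t _ h => absurd h h1, hI.plG.mono_ub fun t _ h => absurd h h2,
      hI.signs.finish (fun hw t ht _ => ?_) (fun hw t ht _ => ?_), ?_⟩
    · rw [hF.eval _ hI.leF hI.ltF t (fun hs => (hI.startF hs).2.trans (ht (hI.startF hs).1))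
        (fun h => absurd h h1) fun _ => trivial,
        hG.eval _ hI.leG hI.ltG t (fun hs => (hI.startG hs).2.trans (ht (hI.startG hs).1))
        (fun h => absurd h h2) fun _ => trivial]
      exact hI.cell.ge hw t ht fun h => absurd h h3
    · rw [hF.eval _ hI.leF hI.ltF t (fun hs => (hI.startF hs).2.trans (ht (hI.startF hs).1).le)
        (fun h => absurd h h1) fun _ => trivial,
        hG.eval _ hI.leG hI.ltG t (fun hs => (hI.startG hs).2.trans (ht (hI.startG hs).1).le)
        (fun h => absurd h h2) fun _ => trivial]
      exact hI.cell.lt hw t ht fun h => absurd h h3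
    · have := hI.size
      omega
  · have : B + 1 ≤ 2 * (eF - sF) + 2 * (eG - sG) := by omega
    have hc : overlayCost = overlayInit.bound + b.cost + bd := by rw [overlayCost]
    rw [hc]
    refine le_trans ?_ (Nat.mul_le_mul_left _ this)
    generalize overlayInit.bound = x
    generalize b.cost = y
    generalize bd = z
    nlinarith [Nat.zero_le (x * B), Nat.zero_le z]

end RealRAM

/-! ### Merging: the maximum of two piecewise linear functions -/

theorem IsPLTo.exists_mem_interior {e : ℕ} {m c x : ℕ → ℝ} {ub : ℝ → Prop} {F : ℝ → ℝ}
    {s : ℕ} (h : IsPLTo s e m c x ub F) {k : ℕ} :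
    ∃ u, (s < k → x k < u) ∧ (k + 1 < e → u < x (k + 1)) := by
  by_cases h1 : s < k
  · by_cases h2 : k + 1 < e
    · obtain ⟨u, hu⟩ := exists_between (h.mono k h1 h2)
      exact ⟨u, fun _ => hu.1, fun _ => hu.2⟩
    · exact ⟨x k + 1, fun _ => by linarith, fun h => absurd h h2⟩
  · exact ⟨x (k + 1) - 1, fun h => absurd h h1, fun _ => by linarith⟩

/-- A strict inequality of lines inside a cell is a weak inequality up to the boundary. -/
theorem line_le_of_lt {K k : ℕ} {x : ℕ → ℝ} {a b a' b' u t : ℝ}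
    (hlt : ∀ v, (0 < k → x k < v) → (k + 1 < K → v < x (k + 1)) → a * v + b < a' * v + b')
    (hu₁ : 0 < k → x k < u) (hu₂ : k + 1 < K → u < x (k + 1))
    (ht₁ : 0 < k → x k ≤ t) (ht₂ : k + 1 < K → t ≤ x (k + 1)) : a * t + b ≤ a' * t + b' := by
  by_contra hcon
  rw [not_le] at hcon
  have hu := hlt u hu₁ hu₂
  set d := a * t + b - (a' * t + b') with hd
  set d' := a' * u + b' - (a * u + b) with hd'
  have h1 : 0 < d := by linarith
  have h2 : 0 < d' := by linarith
  set r := d / (2 * (d + d')) with hr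
  have hr0 : 0 < r := by positivity
  have hr1 : r < 1 := by rw [hr, div_lt_one (by positivity)]; linarith
  have hrd : r * (d + d') = d / 2 := by rw [hr]; field_simp
  have := hlt (t + r * (u - t)) (fun hk => ?_) (fun hk => ?_)
  · have e1 : a * (t + r * (u - t)) + b - (a' * (t + r * (u - t)) + b') = d - r * (d + d') := by
      rw [hd, hd']; ring
    linarith
  · nlinarith [ht₁ hk, hu₁ hk]
  · nlinarith [ht₂ hk, hu₂ hk]

theorem SignsTo.le_of_ne {K : ℕ} {w : ℕ → ℕ} {x m c m' c' : ℕ → ℝ} {F G : ℝ → ℝ}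
    (h : SignsTo K w x (fun _ => True) F G) (hF : IsPL 0 K m c x F) (hG : IsPL 0 K m' c' x G)
    {k : ℕ} (hk : k < K) (hw : w k ≠ 0) {t : ℝ} (ht₁ : 0 < k → x k ≤ t)
    (ht₂ : k + 1 < K → t ≤ x (k + 1)) : F t ≤ G t := by
  obtain ⟨u, hu₁, hu₂⟩ := hF.exists_mem_interior (k := k)
  rw [hF.eval k (by omega) hk t ht₁ ht₂ fun _ => trivial,
    hG.eval k (by omega) hk t ht₁ ht₂ fun _ => trivial]
  refine line_le_of_lt (fun v hv₁ hv₂ => ?_) hu₁ hu₂ ht₁ ht₂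
  have := (h k hk).2 hw v hv₁ hv₂ fun _ => trivial
  rwa [hF.eval k (by omega) hk v (fun h => (hv₁ h).le) (fun h => (hv₂ h).le) fun _ => trivial,
    hG.eval k (by omega) hk v (fun h => (hv₁ h).le) (fun h => (hv₂ h).le) fun _ => trivial]
    at this

/-- Adjacent pieces have different slopes, so that every breakpoint is a kink. -/
def Kinked (s e : ℕ) (m : ℕ → ℝ) : Prop := ∀ k, s ≤ k → k + 1 < e → m k ≠ m (k + 1)

namespace RealRAM

/-! The line of the maximum on the current cell. -/

@[simp] abbrev vHM : ℕ := 25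
@[simp] abbrev vHC : ℕ := 26

/-- The slope of the last piece that has been stored. -/
abbrev lastM : RExp := .get aM (nv vO -ₙ one)

/-- Treat one cell. As the maximum is continuous, its lines on adjacent cells agree as soon as they
have the same slope. -/
def compressBody : Prog :=
  .ite (.get aW (nv vJ) <ₙ one)
    (setR vHM (.get aFM (nv vJ)) ;; setR vHC (.get aFC (nv vJ)))
    (setR vHM (.get aGM (nv vJ)) ;; setR vHC (.get aGC (nv vJ))) ;;
  .ite (.or (nv vJ <ₙ one) (.or (rv vHM <ᵣ lastM) (lastM <ᵣ rv vHM)))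
    (.setReal aM (nv vO) (rv vHM) ;; .setReal aC (nv vO) (rv vHC) ;;
      .setReal aX (nv vO) (.get aE (nv vJ)) ;; setN vO (nv vO +ₙ one)) .skip ;;
  setN vJ (nv vJ +ₙ one)

/-- Append the larger of the two functions to the list of pieces, joining cells on which it is
given by the same line. -/
def compress : Prog :=
  setN vJ (.const 0) ;; .while (nv vJ <ₙ nv vK +ₙ one) compressBody

/-- The invariant of the compression: the pieces from `o` on describe the maximum `H` over the cells
before the current one; the lines of `H` on the cells are given by `hm` and `hc`. -/
structure CompressInv (K o : ℕ) (M C X E hm hc : ℕ → ℝ) (H : ℝ → ℝ) (σ : State) : Prop where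
  keep : ∀ i < o, σ.real aM i = M i ∧ σ.real aC i = C i ∧ σ.real aX i = X i
  zero : σ.nat vJ 0 = 0 → σ.nat vO 0 = o
  le : σ.nat vJ 0 ≤ K
  size : σ.nat vO 0 ≤ o + σ.nat vJ 0
  kinked : Kinked o (σ.nat vO 0) (σ.real aM)
  lt : 0 < σ.nat vJ 0 → o < σ.nat vO 0
  last : 0 < σ.nat vJ 0 → σ.real aM (σ.nat vO 0 - 1) = hm (σ.nat vJ 0 - 1) ∧
    σ.real aC (σ.nat vO 0 - 1) = hc (σ.nat vJ 0 - 1)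
  start : o + 1 < σ.nat vO 0 → 1 < σ.nat vJ 0 ∧ σ.real aX (σ.nat vO 0 - 1) ≤ E (σ.nat vJ 0 - 1)
  pl : 0 < σ.nat vJ 0 → IsPLTo o (σ.nat vO 0) (σ.real aM) (σ.real aC) (σ.real aX)
    (fun t => σ.nat vJ 0 < K → t ≤ E (σ.nat vJ 0)) H

theorem wp_compressBody {K o : ℕ} {M C X hm hc : ℕ → ℝ} {H : ℝ → ℝ} {σ : State}
    (hpl : IsPL 0 K hm hc (σ.real aE) H)
    (hh : ∀ k < K, (σ.nat aW k = 0 → hm k = σ.real aFM k ∧ hc k = σ.real aFC k) ∧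
      (σ.nat aW k ≠ 0 → hm k = σ.real aGM k ∧ hc k = σ.real aGC k))
    (hI : CompressInv K o M C X (σ.real aE) hm hc H σ) (hj : σ.nat vJ 0 < K) :
    wp compressBody (fun τ => CompressInv K o M C X (σ.real aE) hm hc H τ ∧
      τ.nat vJ 0 = σ.nat vJ 0 + 1) σ := by
  have push : ∀ a b, a = hm (σ.nat vJ 0) → b = hc (σ.nat vJ 0) →
      (0 < σ.nat vJ 0 → σ.real aM (σ.nat vO 0 - 1) ≠ a) →
      CompressInv K o M C X (σ.real aE) hm hc H
        ((((((σ.setReal vHM 0 a).setReal vHC 0 b).setReal aM (σ.nat vO 0) a).setReal aC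
          (σ.nat vO 0) b).setReal aX (σ.nat vO 0) (σ.real aE (σ.nat vJ 0))).setNat vO 0
          (σ.nat vO 0 + 1) |>.setNat vJ 0 (σ.nat vJ 0 + 1)) := by
    rintro a b rfl rfl hne
    have ho : o ≤ σ.nat vO 0 := by
      rcases Nat.eq_zero_or_pos (σ.nat vJ 0) with h | h
      · rw [hI.zero h]
      · exact (hI.lt h).le
    have hz := hI.zero
    have hsz := hI.size
    have hlt := hI.lt
    have hst := hI.start
    have hk := hI.kinked
    simp only [vJ, vO, aX, aE, aM] at ho hj hz hsz hlt hst hk hne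
    constructor <;> simp
    · intro i hi
      rw [Function.update_of_ne (by omega), Function.update_of_ne (by omega),
        Function.update_of_ne (by omega)]
      exact hI.keep i hi
    · omega
    · omega
    · intro k h1 h2
      rw [Function.update_of_ne (by omega : k ≠ _)]
      rcases eq_or_ne (k + 1) (σ.nat 15 0) with h3 | h3
      · rw [h3, Function.update_self]
        have h4 := hne (by
          by_contra h5
          rw [hz (by omega)] at h3
          omega)
        rwa [← h3, Nat.add_sub_cancel] at h4
      · rw [Function.update_of_ne h3]
        exact hk k h1 (by omega)
    · omega
    · intro h1
      by_contra h5
      have := hz (by omega)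
      omega
    · rcases Nat.eq_zero_or_pos (σ.nat 28 0) with h | h
      · rw [hz h, h]
        refine IsPLTo.single fun t ht => ?_
        simpa using hpl.eval 0 le_rfl (by omega) t (by omega) ht fun _ => trivial
      · refine (hI.pl h).push (fun h1 => ?_) (fun t _ ht _ => ht) (fun t h1 h2 => ?_)
        · refine lt_of_le_of_lt (hst h1).2 ?_
          have := hpl.mono (σ.nat 28 0 - 1) (by have := (hst h1).1; omega) (by omega)
          rwa [Nat.sub_add_cancel h] at this
        · exact hpl.eval (σ.nat 28 0) (by omega) hj t (fun _ => h1) h2 fun _ => trivial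
  have keep : ∀ a b, a = hm (σ.nat vJ 0) → 0 < σ.nat vJ 0 →
      σ.real aM (σ.nat vO 0 - 1) = a →
      CompressInv K o M C X (σ.real aE) hm hc H
        (((σ.setReal vHM 0 a).setReal vHC 0 b).setNat vJ 0 (σ.nat vJ 0 + 1)) := by
    rintro a b rfl hpos heq
    have hz := hI.zero
    have hsz := hI.size
    have hlt := hI.lt
    have hst := hI.start
    have hk := hI.kinked
    have hl := hI.last hpos
    have hkp := hI.keep
    simp only [vJ, vO, aX, aE, aM, aC] at hj hz hsz hlt hst hk heq hpos hl hkp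
    have hm1 : hm (σ.nat 28 0) = hm (σ.nat 28 0 - 1) := by rw [← heq, hl.1]
    have hmeet := hpl.meet (k := σ.nat 28 0 - 1) (by omega) (by omega)
    rw [Nat.sub_add_cancel hpos] at hmeet
    simp only [aE] at hmeet
    have hc1 : hc (σ.nat 28 0) = hc (σ.nat 28 0 - 1) := by
      rw [hm1] at hmeet; linarith
    have hmono : 1 < σ.nat 28 0 →
        σ.real 13 (σ.nat 28 0 - 1) ≤ σ.real 13 (σ.nat 28 0) := by
      intro h1
      have := hpl.mono (σ.nat 28 0 - 1) (by omega) (by omega)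
      rw [Nat.sub_add_cancel hpos] at this
      exact this.le
    constructor <;> simp
    · exact hkp
    · omega
    · omega
    · exact hk
    · exact hlt hpos
    · exact ⟨heq, by rw [hl.2, hc1]⟩
    · exact fun h1 => ⟨hpos, (hst h1).2.trans (hmono (hst h1).1)⟩
    · have hp := hI.pl hpos
      refine ⟨hp.lt, hp.mono, fun k h1 h2 t h3 h4 h5 => ?_⟩
      by_cases h6 : k + 1 = σ.nat vO 0
      · by_cases h7 : t ≤ σ.real 13 (σ.nat 28 0)
        · exact hp.eval k h1 h2 t h3 h4 fun _ _ => h7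
        · obtain rfl : k = σ.nat vO 0 - 1 := by omega
          rw [heq, hl.2, ← hc1]
          exact hpl.eval (σ.nat 28 0) (by omega) hj t (fun _ => (not_le.1 h7).le) (h5 h6)
            fun _ => trivial
      · exact hp.eval k h1 h2 t h3 h4 fun h => absurd h h6
  simp only [vJ, vO, aX, aE, aM, aC, vHM, vHC] at push keep hj
  have hw := hh _ hj
  simp only [aW, aFM, aFC, aGM, aGC] at hw
  simp [compressBody]
  refine ⟨fun h1 => ⟨fun h2 => ?_, fun h2 h3 h4 => ?_⟩,
    fun h1 => ⟨fun h2 => ?_, fun h2 h3 h4 => ?_⟩⟩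
  · refine push _ _ (hw.1 h1).1.symm (hw.1 h1).2.symm fun h3 => ?_
    intro h4
    rw [h4] at h2
    have := h2 (by omega) le_rfl
    exact lt_irrefl _ this
  · exact keep _ _ (hw.1 h1).1.symm (by omega) (le_antisymm h3 h4)
  · refine push _ _ (hw.2 h1).1.symm (hw.2 h1).2.symm fun h3 => ?_
    intro h4
    rw [h4] at h2
    have := h2 (by omega) le_rfl
    exact lt_irrefl _ this
  · exact keep _ _ (hw.2 h1).1.symm (by omega) (le_antisymm h3 h4)

/-- The cost of the compression, per cell. -/
def compressCost : ℕ := (nv vJ <ₙ nv vK +ₙ one).cost + compressBody.bound + 3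

/-- Compression appends the maximum of the two overlaid functions, without artificial
breakpoints. -/
theorem ends_compress {K : ℕ} {F G : ℝ → ℝ} {σ : State}
    (hF : IsPL 0 K (σ.real aFM) (σ.real aFC) (σ.real aE) F)
    (hG : IsPL 0 K (σ.real aGM) (σ.real aGC) (σ.real aE) G)
    (hs : SignsTo K (σ.nat aW) (σ.real aE) (fun _ => True) F G) (hK : σ.nat vK 0 + 1 = K) :
    Ends compress σ (compressCost * (K + 1)) (fun τ =>
      (∀ i < σ.nat vO 0, τ.real aM i = σ.real aM i ∧ τ.real aC i = σ.real aC i ∧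
        τ.real aX i = σ.real aX i) ∧
      Kinked (σ.nat vO 0) (τ.nat vO 0) (τ.real aM) ∧
      IsPL (σ.nat vO 0) (τ.nat vO 0) (τ.real aM) (τ.real aC) (τ.real aX)
        (fun t => max (F t) (G t))) := by
  set hm : ℕ → ℝ := fun k => if σ.nat aW k = 0 then σ.real aFM k else σ.real aGM k with hhm
  set hc : ℕ → ℝ := fun k => if σ.nat aW k = 0 then σ.real aFC k else σ.real aGC k with hhc
  set H : ℝ → ℝ := fun t => max (F t) (G t) with hH
  have hpl : IsPL 0 K hm hc (σ.real aE) H := by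
    refine ⟨hF.lt, hF.mono, fun k h1 h2 t h3 h4 _ => ?_⟩
    by_cases hw : σ.nat aW k = 0
    · simp only [hhm, hhc, hH, if_pos hw]
      rw [max_eq_left ((hs k h2).1 hw t h3 h4 fun _ => trivial)]
      exact hF.eval k h1 h2 t h3 h4 fun _ => trivial
    · simp only [hhm, hhc, hH, if_neg hw]
      rw [max_eq_right (hs.le_of_ne hF hG h2 hw h3 h4)]
      exact hG.eval k h1 h2 t h3 h4 fun _ => trivial
  refine (Ends.seq (s := 3) (t := compressCost * K + (nv vJ <ₙ nv vK +ₙ one).cost)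
    (R := fun τ => τ = σ.setNat vJ 0 0) ((Ends.of_wp (by simp)).mono (by simp) fun _ h => h)
    ?_).mono ?_ fun _ h => h
  · rintro τ rfl
    refine (Ends.while (CompressInv K (σ.nat vO 0) (σ.real aM) (σ.real aC) (σ.real aX) (σ.real aE)
      hm hc H) (fun υ => compressCost * (K - υ.nat vJ 0)) ?_
      fun υ hI hf hb => ⟨compressBody.bound, ?_⟩).mono ?_ ?_
    · constructor <;> simp
      intro k h1 h2
      omega
    · have n : ∀ a, a ∉ [vO, vJ] → υ.nat a = (σ.setNat vJ 0 0).nat a := fun a ha =>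
        hf.nat a (by simpa [compressBody] using ha)
      have r : ∀ a, a ∉ [vHM, vHC, aM, aC, aX] → υ.real a = (σ.setNat vJ 0 0).real a :=
        fun a ha => hf.real a (by simp at ha; simp [compressBody, ha])
      have nK : υ.nat vK = σ.nat vK := by rw [n vK (by simp)]; simp
      have nW : υ.nat aW = σ.nat aW := by rw [n aW (by simp)]; simp
      have rE : υ.real aE = σ.real aE := by rw [r aE (by simp)]; simp
      have r1 : υ.real aFM = σ.real aFM := by rw [r aFM (by simp)]; simp
      have r2 : υ.real aFC = σ.real aFC := by rw [r aFC (by simp)]; simp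
      have r3 : υ.real aGM = σ.real aGM := by rw [r aGM (by simp)]; simp
      have r4 : υ.real aGC = σ.real aGC := by rw [r aGC (by simp)]; simp
      have hj : υ.nat vJ 0 < K := by
        have h : υ.nat vJ 0 < υ.nat vK 0 + 1 := hb
        rwa [nK, hK] at h
      rw [← rE] at hI hpl ⊢
      refine (Ends.of_wp (wp_compressBody hpl (fun k hk => ?_) hI hj)).mono le_rfl
        fun ω hω => ⟨hω.1, ?_⟩
      · rw [nW, r1, r2, r3, r4]
        exact ⟨fun h => by simp [hhm, hhc, h], fun h => by simp only [hhm, hhc, if_neg h, and_self]⟩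
      · rw [hω.2]
        obtain ⟨d, hd⟩ : ∃ d, K - υ.nat vJ 0 = d + 1 := ⟨K - υ.nat vJ 0 - 1, by omega⟩
        rw [show K - (υ.nat vJ 0 + 1) = d by omega, hd, mul_add, mul_one]
        have : compressCost = (nv vJ <ₙ nv vK +ₙ one).cost + compressBody.bound + 3 := rfl
        omega
    · simp
    · rintro υ ⟨hI, hn, hf⟩
      have nK : υ.nat vK = σ.nat vK := by rw [hf.nat vK (by simp [compressBody])]; simp
      have hj : ¬ υ.nat vJ 0 < υ.nat vK 0 + 1 := hn
      rw [nK, hK] at hj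
      have hKpos : 0 < K := by omega
      exact ⟨hI.keep, hI.kinked, (hI.pl (by omega)).mono_ub fun t _ h => absurd h hj⟩
  · rw [mul_add, mul_one]
    have : compressCost = (nv vJ <ₙ nv vK +ₙ one).cost + compressBody.bound + 3 := rfl
    omega

end RealRAM

/-! ### The complexity of an upper envelope -/

/-- `F` is the maximum of the functions `f i` with `i ∈ S`. -/
def IsMaxOf (S : Finset ℕ) (f : ℕ → ℝ → ℝ) (F : ℝ → ℝ) : Prop :=
  ∀ t, (∀ i ∈ S, f i t ≤ F t) ∧ ∃ i ∈ S, f i t = F t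

theorem IsMaxOf.union {S S' : Finset ℕ} {f : ℕ → ℝ → ℝ} {F G : ℝ → ℝ} (hF : IsMaxOf S f F)
    (hG : IsMaxOf S' f G) : IsMaxOf (S ∪ S') f (fun t => max (F t) (G t)) := by
  intro t
  refine ⟨fun i hi => ?_, ?_⟩
  · rcases Finset.mem_union.1 hi with h | h
    · exact ((hF t).1 i h).trans (le_max_left _ _)
    · exact ((hG t).1 i h).trans (le_max_right _ _)
  · rcases le_total (F t) (G t) with h | h
    · obtain ⟨i, hi, h'⟩ := (hG t).2
      exact ⟨i, Finset.mem_union_right _ hi, h'.trans (max_eq_right h).symm⟩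
    · obtain ⟨i, hi, h'⟩ := (hF t).2
      exact ⟨i, Finset.mem_union_left _ hi, h'.trans (max_eq_left h).symm⟩

/-- In a sequence of bits, rises and falls alternate. -/
theorem card_falls_le (b : ℕ → Bool) {s N : ℕ} (h : s ≤ N) :
    ((Finset.Ico s N).filter fun k => b k = true ∧ b (k + 1) = false).card ≤
      ((Finset.Ico s N).filter fun k => b k = false ∧ b (k + 1) = true).card +
        (if b N = false then 1 else 0) := by
  induction N, h using Nat.le_induction with
  | base => simp
  | succ N hN ih =>
    rw [← Finset.insert_Ico_right_eq_Ico_add_one hN, Finset.filter_insert, Finset.filter_insert]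
    cases h : b N <;> cases h' : b (N + 1) <;> simp [h] at ih ⊢ <;> omega

/-- A piece of the maximum of finitely many functions, each the minimum of a line of larger slope
on the left and a line of smaller slope on the right, is contained in one of these lines; the line
stays below the maximum on the side to which it extends. The label consists of the index of the
function and a bit, `true` for its right line. -/
theorem exists_label {S : Finset ℕ} {a b a' b' : ℕ → ℝ} {F : ℝ → ℝ} {s e : ℕ} {m c x : ℕ → ℝ}
    (hab : ∀ i ∈ S, a' i ≤ a i)
    (hF : IsMaxOf S (fun i t => min (a i * t + b i) (a' i * t + b' i)) F)
    (hpl : IsPL s e m c x F) {k : ℕ} (hs : s ≤ k) (he : k < e) :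
    ∃ l : ℕ × Bool, l.1 ∈ S ∧ ∃ u, (s < k → x k < u) ∧ (k + 1 < e → u < x (k + 1)) ∧
      (l.2 = true → a' l.1 = m k ∧ b' l.1 = c k ∧ ∀ t, u ≤ t → m k * t + c k ≤ F t) ∧
      (l.2 = false → a l.1 = m k ∧ b l.1 = c k ∧ ∀ t, t ≤ u → m k * t + c k ≤ F t) := by
  obtain ⟨p, hp₁, hp₂⟩ := hpl.exists_mem_interior (k := k)
  obtain ⟨q, hpq, hq⟩ : ∃ q, p < q ∧ (k + 1 < e → q < x (k + 1)) := by
    by_cases h : k + 1 < e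
    · obtain ⟨q, hq⟩ := exists_between (hp₂ h)
      exact ⟨q, hq.1, fun _ => hq.2⟩
    · exact ⟨p + 1, by linarith, fun h' => absurd h' h⟩
  have act : ∀ t, ∃ l : ℕ × Bool, t ∈ Set.Ioo p q → l.1 ∈ S ∧
      (l.2 = true → a' l.1 * t + b' l.1 = m k * t + c k ∧
        a' l.1 * t + b' l.1 ≤ a l.1 * t + b l.1) ∧
      (l.2 = false → a l.1 * t + b l.1 = m k * t + c k ∧
        a l.1 * t + b l.1 ≤ a' l.1 * t + b' l.1) := by
    intro t
    obtain ⟨i, hi, h⟩ := (hF t).2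
    beta_reduce at h
    by_cases ht : t ∈ Set.Ioo p q
    · rw [hpl.eval k hs he t (fun h => ((hp₁ h).trans ht.1).le)
        (fun h => (ht.2.trans (hq h)).le) fun _ => trivial] at h
      rcases le_total (a i * t + b i) (a' i * t + b' i) with h' | h'
      · rw [min_eq_left h'] at h
        exact ⟨(i, false), fun _ => ⟨hi, by simp, fun _ => ⟨h, h'⟩⟩⟩
      · rw [min_eq_right h'] at h
        exact ⟨(i, true), fun _ => ⟨hi, fun _ => ⟨h, h'⟩, by simp⟩⟩
    · exact ⟨(i, false), fun h => absurd h ht⟩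
  choose g hg using act
  -- by the pigeonhole principle, one line agrees with the piece at two points
  obtain ⟨t₁, ht₁, t₂, ht₂, hne, hgg⟩ := (Set.Ioo_infinite hpq).exists_ne_map_eq_of_mapsTo
    (t := {l : ℕ × Bool | l.1 ∈ S}) (f := g) (fun t ht => (hg t ht).1)
    (((S ×ˢ Finset.univ : Finset (ℕ × Bool)).finite_toSet).subset fun l hl => by
      simpa using hl)
  obtain ⟨hS, h1, h2⟩ := hg t₁ ht₁
  obtain ⟨-, h3, h4⟩ := hg t₂ ht₂
  rw [← hgg] at h3 h4
  have unique : ∀ α β : ℝ, α * t₁ + β = m k * t₁ + c k → α * t₂ + β = m k * t₂ + c k →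
      α = m k ∧ β = c k := by
    intro α β e1 e2
    have : (α - m k) * (t₁ - t₂) = 0 := by linarith
    rcases mul_eq_zero.1 this with h | h
    · have e3 : α = m k := by linarith
      exact ⟨e3, by rw [e3] at e1; linarith⟩
    · exact absurd (by linarith) hne
  refine ⟨g t₁, hS, t₁, fun h => (hp₁ h).trans ht₁.1, fun h => ht₁.2.trans (hq h),
    fun hb => ?_, fun hb => ?_⟩
  · obtain ⟨e1, e2⟩ := unique _ _ (h1 hb).1 (h3 hb).1
    refine ⟨e1, e2, fun t ht => le_trans ?_ ((hF t).1 _ hS)⟩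
    have h5 := (h1 hb).2
    have h6 := hab _ hS
    rw [← e1, ← e2]
    exact le_min (by nlinarith) le_rfl
  · obtain ⟨e1, e2⟩ := unique _ _ (h2 hb).1 (h4 hb).1
    refine ⟨e1, e2, fun t ht => le_trans ?_ ((hF t).1 _ hS)⟩
    have h5 := (h2 hb).2
    have h6 := hab _ hS
    rw [← e1, ← e2]
    exact le_min le_rfl (by nlinarith)

/-- At a concave kink of the maximum, one of the functions has its apex. -/
theorem exists_apex {S : Finset ℕ} {a b a' b' : ℕ → ℝ} {F : ℝ → ℝ} {s e : ℕ} {m c x : ℕ → ℝ}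
    (hab : ∀ i ∈ S, a' i ≤ a i)
    (hF : IsMaxOf S (fun i t => min (a i * t + b i) (a' i * t + b' i)) F)
    (hpl : IsPL s e m c x F) {k : ℕ} (hs : s ≤ k) (he : k + 1 < e) (hm : m (k + 1) < m k) :
    ∃ i ∈ S, a' i < a i ∧ a i * x (k + 1) + b i = a' i * x (k + 1) + b' i := by
  obtain ⟨i, hi, h⟩ := (hF (x (k + 1))).2
  beta_reduce at h
  have below : ∀ t, min (a i * t + b i) (a' i * t + b' i) ≤ F t := fun t => (hF t).1 i hi
  set y := x (k + 1) with hy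
  have hmeet := hpl.meet hs he
  obtain ⟨p, hp₁, hp₂⟩ := hpl.exists_mem_interior (k := k)
  obtain ⟨q, hq₁, hq₂⟩ := hpl.exists_mem_interior (k := k + 1)
  have hp₂ := hp₂ he
  have hq₁ := hq₁ (by omega)
  have left : ∀ t, p ≤ t → t ≤ y → F t = m k * t + c k := fun t h1 h2 =>
    hpl.eval k hs (by omega) t (fun h => ((hp₁ h).trans_le h1).le) (fun _ => h2) fun _ => trivial
  have right : ∀ t, y ≤ t → t ≤ q → F t = m (k + 1) * t + c (k + 1) := fun t h1 h2 =>
    hpl.eval (k + 1) (by omega) he t (fun _ => h1) (fun h => h2.trans (hq₂ h).le) fun _ => trivial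
  have hFy := left y hp₂.le le_rfl
  have hFy' := right y le_rfl hq₁.le
  -- a line through the kink that is active on both sides contradicts concavity
  have no : ∀ α β : ℝ, (∃ t, p ≤ t ∧ t < y ∧ α * t + β ≤ F t) →
      (∃ t, y < t ∧ t ≤ q ∧ α * t + β ≤ F t) → α * y + β = F y → False := by
    rintro α β ⟨t, ht1, ht2, ht3⟩ ⟨t', ht1', ht2', ht3'⟩ h
    rw [left t ht1 ht2.le] at ht3
    rw [right t' ht1'.le ht2'] at ht3'
    have h1 : m k ≤ α := by
      by_contra hc
      nlinarith [mul_pos (sub_pos.2 (not_le.1 hc)) (sub_pos.2 ht2)]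
    have h2 : α ≤ m (k + 1) := by
      by_contra hc
      nlinarith [mul_pos (sub_pos.2 (not_le.1 hc)) (sub_pos.2 ht1')]
    linarith
  have nearL : ∀ P : ℝ → Prop, (∀ᶠ t in nhds y, P t) → ∃ t, p ≤ t ∧ t < y ∧ P t := by
    intro P hP
    have h1 : ∀ᶠ t in nhdsWithin y (Set.Iio y), P t := nhdsWithin_le_nhds hP
    obtain ⟨t, ht⟩ := (h1.and (Ico_mem_nhdsLT hp₂)).exists
    exact ⟨t, ht.2.1, ht.2.2, ht.1⟩
  have nearR : ∀ P : ℝ → Prop, (∀ᶠ t in nhds y, P t) → ∃ t, y < t ∧ t ≤ q ∧ P t := by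
    intro P hP
    have h1 : ∀ᶠ t in nhdsWithin y (Set.Ioi y), P t := nhdsWithin_le_nhds hP
    obtain ⟨t, ht⟩ := (h1.and (Ioc_mem_nhdsGT hq₁)).exists
    exact ⟨t, ht.2.1, ht.2.2, ht.1⟩
  rcases lt_trichotomy (a i * y + b i) (a' i * y + b' i) with h' | h' | h'
  · exfalso
    rw [min_eq_left h'.le] at h
    have ev : ∀ᶠ t in nhds y, a i * t + b i ≤ F t := by
      have : ∀ᶠ t in nhds y, a i * t + b i < a' i * t + b' i :=
        ContinuousAt.eventually_lt (by fun_prop) (by fun_prop) h'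
      filter_upwards [this] with t ht
      have := below t
      rwa [min_eq_left ht.le] at this
    exact no _ _ (nearL _ ev) (nearR _ ev) h
  · refine ⟨i, hi, lt_of_le_of_ne (hab i hi) fun hEq => ?_, h'⟩
    rw [min_eq_left h'.le] at h
    have ev : ∀ᶠ t in nhds y, a i * t + b i ≤ F t := by
      refine Filter.Eventually.of_forall fun t => ?_
      have hb : b i = b' i := by rw [hEq] at h'; linarith
      have := below t
      rwa [hEq, ← hb, min_self] at this
    exact no _ _ (nearL _ ev) (nearR _ ev) h
  · exfalso
    rw [min_eq_right h'.le] at h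
    have ev : ∀ᶠ t in nhds y, a' i * t + b' i ≤ F t := by
      have : ∀ᶠ t in nhds y, a' i * t + b' i < a i * t + b i :=
        ContinuousAt.eventually_lt (by fun_prop) (by fun_prop) h'
      filter_upwards [this] with t ht
      have := below t
      rwa [min_eq_right ht.le] at this
    exact no _ _ (nearL _ ev) (nearR _ ev) h

/-- Every upper envelope of `n` functions, each the minimum of two lines, has at most `8 * n + 2`
pieces. -/
theorem card_pieces_le {S : Finset ℕ} {a b a' b' : ℕ → ℝ} {F : ℝ → ℝ} {s e : ℕ} {m c x : ℕ → ℝ}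
    (hab : ∀ i ∈ S, a' i ≤ a i)
    (hF : IsMaxOf S (fun i t => min (a i * t + b i) (a' i * t + b' i)) F)
    (hpl : IsPL s e m c x F) (hk : Kinked s e m) : e - s ≤ 8 * S.card + 2 := by
  classical
  have hse := hpl.lt
  have hl' := fun k (h : s ≤ k ∧ k < e) => exists_label hab hF hpl h.1 h.2
  choose! l hl using hl'
  have ev : ∀ k u, s ≤ k → k < e → (s < k → x k < u) → (k + 1 < e → u < x (k + 1)) →
      F u = m k * u + c k := fun k u h1 h2 h3 h4 =>
    hpl.eval k h1 h2 u (fun h => (h3 h).le) (fun h => (h4 h).le) fun _ => trivial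
  have sameline : ∀ i j, s ≤ i → i < e → s ≤ j → j < e → l i = l j → m i = m j ∧ c i = c j := by
    intro i j hi hi' hj hj' h
    obtain ⟨-, u, -, -, h1, h2⟩ := hl i ⟨hi, hi'⟩
    obtain ⟨-, v, -, -, h3, h4⟩ := hl j ⟨hj, hj'⟩
    rw [h] at h1 h2
    cases hb : (l j).2
    · exact ⟨(h2 hb).1.symm.trans (h4 hb).1, (h2 hb).2.1.symm.trans (h4 hb).2.1⟩
    · exact ⟨(h1 hb).1.symm.trans (h3 hb).1, (h1 hb).2.1.symm.trans (h3 hb).2.1⟩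
  have xle : ∀ i j, s < i → i ≤ j → j < e → x i ≤ x j := by
    intro i j hi hij hj
    rcases hij.eq_or_lt with rfl | h
    · exact le_rfl
    · exact (hpl.mono_lt hi h hj).le
  set J := Finset.Ico s (e - 1) with hJ
  have memJ : ∀ k, k ∈ J ↔ s ≤ k ∧ k + 1 < e := by
    intro k; rw [hJ, Finset.mem_Ico]; omega
  -- different concave kinks belong to different apexes
  have concave : (J.filter fun k => m (k + 1) < m k).card ≤ S.card := by
    have ap := fun k (h : k ∈ J ∧ m (k + 1) < m k) =>
      exists_apex hab hF hpl ((memJ k).1 h.1).1 ((memJ k).1 h.1).2 h.2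
    choose! f hf using ap
    refine Finset.card_le_card_of_injOn f (fun k hk => (hf k (Finset.mem_filter.1 hk)).1) ?_
    intro i hi j hj hij
    have h1 := hf i (Finset.mem_filter.1 hi)
    have h2 := hf j (Finset.mem_filter.1 hj)
    rw [← hij] at h2
    have hi' := (memJ i).1 (Finset.mem_filter.1 hi).1
    have hj' := (memJ j).1 (Finset.mem_filter.1 hj).1
    have h3 : (a (f i) - a' (f i)) * (x (i + 1) - x (j + 1)) = 0 := by linarith [h1.2.2, h2.2.2]
    rcases mul_eq_zero.1 h3 with h | h
    · linarith [h1.2.1]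
    · by_contra hne
      rcases Nat.lt_or_gt_of_ne hne with h4 | h4
      · linarith [hpl.mono_lt (i := i + 1) (j := j + 1) (by omega) (by omega) hj'.2]
      · linarith [hpl.mono_lt (i := j + 1) (j := i + 1) (by omega) (by omega) hi'.2]
  -- the line to the left of such a convex kink does not occur again further to the right
  have rise : (J.filter fun k => m k < m (k + 1) ∧ (l (k + 1)).2 = true).card ≤ 2 * S.card := by
    have key : ∀ i j, i ∈ J → j ∈ J → m i < m (i + 1) → (l (i + 1)).2 = true → i < j →
        l i ≠ l j := by
      intro i j hi hj hm hb hij h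
      rw [memJ] at hi hj
      obtain ⟨h1, h2⟩ := sameline i j hi.1 (by omega) hj.1 (by omega) h
      rcases eq_or_ne (i + 1) j with rfl | hne
      · exact hm.ne h1
      · obtain ⟨-, u, hu1, hu2, h3, -⟩ := hl (i + 1) ⟨by omega, by omega⟩
        obtain ⟨-, v, hv1, hv2, -⟩ := hl j ⟨by omega, by omega⟩
        have e1 := hv1 (by omega)
        have e2 := hu2 (by omega)
        have e3 := xle (i + 1 + 1) j (by omega) (by omega) (by omega)
        have e4 := hu1 (by omega)
        have e5 := (h3 hb).2.2 v (by linarith)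
        rw [ev j v (by omega) (by omega) hv1 hv2, ← h1, ← h2] at e5
        have e6 := hpl.meet hi.1 hi.2
        nlinarith [mul_pos (sub_pos.2 hm) (sub_pos.2 (show x (i + 1) < v by linarith))]
    calc _ ≤ (S ×ˢ (Finset.univ : Finset Bool)).card := by
          refine Finset.card_le_card_of_injOn l (fun k hk => ?_) fun i hi j hj hij => ?_
          · have := (memJ k).1 (Finset.mem_filter.1 hk).1
            simpa using (hl k ⟨this.1, by omega⟩).1
          · have hi := Finset.mem_filter.1 hi
            have hj := Finset.mem_filter.1 hj
            by_contra hne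
            rcases Nat.lt_or_gt_of_ne hne with h4 | h4
            · exact key i j hi.1 hj.1 hi.2.1 hi.2.2 h4 hij
            · exact key j i hj.1 hi.1 hj.2.1 hj.2.2 h4 hij.symm
      _ = _ := by rw [Finset.card_product]; simp [mul_comm]
  -- the line to the right of such a convex kink does not occur further to the left
  have fall : (J.filter fun k => m k < m (k + 1) ∧ (l k).2 = false).card ≤ 2 * S.card := by
    have key : ∀ i j, i ∈ J → j ∈ J → m j < m (j + 1) → (l j).2 = false → i < j →
        l (i + 1) ≠ l (j + 1) := by
      intro i j hi hj hm hb hij h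
      rw [memJ] at hi hj
      obtain ⟨h1, h2⟩ := sameline (i + 1) (j + 1) (by omega) (by omega) (by omega) (by omega) h
      rcases eq_or_ne (i + 1) j with rfl | hne
      · exact hm.ne h1
      · obtain ⟨-, u, hu1, hu2, -⟩ := hl (i + 1) ⟨by omega, by omega⟩
        obtain ⟨-, v, hv1, hv2, -, h3⟩ := hl j ⟨by omega, by omega⟩
        have e1 := hv1 (by omega)
        have e2 := hu2 (by omega)
        have e3 := xle (i + 1 + 1) j (by omega) (by omega) (by omega)
        have e4 := hv2 (by omega)
        have e5 := (h3 hb).2.2 u (by linarith)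
        rw [ev (i + 1) u (by omega) (by omega) hu1 hu2, h1, h2] at e5
        have e6 := hpl.meet hj.1 hj.2
        nlinarith [mul_pos (sub_pos.2 hm) (sub_pos.2 (show u < x (j + 1) by linarith))]
    calc _ ≤ (S ×ˢ (Finset.univ : Finset Bool)).card := by
          refine Finset.card_le_card_of_injOn (fun k => l (k + 1)) (fun k hk => ?_)
            fun i hi j hj hij => ?_
          · have := (memJ k).1 (Finset.mem_filter.1 hk).1
            simpa using (hl (k + 1) ⟨by omega, by omega⟩).1
          · have hi := Finset.mem_filter.1 hi
            have hj := Finset.mem_filter.1 hj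
            by_contra hne
            rcases Nat.lt_or_gt_of_ne hne with h4 | h4
            · exact key i j hi.1 hj.1 hj.2.1 hj.2.2 h4 hij
            · exact key j i hj.1 hi.1 hi.2.1 hi.2.2 h4 hij.symm
      _ = _ := by rw [Finset.card_product]; simp [mul_comm]
  -- kinks at which the bit changes from `true` to `false`
  have alt := card_falls_le (fun k => (l k).2) (s := s) (N := e - 1) (by omega)
  have alt' : (J.filter fun k => (l k).2 = true ∧ (l (k + 1)).2 = false).card ≤
      (J.filter fun k => (l k).2 = false ∧ (l (k + 1)).2 = true).card + 1 :=
    alt.trans (Nat.add_le_add_left (by split_ifs <;> simp) _)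
  have trich : ∀ k ∈ J, m (k + 1) < m k ∨ m k < m (k + 1) := by
    intro k h
    rw [memJ] at h
    exact (hk k h.1 h.2).symm.lt_or_gt
  have h1 : J.filter (fun k => (l k).2 = false ∧ (l (k + 1)).2 = true) ⊆
      (J.filter fun k => m (k + 1) < m k) ∪
        J.filter fun k => m k < m (k + 1) ∧ (l (k + 1)).2 = true := by
    intro k h
    rw [Finset.mem_filter] at h
    rw [Finset.mem_union, Finset.mem_filter, Finset.mem_filter]
    rcases trich k h.1 with h' | h'
    · exact .inl ⟨h.1, h'⟩
    · exact .inr ⟨h.1, h', h.2.2⟩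
  have h2 : J ⊆ ((J.filter fun k => m (k + 1) < m k) ∪
      (J.filter fun k => m k < m (k + 1) ∧ (l (k + 1)).2 = true)) ∪
      ((J.filter fun k => m k < m (k + 1) ∧ (l k).2 = false) ∪
      J.filter fun k => (l k).2 = true ∧ (l (k + 1)).2 = false) := by
    intro k h
    simp only [Finset.mem_union, Finset.mem_filter, h, true_and]
    rcases trich k h with h' | h'
    · exact .inl (.inl h')
    · cases hb : (l (k + 1)).2 <;> cases hb' : (l k).2 <;> simp [h']
  have c1 := (Finset.card_le_card h1).trans (Finset.card_union_le _ _)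
  have c2 := (Finset.card_le_card h2).trans ((Finset.card_union_le _ _).trans
    (add_le_add (Finset.card_union_le _ _) (Finset.card_union_le _ _)))
  have c3 : J.card = e - 1 - s := by rw [hJ, Nat.card_Ico]
  omega

/-! ### Divide and conquer -/

/-- The leaves below node `b` of the binary tree with nodes `0, …, 2 * N - 2`, in which the nodes
`b < N` are the leaves and the children of node `N + t` are `2 * t` and `2 * t + 1`. -/
def leaves (N b : ℕ) : Finset ℕ :=
  if b < N then {b}
  else if b < 2 * N - 1 then leaves N (2 * (b - N)) ∪ leaves N (2 * (b - N) + 1) else ∅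
termination_by b

theorem leaves_of_lt {N b : ℕ} (h : b < N) : leaves N b = {b} := by
  rw [leaves, if_pos h]

theorem leaves_add {N t : ℕ} (h : t + 1 < N) :
    leaves N (N + t) = leaves N (2 * t) ∪ leaves N (2 * t + 1) := by
  rw [leaves, if_neg (by omega), if_pos (by omega), Nat.add_sub_cancel_left]

/-- Only the nodes close to the root `2 * N - 2` have many leaves. -/
theorem card_leaves_le {N b : ℕ} (hb : b < 2 * N - 1) :
    (leaves N b).card * (2 * N - 1 - b) ≤ 2 * N := by
  induction b using Nat.strong_induction_on with
  | _ b ih =>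
    by_cases h : b < N
    · rw [leaves_of_lt h, Finset.card_singleton]; omega
    · obtain ⟨t, rfl⟩ : ∃ t, b = N + t := ⟨b - N, by omega⟩
      rw [leaves_add (by omega)]
      have h1 := ih (2 * t) (by omega) (by omega)
      have h2 := ih (2 * t + 1) (by omega) (by omega)
      have h3 := Finset.card_union_le (leaves N (2 * t)) (leaves N (2 * t + 1))
      obtain ⟨r, hr⟩ : ∃ r, N = t + 1 + r := ⟨N - (t + 1), by omega⟩
      rw [show 2 * N - 1 - 2 * t = 2 * r + 1 by omega] at h1
      rw [show 2 * N - 1 - (2 * t + 1) = 2 * r by omega] at h2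
      rw [show 2 * N - 1 - (N + t) = r by omega]
      nlinarith

/-- The cost of merging is proportional to this quantity. -/
theorem card_leaves_add_le {N t : ℕ} (ht : t + 1 < N) :
    (leaves N (2 * t)).card + (leaves N (2 * t + 1)).card ≤ 2 * N / (N - 1 - t) := by
  rw [Nat.le_div_iff_mul_le (by omega)]
  have h1 := card_leaves_le (N := N) (b := 2 * t) (by omega)
  have h2 := card_leaves_le (N := N) (b := 2 * t + 1) (by omega)
  obtain ⟨r, hr⟩ : ∃ r, N = t + 1 + r := ⟨N - (t + 1), by omega⟩
  rw [show 2 * N - 1 - 2 * t = 2 * r + 1 by omega] at h1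
  rw [show 2 * N - 1 - (2 * t + 1) = 2 * r by omega] at h2
  rw [show N - 1 - t = r by omega]
  nlinarith

theorem leaves_root {N : ℕ} (hN : 1 ≤ N) : leaves N (2 * N - 2) = Finset.range N := by
  apply Finset.Subset.antisymm
  · have key : ∀ b, leaves N b ⊆ Finset.range N := by
      intro b
      induction b using Nat.strong_induction_on with
      | _ b ih =>
        rw [leaves]
        split_ifs with h h'
        · simpa using h
        · exact Finset.union_subset (ih _ (by omega)) (ih _ (by omega))
        · simp
    exact key _
  · have key : ∀ d b, 2 * N - 2 - b ≤ d → b ≤ 2 * N - 2 → leaves N b ⊆ leaves N (2 * N - 2) := by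
      intro d
      induction d with
      | zero => intro b h1 h2; rw [show b = 2 * N - 2 by omega]
      | succ d ih =>
        intro b h1 h2
        rcases h2.eq_or_lt with h | h
        · rw [h]
        · refine subset_trans ?_ (ih (N + b / 2) (by omega) (by omega))
          rw [leaves_add (by omega)]
          rcases Nat.even_or_odd' b with ⟨r, rfl | rfl⟩
          · rw [show 2 * r / 2 = r by omega]; exact Finset.subset_union_left
          · rw [show (2 * r + 1) / 2 = r by omega]; exact Finset.subset_union_right
    intro i hi
    rw [Finset.mem_range] at hi
    exact key _ i le_rfl (by omega) (by rw [leaves_of_lt hi]; simp)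

/-- A bound for the sum of the numbers of leaves below the inner nodes of the tree; the term `j`
belongs to the inner node number `j`, counted from the root. -/
def mergeWork (N : ℕ) : ℕ := ∑ j ∈ Finset.range (N - 1), 2 * N / (j + 1)

namespace RealRAM

/-- Set up the overlay of the blocks `2 * t` and `2 * t + 1`. -/
def mergeInit : Prog :=
  setN vP (.get aS (nv vT +ₙ nv vT)) ;;
  setN vPE (.get aS (nv vT +ₙ nv vT +ₙ one)) ;;
  setN vQ (.get aS (nv vT +ₙ nv vT +ₙ one)) ;;
  setN vQE (.get aS (nv vT +ₙ nv vT +ₙ .const 2))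

def mergeDone : Prog :=
  setN vT (nv vT +ₙ one) ;; .setNat aS (nv vN +ₙ nv vT) (nv vO)

/-- Merge the blocks `2 * t` and `2 * t + 1`, and append the result as block `N + t`. -/
def merge : Prog := mergeInit ;; overlay ;; compress ;; mergeDone

/-- Merge the blocks `0, …, N - 1` in a queue. -/
def envelope : Prog :=
  setN vT (.const 0) ;; .while (nv vT +ₙ one <ₙ nv vN) merge

/-- A family of functions, each the minimum of the line with slope `a i` and intercept `b i` and the
line with slope `a' i` and intercept `b' i`; the first line is the minimum on the left. -/
structure Hats where
  a : ℕ → ℝ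
  b : ℕ → ℝ
  a' : ℕ → ℝ
  b' : ℕ → ℝ
  le : ∀ i, a' i ≤ a i

/-- The functions of the family. -/
def Hats.fn (h : Hats) (i : ℕ) (t : ℝ) : ℝ := min (h.a i * t + h.b i) (h.a' i * t + h.b' i)

/-- Block `b` of the array of pieces describes the function `F`. -/
abbrev Block (σ : State) (b : ℕ) (F : ℝ → ℝ) : Prop :=
  IsPL (σ.nat aS b) (σ.nat aS (b + 1)) (σ.real aM) (σ.real aC) (σ.real aX) F

/-- The invariant of the merging loop: the first `N + t` nodes of the tree have been computed, and
the pieces before `o` have not been changed. -/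
structure EnvelopeInv (h : Hats) (N o : ℕ) (M C X : ℕ → ℝ) (σ : State) : Prop where
  size : σ.nat vN 0 = N
  le : σ.nat vT 0 + 1 ≤ N
  keep : ∀ i < o, σ.real aM i = M i ∧ σ.real aC i = C i ∧ σ.real aX i = X i
  le_end : o ≤ σ.nat vO 0
  last : σ.nat aS (N + σ.nat vT 0) = σ.nat vO 0
  block : ∀ b < N + σ.nat vT 0, ∃ F, IsMaxOf (leaves N b) h.fn F ∧ Block σ b F ∧
    σ.nat aS (b + 1) - σ.nat aS b ≤ 8 * (leaves N b).card + 2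

theorem EnvelopeInv.le_of_le {h : Hats} {N o : ℕ} {M C X : ℕ → ℝ} {σ : State}
    (hI : EnvelopeInv h N o M C X σ) {b : ℕ} (hb : b ≤ N + σ.nat vT 0) :
    σ.nat aS b ≤ σ.nat vO 0 := by
  rw [← hI.last]
  have key : ∀ d, b + d ≤ N + σ.nat vT 0 → σ.nat aS b ≤ σ.nat aS (b + d) := by
    intro d
    induction d with
    | zero => simp
    | succ d ih =>
      intro hd
      obtain ⟨F, -, hB, -⟩ := hI.block (b + d) (by omega)
      exact (ih (by omega)).trans hB.lt.le
  have := key (N + σ.nat vT 0 - b) (by omega)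
  rwa [Nat.add_sub_cancel' hb] at this

/-- The cost of one merge, per unit of weight. -/
def mergeCost : ℕ :=
  (nv vT +ₙ one <ₙ nv vN).cost + mergeInit.bound + 24 * overlayCost + 25 * compressCost +
    mergeDone.bound

theorem ends_merge {h : Hats} {N o : ℕ} {M C X : ℕ → ℝ} {σ : State}
    (hI : EnvelopeInv h N o M C X σ) (ht : σ.nat vT 0 + 1 < N) :
    Ends merge σ (mergeInit.bound + (overlayCost * (24 * (2 * N / (N - 1 - σ.nat vT 0))) +
        (compressCost * (25 * (2 * N / (N - 1 - σ.nat vT 0))) + mergeDone.bound)))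
      (fun τ => EnvelopeInv h N o M C X τ ∧ τ.nat vT 0 = σ.nat vT 0 + 1) := by
  set t := σ.nat vT 0 with htdef
  set W := 2 * N / (N - 1 - t) with hW
  obtain ⟨F, hFmax, hF, hFsize⟩ := hI.block (2 * t) (by omega)
  obtain ⟨G, hGmax, hG, hGsize⟩ := hI.block (2 * t + 1) (by omega)
  have hcard := card_leaves_add_le ht
  rw [← hW] at hcard
  have hpos : ∀ S F, IsMaxOf S h.fn F → 1 ≤ S.card := fun S F hmax => by
    obtain ⟨i, hi, -⟩ := (hmax 0).2
    exact Finset.card_pos.2 ⟨i, hi⟩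
  have hp1 := hpos _ _ hFmax
  have hp2 := hpos _ _ hGmax
  rw [show 2 * t + 1 + 1 = 2 * t + 2 from rfl] at hGsize
  replace hG : IsPL (σ.nat aS (2 * t + 1)) (σ.nat aS (2 * t + 2)) (σ.real aM) (σ.real aC)
    (σ.real aX) G := hG
  have hlen : 2 * (σ.nat aS (2 * t + 1) - σ.nat aS (2 * t)) +
      2 * (σ.nat aS (2 * t + 2) - σ.nat aS (2 * t + 1)) ≤ 24 * W := by
    omega
  refine Ends.seq (R := fun τ => Frame mergeInit.natWrites mergeInit.realWrites σ τ ∧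
      τ.nat vP 0 = σ.nat aS (2 * t) ∧ τ.nat vPE 0 = σ.nat aS (2 * t + 1) ∧
      τ.nat vQ 0 = σ.nat aS (2 * t + 1) ∧ τ.nat vQE 0 = σ.nat aS (2 * t + 2))
    ((Ends.of_wp (Q := fun τ => τ.nat vP 0 = σ.nat aS (2 * t) ∧
      τ.nat vPE 0 = σ.nat aS (2 * t + 1) ∧
      τ.nat vQ 0 = σ.nat aS (2 * t + 1) ∧ τ.nat vQE 0 = σ.nat aS (2 * t + 2)) ?_).frame.mono le_rfl
      fun τ hτ => ⟨hτ.2, hτ.1⟩) ?_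
  · simp only [vT] at htdef
    simp [mergeInit, ← htdef, two_mul]
  rintro τ ⟨hf, h1, h2, h3, h4⟩
  have hf' : Frame [vP, vPE, vQ, vQE] [] σ τ := hf.weaken (by simp [mergeInit])
    (by simp [mergeInit])
  have fM := hf'.real aM (by simp)
  have fC := hf'.real aC (by simp)
  have fX := hf'.real aX (by simp)
  refine Ends.seq ((ends_overlay hF hG fM fC fX h1 h2 h3 h4).frame.mono
    (Nat.mul_le_mul_left _ hlen) fun _ h => h) ?_
  rintro υ ⟨⟨u1, u2, u3, u4⟩, hfu⟩
  have hfu' : Frame [vK, aW, vCross, vHas, vP, vQ] [aE, aFM, aFC, aGM, aGC, vE, vXC] τ υ :=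
    hfu.weaken
      (by simp [overlay, overlayInit, overlayLoop, recordCell, findCross, nextEvent, advance,
        startCell])
      (by simp [overlay, overlayInit, overlayLoop, recordCell, findCross, nextEvent, advance,
        startCell])
  refine Ends.seq ((ends_compress u1 u2 u3 rfl).frame.mono
    (Nat.mul_le_mul_left _ (by omega)) fun _ h => h) ?_
  rintro ω ⟨⟨w1, w2, w3⟩, hfw⟩
  have hfw' : Frame [vO, vJ] [vHM, vHC, aM, aC, aX] υ ω :=
    hfw.weaken (by simp [compress, compressBody]) (by simp [compress, compressBody])
  have n : ∀ a, a ∉ [vP, vPE, vQ, vQE, vK, aW, vCross, vHas, vO, vJ] → ω.nat a = σ.nat a := by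
    intro a ha
    simp at ha
    rw [hfw'.nat a (by simp; omega), hfu'.nat a (by simp; omega), hf'.nat a (by simp; omega)]
  have eO : υ.nat vO 0 = σ.nat vO 0 := by
    rw [hfu'.nat vO (by simp), hf'.nat vO (by simp)]
  have eM : υ.real aM = σ.real aM := by rw [hfu'.real aM (by simp), fM]
  have eC : υ.real aC = σ.real aC := by rw [hfu'.real aC (by simp), fC]
  have eX : υ.real aX = σ.real aX := by rw [hfu'.real aX (by simp), fX]
  rw [eO, eM, eC, eX] at w1
  rw [eO] at w2 w3
  refine Ends.of_wp ?_
  have eT : ω.nat vT 0 = t := by rw [n vT (by simp)]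
  have eN : ω.nat vN 0 = N := by rw [n vN (by simp), hI.size]
  have eS : ω.nat aS = σ.nat aS := by rw [n aS (by simp)]
  have hmono := fun b hb => hI.le_of_le (b := b) hb
  have hmax : IsMaxOf (leaves N (N + t)) h.fn (fun t => max (F t) (G t)) := by
    rw [leaves_add ht]; exact hFmax.union hGmax
  have hsz := card_pieces_le (fun i _ => h.le i) hmax w3 w2
  have hlast := hI.last
  have hkeep := hI.keep
  have hend := hI.le_end
  have hblock := hI.block
  have hwlt := w3.lt
  rw [← htdef] at hlast hblock hmono
  simp only [vT, vN, aS, vO, aM, aC, aX] at *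
  simp [mergeDone]
  refine ⟨?_, eT⟩
  constructor <;> simp [eT, eN]
  · omega
  · intro i hi
    obtain ⟨q1, q2, q3⟩ := w1 i (by omega)
    rw [q1, q2, q3]
    exact hkeep i hi
  · omega
  · rw [eS]
    intro b hb
    rcases eq_or_ne b (N + t) with rfl | hne
    · refine ⟨_, hmax, ?_⟩
      simp [Block, ← add_assoc]
      rw [eS, hlast]
      exact ⟨w3, by omega⟩
    · obtain ⟨H, h5, h6, h7⟩ := hblock b (by omega)
      refine ⟨H, h5, ?_⟩
      simp only [Block, setNat_nat_self, setNat_real]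
      simp only [eS, aM, aC, aX, setNat_nat_of_ne _ _ _ _ _ (show (11 : ℕ) ≠ 12 by decide)]
      rw [Function.update_of_ne (by omega), Function.update_of_ne (by omega)]
      refine ⟨h6.congr fun k _ hk => ?_, by omega⟩
      simp only [aS] at hk
      have := hmono (b + 1) (by omega)
      exact w1 k (by omega)

/-- Divide and conquer computes the upper envelope, in a time proportional to `mergeWork N`. -/
theorem ends_envelope {h : Hats} {N : ℕ} {σ : State} (hN : 1 ≤ N) (hsize : σ.nat vN 0 = N)
    (hlast : σ.nat aS N = σ.nat vO 0)
    (hblock : ∀ b < N, Block σ b (h.fn b) ∧ σ.nat aS (b + 1) = σ.nat aS b + 2) :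
    Ends envelope σ (mergeCost * mergeWork N + (3 + (nv vT +ₙ one <ₙ nv vN).cost))
      (fun τ => (∀ i < σ.nat vO 0, τ.real aM i = σ.real aM i ∧ τ.real aC i = σ.real aC i ∧
          τ.real aX i = σ.real aX i) ∧
        τ.nat aS (2 * N - 1) = τ.nat vO 0 ∧ σ.nat vO 0 ≤ τ.nat vO 0 ∧
        ∃ F, IsMaxOf (Finset.range N) h.fn F ∧ Block τ (2 * N - 2) F ∧
          τ.nat aS (2 * N - 2 + 1) - τ.nat aS (2 * N - 2) ≤ 8 * N + 2) := by
  refine (Ends.seq (s := 3) (t := mergeCost * mergeWork N + (nv vT +ₙ one <ₙ nv vN).cost)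
    (R := fun τ => τ = σ.setNat vT 0 0) ((Ends.of_wp (by simp)).mono (by simp) fun _ h => h)
    ?_).mono (by omega) fun _ h => h
  rintro τ rfl
  refine (Ends.while (EnvelopeInv h N (σ.nat vO 0) (σ.real aM) (σ.real aC) (σ.real aX))
    (fun υ => mergeCost * ∑ j ∈ Finset.range (N - 1 - υ.nat vT 0), 2 * N / (j + 1)) ?_
    fun υ hI hf hb => ⟨_, (ends_merge hI ?_).mono le_rfl fun ω hω => ⟨hω.1, ?_⟩⟩).mono ?_ ?_
  · simp only [vN, aS, vO] at *
    constructor <;> simp [hsize, hlast]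
    · omega
    · intro b hb
      refine ⟨_, fun t => ⟨?_, ?_⟩, (hblock b hb).1, ?_⟩
      · simp [leaves_of_lt hb]
      · simp [leaves_of_lt hb]
      · rw [(hblock b hb).2]; omega
  · have : υ.nat vT 0 + 1 < υ.nat vN 0 := hb
    rwa [hI.size] at this
  · have ht : υ.nat vT 0 + 1 < υ.nat vN 0 := hb
    rw [hI.size] at ht
    rw [hω.2]
    obtain ⟨d, hd⟩ : ∃ d, N - 1 - υ.nat vT 0 = d + 1 := ⟨N - 1 - υ.nat vT 0 - 1, by omega⟩
    rw [show N - 1 - (υ.nat vT 0 + 1) = d by omega, hd, Finset.sum_range_succ, mul_add]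
    have h1 : 1 ≤ 2 * N / (d + 1) := by
      rw [Nat.le_div_iff_mul_le (by omega)]; omega
    generalize 2 * N / (d + 1) = w at h1 ⊢
    have : mergeCost = (nv vT +ₙ one <ₙ nv vN).cost + mergeInit.bound + 24 * overlayCost +
      25 * compressCost + mergeDone.bound := rfl
    rw [this]
    generalize (nv vT +ₙ one <ₙ nv vN).cost = c₁
    generalize mergeInit.bound = c₂
    generalize mergeDone.bound = c₃
    generalize overlayCost = c₄
    generalize compressCost = c₅
    nlinarith [Nat.mul_le_mul_left (c₁ + c₂ + c₃) h1]
  · simp [mergeWork]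
  · rintro υ ⟨hI, hn, -⟩
    have ht : ¬ υ.nat vT 0 + 1 < υ.nat vN 0 := hn
    rw [hI.size] at ht
    have hle := hI.le
    have hl := hI.last
    have h2 : υ.nat vT 0 = N - 1 := by omega
    rw [h2, show N + (N - 1) = 2 * N - 1 by omega] at hl
    refine ⟨hI.keep, hl, hI.le_end, ?_⟩
    obtain ⟨F, h3, h4, h5⟩ := hI.block (2 * N - 2) (by omega)
    rw [leaves_root hN, Finset.card_range] at h5
    rw [leaves_root hN] at h3
    exact ⟨F, h3, h4, h5⟩

end RealRAM

/-! ### Loading the input -/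

namespace RealRAM

/-!
More variables: the two lines `vA`, `vB` and `vA'`, `vB'` of an input function and its breakpoint
`vY`, the uncovered slope `vS`, and the number `inN` of double-wedges in the input.
-/

@[simp] abbrev vA : ℕ := 20
@[simp] abbrev vB : ℕ := 21
@[simp] abbrev vA' : ℕ := 22
@[simp] abbrev vB' : ℕ := 23
@[simp] abbrev vY : ℕ := 24
@[simp] abbrev vS : ℕ := 30
@[simp] abbrev inN : ℕ := 0

/-- Append a block that consists of two pieces. -/
def storeLeaf : Prog :=
  .setNat aS (nv vN) (nv vO) ;;
  .setReal aM (nv vO) (rv vA) ;; .setReal aC (nv vO) (rv vB) ;;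
  .setReal aM (nv vO +ₙ one) (rv vA') ;; .setReal aC (nv vO +ₙ one) (rv vB') ;;
  .setReal aX (nv vO +ₙ one) (rv vY) ;;
  setN vO (nv vO +ₙ .const 2) ;; setN vN (nv vN +ₙ one) ;; setN vI (nv vI +ₙ one)

/-- For every double-wedge, compute two lines and a breakpoint by `leaf`, and append the function
that is the first line up to the breakpoint and the second line from there on. -/
def load (leaf : Prog) : Prog :=
  setN vI (.const 0) ;; .while (nv vI <ₙ nv inN) (leaf ;; storeLeaf) ;;
  .setNat aS (nv vN) (nv vO)

/-- The invariant of the loading loop: before it, there were `N` blocks with `o` pieces. -/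
structure LoadInv (n N o : ℕ) (F : ℕ → ℝ → ℝ) (σ τ : State) : Prop where
  le : τ.nat vI 0 ≤ n
  size : τ.nat vN 0 = N + τ.nat vI 0
  endO : τ.nat vO 0 = o + 2 * τ.nat vI 0
  start : ∀ j < τ.nat vI 0, τ.nat aS (N + j) = o + 2 * j
  keepS : ∀ b < N, τ.nat aS b = σ.nat aS b
  keep : ∀ i < o, τ.real aM i = σ.real aM i ∧ τ.real aC i = σ.real aC i ∧
    τ.real aX i = σ.real aX i
  block : ∀ j < τ.nat vI 0,
    IsPL (o + 2 * j) (o + 2 * j + 2) (τ.real aM) (τ.real aC) (τ.real aX) (F j)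

theorem wp_storeLeaf {n N o : ℕ} {F : ℕ → ℝ → ℝ} {σ τ : State} (hI : LoadInv n N o F σ τ)
    (hi : τ.nat vI 0 < n)
    (h1 : ∀ t ≤ τ.real vY 0, F (τ.nat vI 0) t = τ.real vA 0 * t + τ.real vB 0)
    (h2 : ∀ t, τ.real vY 0 ≤ t → F (τ.nat vI 0) t = τ.real vA' 0 * t + τ.real vB' 0) :
    wp storeLeaf (fun υ => LoadInv n N o F σ υ ∧ υ.nat vI 0 = τ.nat vI 0 + 1) τ := by
  obtain ⟨e1, e2, e3, e4, e5, e6, e7⟩ := hI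
  simp only [vI, vN, vO, aS, aM, aC, aX, vY, vA, vB, vA', vB'] at *
  simp [storeLeaf]
  constructor <;> simp
  · omega
  · omega
  · omega
  · intro j hj
    rcases eq_or_ne (N + j) (τ.nat 10 0) with h | h
    · rw [h, Function.update_self]; omega
    · rw [Function.update_of_ne h]; exact e4 j (by omega)
  · intro b hb
    rw [Function.update_of_ne (by omega)]; exact e5 b hb
  · intro i hi
    rw [Function.update_of_ne (by omega), Function.update_of_ne (by omega),
      Function.update_of_ne (by omega), Function.update_of_ne (by omega),
      Function.update_of_ne (by omega)]
    exact e6 i hi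
  · intro j hj
    rcases eq_or_ne j (τ.nat 13 0) with rfl | h
    · rw [← e3]
      apply IsPL.pair
      · simpa using h1
      · simpa using h2
    · refine (e7 j (by omega)).congr fun k hk1 hk2 => ?_
      rw [Function.update_of_ne (by omega), Function.update_of_ne (by omega),
        Function.update_of_ne (by omega), Function.update_of_ne (by omega),
        Function.update_of_ne (by omega)]
      exact ⟨rfl, rfl, rfl⟩

/-- The real arrays that may be used by the computation of a leaf. -/
def leafTemps : List ℕ := [20, 21, 22, 23, 24, 25, 26, 27, 28, 29]

/-- The cost of loading, per double-wedge. -/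
def loadCost (leaf : Prog) : ℕ :=
  (nv vI <ₙ nv inN).cost + leaf.bound + storeLeaf.bound + 8

theorem ends_load {leaf : Prog} {n : ℕ} {F : ℕ → ℝ → ℝ} {σ : State} (hn : σ.nat inN 0 = n)
    (hcn : leaf.natWrites = []) (hcr : leaf.realWrites ⊆ leafTemps)
    (hleaf : ∀ τ, (∀ a < 3, τ.nat a = σ.nat a) → (∀ a < 4, τ.real a = σ.real a) →
      τ.real vS = σ.real vS → τ.nat vI 0 < n →
      wp leaf (fun υ => (∀ t ≤ υ.real vY 0, F (τ.nat vI 0) t = υ.real vA 0 * t + υ.real vB 0) ∧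
        (∀ t, υ.real vY 0 ≤ t → F (τ.nat vI 0) t = υ.real vA' 0 * t + υ.real vB' 0)) τ) :
    Ends (load leaf) σ (loadCost leaf * (n + 1)) (fun τ =>
      τ.nat vN 0 = σ.nat vN 0 + n ∧ τ.nat aS (τ.nat vN 0) = τ.nat vO 0 ∧
      τ.nat vO 0 = σ.nat vO 0 + 2 * n ∧
      (∀ b < σ.nat vN 0, τ.nat aS b = σ.nat aS b) ∧
      (0 < n → τ.nat aS (σ.nat vN 0) = σ.nat vO 0) ∧
      (∀ i < σ.nat vO 0, τ.real aM i = σ.real aM i ∧ τ.real aC i = σ.real aC i ∧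
        τ.real aX i = σ.real aX i) ∧
      (∀ j < n, Block τ (σ.nat vN 0 + j) (F j) ∧
        τ.nat aS (σ.nat vN 0 + j + 1) = τ.nat aS (σ.nat vN 0 + j) + 2)) := by
  set N := σ.nat vN 0 with hN
  set o := σ.nat vO 0 with ho
  set b : Test := nv vI <ₙ nv inN with hb
  refine (Ends.seq (s := 3) (R := fun τ => τ = σ.setNat vI 0 0)
    ((Ends.of_wp (by simp)).mono (by simp) fun _ h => h)
    (t := ((b.cost + (leaf.bound + storeLeaf.bound)) * n + b.cost) + 5) ?_).mono ?_ fun _ h => h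
  · rintro τ rfl
    refine Ends.seq ((Ends.while (b := b) (LoadInv n N o F σ)
      (fun υ => (b.cost + (leaf.bound + storeLeaf.bound)) * (n - υ.nat vI 0)) ?_
      fun υ hI hf hb' => ⟨leaf.bound + storeLeaf.bound, ?_⟩).mono ?_ fun _ h => h) ?_
    · constructor <;> simp
      · exact hN.symm
      · exact ho.symm
    · have n1 : ∀ a < 3, υ.nat a = σ.nat a := fun a ha => by
        have : a ≠ 13 := by omega
        rw [hf.nat a (by simp [hcn, storeLeaf]; omega)]
        simp [this]
      have r1 : ∀ a, a < 4 ∨ a = vS → υ.real a = σ.real a := fun a ha => by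
        rw [hf.real a]
        · simp
        · intro h
          simp only [Prog.realWrites, List.mem_append] at h
          rcases h with h | h
          · have := hcr h
            simp [leafTemps] at this
            simp at ha
            omega
          · simp [storeLeaf] at h
            simp at ha
            omega
      have hi : υ.nat vI 0 < n := by
        have h : υ.nat vI 0 < υ.nat inN 0 := hb'
        rwa [n1 inN (by simp), hn] at h
      refine Ends.seq (Ends.of_wp (hleaf υ n1 (fun a ha => r1 a (.inl ha)) (r1 vS (.inr rfl))
        hi)).frame fun ω hω => ?_
      obtain ⟨⟨c1, c2⟩, hfw⟩ := hω
      have n2 : ω.nat = υ.nat := funext fun a => hfw.nat a (by simp [hcn])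
      have r2 : ∀ a < 20, ω.real a = υ.real a := fun a ha => by
        refine hfw.real a fun h => ?_
        have := hcr h
        simp [leafTemps] at this
        omega
      have hI' : LoadInv n N o F σ ω := by
        obtain ⟨e1, e2, e3, e4, e5, e6, e7⟩ := hI
        constructor <;> simp only [n2, r2 aM (by simp), r2 aC (by simp), r2 aX (by simp)] <;>
          assumption
      rw [← n2] at hi c1 c2 ⊢
      refine (Ends.of_wp (wp_storeLeaf hI' hi c1 c2)).mono le_rfl fun υ' h => ⟨h.1, ?_⟩
      rw [h.2]
      obtain ⟨d, hd⟩ : ∃ d, n - ω.nat vI 0 = d + 1 := ⟨n - ω.nat vI 0 - 1, by omega⟩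
      rw [show n - (ω.nat vI 0 + 1) = d by omega, hd, mul_add, mul_one]
      exact (Nat.add_comm _ _).le
    · simp
    · rintro υ ⟨⟨e1, e2, e3, e4, e5, e6, e7⟩, hnb, hf⟩
      have h : ¬ υ.nat vI 0 < υ.nat inN 0 := hnb
      have nn : υ.nat inN = σ.nat inN := by
        rw [hf.nat inN (by simp [hcn, storeLeaf])]; simp
      rw [nn, hn] at h
      have hi : υ.nat vI 0 = n := by omega
      rw [hi] at e2 e3 e4 e7
      refine (Ends.of_wp (P := .setNat aS (nv vN) (nv vO)) ?_).mono
        (by simp) fun _ h => h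
      simp only [vN, vO, aS, aM, aC, aX, vI] at *
      simp
      have upd : ∀ j ≤ n, Function.update (υ.nat 11) (υ.nat 10 0) (υ.nat 15 0) (N + j) =
          o + 2 * j := by
        intro j hj
        rcases eq_or_ne (N + j) (υ.nat 10 0) with h | h
        · rw [h, Function.update_self, e3]; omega
        · rw [Function.update_of_ne h]; exact e4 j (by omega)
      refine ⟨e2, e3, fun b hb => ?_, fun hpos => ?_, e6, fun j hj => ⟨?_, ?_⟩⟩
      · rw [Function.update_of_ne (by omega)]; exact e5 b hb
      · exact upd 0 (by omega)
      · have := upd (j + 1) (by omega)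
        rw [← add_assoc] at this
        simp only [Block, aS, aM, aC, aX, setNat_nat_self, setNat_real]
        rw [upd j hj.le, this]
        exact e7 j hj
      · have := upd (j + 1) (by omega)
        rw [← add_assoc] at this
        rw [upd j hj.le, this]
        ring
  · have : loadCost leaf = b.cost + leaf.bound + storeLeaf.bound + 8 := rfl
    rw [this]
    generalize b.cost = c₁
    generalize leaf.bound = c₂
    generalize storeLeaf.bound = c₃
    nlinarith [Nat.zero_le (c₂ + c₃)]

end RealRAM

/-! ### Finding a slope that is not covered -/

/-- The condition for the slope `s` not to be covered by the double-wedge whose lines have slopes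
`m₁` and `m₂`; the wedge contains no vertical line iff `same` holds. -/
def Uncovered (same : Prop) (m₁ m₂ s : ℝ) : Prop :=
  (same → 0 < (m₁ - s) * (m₂ - s)) ∧ (¬ same → (m₁ - s) * (m₂ - s) < 0)

namespace RealRAM

/-- Functions whose maximum is negative at the slopes that are not covered: for a double-wedge
without vertical lines, the function `s ↦ min (s - lo) (hi - s)` (twice), and for the other ones the
functions `s ↦ lo - s` and `s ↦ s - hi`, where `lo < hi` are the slopes of the two lines. -/
def slopeHats (n : ℕ) (m₁ m₂ : ℕ → ℝ) (f₁ f₂ : ℕ → ℕ) : Hats where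
  a j := if j < n then (if f₁ j = f₂ j then 1 else -1) else 1
  b j := if j < n then (if f₁ j = f₂ j then -min (m₁ j) (m₂ j) else min (m₁ j) (m₂ j))
    else if f₁ (j - n) = f₂ (j - n) then -min (m₁ (j - n)) (m₂ (j - n))
    else -max (m₁ (j - n)) (m₂ (j - n))
  a' j := if j < n then -1 else if f₁ (j - n) = f₂ (j - n) then -1 else 1
  b' j := if j < n then (if f₁ j = f₂ j then max (m₁ j) (m₂ j) else min (m₁ j) (m₂ j))
    else if f₁ (j - n) = f₂ (j - n) then max (m₁ (j - n)) (m₂ (j - n))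
    else -max (m₁ (j - n)) (m₂ (j - n))
  le j := by split_ifs <;> norm_num

section slopeHats

variable {n : ℕ} {m₁ m₂ : ℕ → ℝ} {f₁ f₂ : ℕ → ℕ}

theorem slopeHats_same {i : ℕ} (h : f₁ i = f₂ i) (t : ℝ) :
    (i < n → (slopeHats n m₁ m₂ f₁ f₂).fn i t =
      min (t - min (m₁ i) (m₂ i)) (max (m₁ i) (m₂ i) - t)) ∧
    (slopeHats n m₁ m₂ f₁ f₂).fn (n + i) t =
      min (t - min (m₁ i) (m₂ i)) (max (m₁ i) (m₂ i) - t) := by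
  constructor
  · intro hi
    simp only [Hats.fn, slopeHats, hi, h, if_true]
    congr 1 <;> ring
  · simp only [Hats.fn, slopeHats, show ¬ n + i < n by omega, Nat.add_sub_cancel_left, h, if_true,
      if_false]
    congr 1 <;> ring

theorem slopeHats_differ {i : ℕ} (h : f₁ i ≠ f₂ i) (t : ℝ) :
    (i < n → (slopeHats n m₁ m₂ f₁ f₂).fn i t = min (m₁ i) (m₂ i) - t) ∧
    (slopeHats n m₁ m₂ f₁ f₂).fn (n + i) t = t - max (m₁ i) (m₂ i) := by
  constructor
  · intro hi
    simp only [Hats.fn, slopeHats, hi, h, if_true, if_false, min_self]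
    ring
  · simp only [Hats.fn, slopeHats, show ¬ n + i < n by omega, Nat.add_sub_cancel_left, h,
      if_false, min_self]
    ring

theorem uncovered_of_neg {F : ℝ → ℝ} {s : ℝ}
    (hF : IsMaxOf (Finset.range (n + n)) (slopeHats n m₁ m₂ f₁ f₂).fn F) (hs : F s < 0) {i : ℕ}
    (hi : i < n) : Uncovered (f₁ i = f₂ i) (m₁ i) (m₂ i) s := by
  have h1 := ((hF s).1 i (Finset.mem_range.2 (by omega))).trans_lt hs
  have h2 := ((hF s).1 (n + i) (Finset.mem_range.2 (by omega))).trans_lt hs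
  constructor
  · intro h
    rw [(slopeHats_same h s).1 hi] at h1
    rcases min_lt_iff.1 h1 with h3 | h3
    · have h4 : s < m₁ i := by linarith [min_le_left (m₁ i) (m₂ i)]
      have h5 : s < m₂ i := by linarith [min_le_right (m₁ i) (m₂ i)]
      exact mul_pos (by linarith) (by linarith)
    · have h4 : m₁ i < s := by linarith [le_max_left (m₁ i) (m₂ i)]
      have h5 : m₂ i < s := by linarith [le_max_right (m₁ i) (m₂ i)]
      exact mul_pos_of_neg_of_neg (by linarith) (by linarith)
  · intro h
    rw [(slopeHats_differ h s).1 hi] at h1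
    rw [(slopeHats_differ h s).2] at h2
    rcases le_total (m₁ i) (m₂ i) with h3 | h3
    · rw [min_eq_left h3] at h1
      rw [max_eq_right h3] at h2
      exact mul_neg_of_neg_of_pos (by linarith) (by linarith)
    · rw [min_eq_right h3] at h1
      rw [max_eq_left h3] at h2
      exact mul_neg_of_pos_of_neg (by linarith) (by linarith)

theorem neg_of_uncovered {F : ℝ → ℝ} {s : ℝ}
    (hF : IsMaxOf (Finset.range (n + n)) (slopeHats n m₁ m₂ f₁ f₂).fn F)
    (h : ∀ i < n, Uncovered (f₁ i = f₂ i) (m₁ i) (m₂ i) s) : F s < 0 := by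
  obtain ⟨j, hj, hFj⟩ := (hF s).2
  rw [← hFj]
  obtain ⟨i, hi, hji⟩ : ∃ i, i < n ∧ (j = i ∨ j = n + i) := by
    rw [Finset.mem_range] at hj
    by_cases h : j < n
    · exact ⟨j, h, .inl rfl⟩
    · exact ⟨j - n, by omega, .inr (by omega)⟩
  by_cases hs : f₁ i = f₂ i
  · have h1 := (h i hi).1 hs
    have h2 : min (s - min (m₁ i) (m₂ i)) (max (m₁ i) (m₂ i) - s) < 0 := by
      rw [min_lt_iff]
      rcases pos_and_pos_or_neg_and_neg_of_mul_pos h1 with ⟨h3, h4⟩ | ⟨h3, h4⟩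
      · left
        have : s < min (m₁ i) (m₂ i) := lt_min (by linarith) (by linarith)
        linarith
      · right
        have : max (m₁ i) (m₂ i) < s := max_lt (by linarith) (by linarith)
        linarith
    rcases hji with rfl | rfl
    · rwa [(slopeHats_same hs s).1 hi]
    · rwa [(slopeHats_same hs s).2]
  · have h1 := (h i hi).2 hs
    have h2 : min (m₁ i) (m₂ i) < s ∧ s < max (m₁ i) (m₂ i) := by
      rw [min_lt_iff, lt_max_iff]
      rcases mul_neg_iff.1 h1 with ⟨h3, h4⟩ | ⟨h3, h4⟩
      · exact ⟨.inr (by linarith), .inl (by linarith)⟩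
      · exact ⟨.inl (by linarith), .inr (by linarith)⟩
    rcases hji with rfl | rfl
    · rw [(slopeHats_differ hs s).1 hi]; linarith
    · rw [(slopeHats_differ hs s).2]; linarith

/-- A negative value of `F` shows up at a breakpoint, unless the last piece is decreasing: if `F` is
negative near `-∞`, then no double-wedge contains vertical lines, so that `F` is negative and
decreasing near `∞`. -/
theorem exists_neg_break {F : ℝ → ℝ} {s : ℝ} {st en : ℕ} {m c x : ℕ → ℝ}
    (hF : IsMaxOf (Finset.range (n + n)) (slopeHats n m₁ m₂ f₁ f₂).fn F)
    (hpl : IsPL st en m c x F) (hs : F s < 0) (hlast : 0 ≤ m (en - 1)) :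
    ∃ k, st < k ∧ k < en ∧ F (x k) < 0 := by
  by_contra hcon
  push Not at hcon
  have hse := hpl.lt
  -- `F` is negative on the whole left ray
  have hleft : ∀ t ≤ s, F t < 0 := by
    obtain ⟨k, hk1, hk2, hk3, hk4⟩ := hpl.exists_piece s
    have ev := hpl.eval k hk1 hk2
    have es := ev s hk3 (fun h => (hk4 h).le) fun _ => trivial
    have hm : 0 ≤ m k := by
      by_cases hk : k + 1 < en
      · have h1 := hcon (k + 1) (by omega) hk
        rw [ev (x (k + 1)) (fun h => (hk3 h).trans (hk4 hk).le) (fun _ => le_rfl)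
          fun _ => trivial] at h1
        by_contra h2
        nlinarith [mul_pos_of_neg_of_neg (not_le.1 h2) (sub_neg.2 (hk4 hk))]
      · rwa [show k = en - 1 by omega]
    rcases hk1.eq_or_lt with rfl | hlt
    · intro t ht
      rw [ev t (by omega) (fun h => ht.trans (hk4 h).le) fun _ => trivial]
      nlinarith
    · have h1 := hcon k hlt hk2
      rw [ev (x k) (fun _ => le_rfl) (fun h => (hk3 hlt).trans (hk4 h).le) fun _ => trivial] at h1
      nlinarith [hk3 hlt]
  have same : ∀ i < n, f₁ i = f₂ i := by
    intro i hi
    by_contra h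
    have h1 := (hF (min s (min (m₁ i) (m₂ i)))).1 i (Finset.mem_range.2 (by omega))
    rw [(slopeHats_differ h _).1 hi] at h1
    have h2 := hleft (min s (min (m₁ i) (m₂ i))) (min_le_left _ _)
    linarith [min_le_right s (min (m₁ i) (m₂ i))]
  -- far to the right all functions are decreasing
  obtain ⟨T, hT⟩ : ∃ T, ∀ i < n, max (m₁ i) (m₂ i) ≤ T ∧ -min (m₁ i) (m₂ i) ≤ T := by
    refine ⟨∑ i ∈ Finset.range n, (|m₁ i| + |m₂ i|), fun i hi => ?_⟩
    have h1 : |m₁ i| + |m₂ i| ≤ ∑ i ∈ Finset.range n, (|m₁ i| + |m₂ i|) :=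
      Finset.single_le_sum (f := fun i => |m₁ i| + |m₂ i|)
        (fun j _ => by positivity) (Finset.mem_range.2 hi)
    have h2 := le_abs_self (m₁ i)
    have h3 := le_abs_self (m₂ i)
    have h4 := neg_abs_le (m₁ i)
    have h5 := neg_abs_le (m₂ i)
    have h6 := abs_nonneg (m₁ i)
    have h7 := abs_nonneg (m₂ i)
    refine ⟨max_le (by linarith) (by linarith), ?_⟩
    rw [neg_le]
    exact le_min (by linarith) (by linarith)
  have dec : ∀ t, T ≤ t → F (t + 1) ≤ F t - 1 := by
    intro t ht
    obtain ⟨j, hj, hFj⟩ := (hF (t + 1)).2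
    have h1 := (hF t).1 j hj
    rw [← hFj]
    obtain ⟨i, hi, hji⟩ : ∃ i, i < n ∧ (j = i ∨ j = n + i) := by
      rw [Finset.mem_range] at hj
      by_cases h : j < n
      · exact ⟨j, h, .inl rfl⟩
      · exact ⟨j - n, by omega, .inr (by omega)⟩
    have e : ∀ u, (slopeHats n m₁ m₂ f₁ f₂).fn j u =
        min (u - min (m₁ i) (m₂ i)) (max (m₁ i) (m₂ i) - u) := by
      intro u
      rcases hji with rfl | rfl
      · exact (slopeHats_same (same j hi) u).1 hi
      · exact (slopeHats_same (same i hi) u).2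
    rw [e] at h1 ⊢
    have hTi := hT i hi
    have : max (m₁ i) (m₂ i) - t ≤ t - min (m₁ i) (m₂ i) := by
      have := min_le_max (a := m₁ i) (b := m₂ i)
      linarith
    rw [min_eq_right this] at h1
    exact (min_le_right _ _).trans (by linarith)
  have ev := fun t h => hpl.eval (en - 1) (by omega) (by omega) t h (fun h => by omega)
    fun _ => trivial
  have h1 := dec (max T (x (en - 1))) (le_max_left _ _)
  rw [ev _ fun _ => le_max_right _ _,
    ev _ fun _ => (le_max_right T (x (en - 1))).trans (by linarith)] at h1
  linarith

end slopeHats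

/-- The pieces of a function of `slopeHats`; `dm` and `dc` are slope and intercept of the line used
for double-wedges that contain vertical lines. -/
def slopeLeaf (dm : ℚ) (dc : RExp) : Prog :=
  .ite (.get 0 (nv vI) <ᵣ .get 2 (nv vI))
    (setR 27 (.get 0 (nv vI)) ;; setR 28 (.get 2 (nv vI)))
    (setR 27 (.get 2 (nv vI)) ;; setR 28 (.get 0 (nv vI))) ;;
  .ite (.and (.not (.get 1 (nv vI) <ₙ .get 2 (nv vI))) (.not (.get 2 (nv vI) <ₙ .get 1 (nv vI))))
    (setR vA (.const 1) ;; setR vB (.const 0 -ᵣ rv 27) ;;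
      setR vA' (.const (-1)) ;; setR vB' (rv 28) ;; setR vY ((rv 27 +ᵣ rv 28) /ᵣ .const 2))
    (setR vA (.const dm) ;; setR vB dc ;;
      setR vA' (.const dm) ;; setR vB' dc ;; setR vY (.const 0))

theorem wp_slopeLeaf {τ : State} {dm : ℚ} {dc : RExp} {G : ℝ → ℝ}
    (hdc : ∃ q : ℝ → ℝ → ℝ, (∀ υ : State, dc.eval υ = q (υ.real 27 0) (υ.real 28 0)) ∧
      (τ.nat 1 (τ.nat vI 0) ≠ τ.nat 2 (τ.nat vI 0) → ∀ t, G t = dm * t +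
        q (min (τ.real 0 (τ.nat vI 0)) (τ.real 2 (τ.nat vI 0)))
          (max (τ.real 0 (τ.nat vI 0)) (τ.real 2 (τ.nat vI 0)))))
    (hG : τ.nat 1 (τ.nat vI 0) = τ.nat 2 (τ.nat vI 0) → ∀ t, G t =
      min (t - min (τ.real 0 (τ.nat vI 0)) (τ.real 2 (τ.nat vI 0)))
        (max (τ.real 0 (τ.nat vI 0)) (τ.real 2 (τ.nat vI 0)) - t)) :
    wp (slopeLeaf dm dc) (fun υ =>
      (∀ t ≤ υ.real vY 0, G t = υ.real vA 0 * t + υ.real vB 0) ∧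
      (∀ t, υ.real vY 0 ≤ t → G t = υ.real vA' 0 * t + υ.real vB' 0)) τ := by
  obtain ⟨q, hq, hd⟩ := hdc
  simp only [vI, vY, vA, vB, vA', vB'] at *
  simp [slopeLeaf, hq]
  constructor
  · intro hlt
    rw [min_eq_left hlt.le, max_eq_right hlt.le] at hd hG
    refine ⟨fun h1 h2 => ?_, fun h1 => ?_⟩
    · have hG := hG (le_antisymm h2 h1)
      refine ⟨fun t ht => ?_, fun t ht => ?_⟩
      · rw [hG, min_eq_left (by linarith)]; ring
      · rw [hG, min_eq_right (by linarith)]; ring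
    · have hd := hd (by omega)
      exact ⟨fun t _ => hd t, fun t _ => hd t⟩
  · intro hge
    rw [min_eq_right hge, max_eq_left hge] at hd hG
    refine ⟨fun h1 h2 => ?_, fun h1 => ?_⟩
    · have hG := hG (le_antisymm h2 h1)
      refine ⟨fun t ht => ?_, fun t ht => ?_⟩
      · rw [hG, min_eq_left (by linarith)]; ring
      · rw [hG, min_eq_right (by linarith)]; ring
    · have hd := hd (by omega)
      exact ⟨fun t _ => hd t, fun t _ => hd t⟩

/-! The scan for a negative value. -/

def scanInit : Prog :=
  setN vJ (.get aS (nv vN +ₙ nv vN -ₙ .const 2) +ₙ one) ;; setR vS (.const 0)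

def scanBody : Prog :=
  .ite (.get aM (nv vJ) *ᵣ .get aX (nv vJ) +ᵣ .get aC (nv vJ) <ᵣ .const 0)
    (setR vS (.get aX (nv vJ))) .skip ;;
  setN vJ (nv vJ +ₙ one)

/-- If the last piece is decreasing, then it is negative at `1 - c / m`, and to the right of
that. -/
def scanLast : Prog :=
  .ite (lastM <ᵣ .const 0)
    (setR vS (.const 1 -ᵣ .get aC (nv vO -ₙ one) /ᵣ lastM) ;;
      .ite (rv vS <ᵣ .get aX (nv vO -ₙ one)) (setR vS (.get aX (nv vO -ₙ one))) .skip) .skip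

/-- Find a point at which the last block is negative. -/
def scan : Prog := scanInit ;; .while (nv vJ <ₙ nv vO) scanBody ;; scanLast

/-- The cost of the scan, per piece. -/
def scanCost : ℕ := scanInit.bound + (nv vJ <ₙ nv vO).cost + scanBody.bound + scanLast.bound

theorem ends_scan {N : ℕ} {F : ℝ → ℝ} {σ : State} (hN : σ.nat vN 0 = N)
    (hpl : IsPL (σ.nat aS (2 * N - 2)) (σ.nat vO 0) (σ.real aM) (σ.real aC) (σ.real aX) F)
    (hF : 0 ≤ σ.real aM (σ.nat vO 0 - 1) →
      ∃ k, σ.nat aS (2 * N - 2) < k ∧ k < σ.nat vO 0 ∧ F (σ.real aX k) < 0) :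
    Ends scan σ (scanCost * (σ.nat vO 0 - σ.nat aS (2 * N - 2) + 1))
      (fun τ => F (τ.real vS 0) < 0) := by
  set st := σ.nat aS (2 * N - 2) with hst
  set en := σ.nat vO 0 with hen
  have hlt := hpl.lt
  have ev : ∀ k, st < k → k < en → F (σ.real aX k) =
      σ.real aM k * σ.real aX k + σ.real aC k := fun k h1 h2 =>
    hpl.eval k h1.le h2 _ (fun _ => le_rfl) (fun h => (hpl.mono k h1 h).le) fun _ => trivial
  set b : Test := nv vJ <ₙ nv vO with hb
  refine (Ends.seq (R := fun τ => Frame [vJ] [vS] σ τ ∧ τ.nat vJ 0 = st + 1)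
    ((Ends.of_wp (Q := fun τ => τ.nat vJ 0 = st + 1) ?_).frame.mono (le_refl scanInit.bound)
      fun τ h => ⟨h.2.weaken (by simp [scanInit]) (by simp [scanInit]), h.1⟩)
    (t := (b.cost + scanBody.bound) * (en - st) + b.cost + scanLast.bound) ?_).mono ?_
    fun _ h => h
  · simp only [vN, aS] at hN hst
    simp [scanInit, hN, ← two_mul, ← hst]
  · rintro τ ⟨hf, hJ⟩
    have tM := hf.real aM (by simp)
    have tC := hf.real aC (by simp)
    have tX := hf.real aX (by simp)
    have tO : τ.nat vO 0 = en := by rw [hf.nat vO (by simp)]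
    refine Ends.seq ((Ends.while (b := b) (fun υ =>
        st < υ.nat vJ 0 ∧ υ.nat vJ 0 ≤ en ∧
        ((∃ k, st < k ∧ k < υ.nat vJ 0 ∧ F (σ.real aX k) < 0) → F (υ.real vS 0) < 0))
      (fun υ => (b.cost + scanBody.bound) * (en - υ.nat vJ 0)) ?_
      fun υ hI hfu hb' => ⟨scanBody.bound, (Ends.of_wp (Q := fun ω =>
        (st < ω.nat vJ 0 ∧ ω.nat vJ 0 ≤ en ∧
        ((∃ k, st < k ∧ k < ω.nat vJ 0 ∧ F (σ.real aX k) < 0) → F (ω.real vS 0) < 0)) ∧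
        ω.nat vJ 0 = υ.nat vJ 0 + 1) ?_).mono le_rfl ?_⟩).mono ?_
        fun _ h => h) ?_
    · rw [hJ]
      refine ⟨by omega, by omega, ?_⟩
      rintro ⟨k, h1, h2, -⟩
      omega
    · have uM : υ.real aM = σ.real aM := by rw [hfu.real aM (by simp [scanBody]), tM]
      have uC : υ.real aC = σ.real aC := by rw [hfu.real aC (by simp [scanBody]), tC]
      have uX : υ.real aX = σ.real aX := by rw [hfu.real aX (by simp [scanBody]), tX]
      have uO : υ.nat vO 0 = en := by rw [hfu.nat vO (by simp [scanBody]), tO]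
      have hj : υ.nat vJ 0 < υ.nat vO 0 := hb'
      rw [uO] at hj
      obtain ⟨i1, i2, i3⟩ := hI
      have evj := ev _ i1 hj
      simp only [aM, aC, aX, vJ, vS, vO] at *
      simp [scanBody, uM, uC, uX]
      refine ⟨fun hneg => ⟨by omega, by omega, fun k _ _ _ => ?_⟩,
        fun hpos => ⟨by omega, by omega, fun k h1 h2 h3 => ?_⟩⟩
      · rw [evj]; exact hneg
      · rcases h2.eq_or_lt with rfl | h4
        · rw [evj] at h3; linarith
        · exact i3 ⟨k, h1, h4, h3⟩
    · rintro ω ⟨h1, h2⟩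
      refine ⟨h1, ?_⟩
      have h3 := h1.2.1
      rw [h2] at h3 ⊢
      obtain ⟨d, hd⟩ : ∃ d, en - υ.nat vJ 0 = d + 1 := ⟨en - υ.nat vJ 0 - 1, by omega⟩
      rw [show en - (υ.nat vJ 0 + 1) = d by omega, hd, mul_add, mul_one]
      exact (Nat.add_comm _ _).le
    · rw [hJ]
      have : en - (st + 1) ≤ en - st := by omega
      have := Nat.mul_le_mul_left (b.cost + scanBody.bound) this
      omega
    · rintro υ ⟨⟨i1, i2, i3⟩, hnb, hfu⟩
      have uM : υ.real aM = σ.real aM := by rw [hfu.real aM (by simp [scanBody]), tM]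
      have uC : υ.real aC = σ.real aC := by rw [hfu.real aC (by simp [scanBody]), tC]
      have uX : υ.real aX = σ.real aX := by rw [hfu.real aX (by simp [scanBody]), tX]
      have uO : υ.nat vO 0 = en := by rw [hfu.nat vO (by simp [scanBody]), tO]
      have hj : ¬ υ.nat vJ 0 < υ.nat vO 0 := hnb
      rw [uO] at hj
      have hjen : υ.nat vJ 0 = en := by omega
      rw [hjen] at i3
      have hlast : ∀ t, σ.real aX (en - 1) ≤ t →
          F t = σ.real aM (en - 1) * t + σ.real aC (en - 1) := fun t ht =>
        hpl.eval (en - 1) (by omega) (by omega) t (fun _ => ht) (fun h => by omega) fun _ => trivial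
      have hneg : ∀ t, σ.real aM (en - 1) < 0 →
          1 - σ.real aC (en - 1) / σ.real aM (en - 1) ≤ t →
          σ.real aM (en - 1) * t + σ.real aC (en - 1) < 0 := by
        intro t h1 h2
        have h3 : σ.real aM (en - 1) * (1 - σ.real aC (en - 1) / σ.real aM (en - 1)) =
            σ.real aM (en - 1) - σ.real aC (en - 1) := by
          rw [mul_sub, mul_one, mul_div_cancel₀ _ h1.ne]
        nlinarith
      refine Ends.of_wp ?_
      simp only [aM, aC, aX, vJ, vS, vO] at *
      simp [scanLast, uM, uC, uX, uO]
      refine ⟨fun h1 => ⟨fun h2 => ?_, fun h2 => ?_⟩, fun h1 => i3 (hF h1)⟩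
      · rw [hlast _ le_rfl]
        exact hneg _ h1 h2.le
      · rw [hlast _ h2]
        exact hneg _ h1 le_rfl
  · have : scanCost = scanInit.bound + b.cost + scanBody.bound + scanLast.bound := rfl
    rw [this]
    generalize scanInit.bound = c₁
    generalize b.cost = c₂
    generalize scanBody.bound = c₃
    generalize scanLast.bound = c₄
    nlinarith [Nat.zero_le ((c₁ + c₄) * (en - st)), Nat.zero_le c₃]

end RealRAM

/-! ### Regions with given corners -/

open Pointwise in
theorem convex_regionSet (l : List Corner) : Convex ℝ (regionSet l) := by
  have h : regionSet l = convexHull ℝ {v : Plane | Corner.vertex v ∈ l} +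
      (PointedCone.hull ℝ {u : Plane | Corner.direction u ∈ l} : Set Plane) := by
    ext p
    simp only [regionSet, Set.mem_ofPred_eq, Set.mem_add, SetLike.mem_coe, eq_comm (b := p)]
  rw [h]
  exact (convex_convexHull ℝ _).add (PointedCone.convex _)

/-- A linear inequality that holds at all corners holds on the region. -/
theorem le_of_mem_regionSet {l : List Corner} {a b c : ℝ}
    (h : ∀ C ∈ l, 0 ≤ a * C.homog 0 + b * C.homog 1 + c * C.homog 2) {p : Plane}
    (hp : p ∈ regionSet l) : 0 ≤ a * p.1 + b * p.2 + c := by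
  obtain ⟨q, hq, u, hu, rfl⟩ := hp
  have h1 : 0 ≤ a * q.1 + b * q.2 + c := by
    have hc : Convex ℝ {q : Plane | 0 ≤ a * q.1 + b * q.2 + c} := by
      intro x hx y hy s t hs ht hst
      simp only [Set.mem_ofPred_eq, Prod.fst_add, Prod.smul_fst, Prod.snd_add, Prod.smul_snd,
        smul_eq_mul] at *
      have : a * (s * x.1 + t * y.1) + b * (s * x.2 + t * y.2) + c =
          s * (a * x.1 + b * x.2 + c) + t * (a * y.1 + b * y.2 + c) := by
        linear_combination -c * hst
      rw [this]
      positivity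
    refine convexHull_min (fun v hv => ?_) hc hq
    simpa [Corner.homog] using h _ hv
  have h2 : 0 ≤ a * u.1 + b * u.2 := by
    refine Submodule.span_induction (p := fun u _ => 0 ≤ a * u.1 + b * u.2) (fun v hv => ?_)
      (by simp) (fun x y _ _ hx hy => ?_) (fun r x _ hx => ?_) hu
    · simpa [Corner.homog] using h _ hv
    · simp only [Prod.fst_add, Prod.snd_add]
      linarith
    · have e1 : (r • x).1 = (r : ℝ) * x.1 := rfl
      have e2 : (r • x).2 = (r : ℝ) * x.2 := rfl
      rw [e1, e2]
      have := mul_nonneg r.2 hx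
      linarith
  simp only [Prod.fst_add, Prod.snd_add]
  linarith

/-- A nonnegative combination of two corners belongs to the region if it is a finite point. -/
theorem mem_regionSet_of_homog {l : List Corner} {C D : Corner} (hC : C ∈ l) (hD : D ∈ l)
    {s t : ℝ} (hs : 0 ≤ s) (ht : 0 ≤ t) {p : Plane}
    (h0 : p.1 = s * C.homog 0 + t * D.homog 0) (h1 : p.2 = s * C.homog 1 + t * D.homog 1)
    (h2 : 1 = s * C.homog 2 + t * D.homog 2) : p ∈ regionSet l := by
  have hdir : ∀ {u : Plane}, Corner.direction u ∈ l → ∀ {r : ℝ}, 0 ≤ r →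
      r • u ∈ PointedCone.hull ℝ {u : Plane | Corner.direction u ∈ l} := fun hu r hr =>
    Submodule.smul_mem _ (⟨r, hr⟩ : NNReal) (PointedCone.subset_hull hu)
  cases C with
  | vertex v =>
    cases D with
    | vertex w =>
      simp [Corner.homog] at h0 h1 h2
      refine ⟨p, ?_, 0, zero_mem _, by simp⟩
      have : p = s • v + t • w := Prod.ext (by simpa using h0) (by simpa using h1)
      rw [this]
      exact convex_convexHull ℝ _ (subset_convexHull ℝ _ (by exact hC))
        (subset_convexHull ℝ _ (by exact hD)) hs ht
        h2.symm
    | direction w =>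
      simp [Corner.homog] at h0 h1 h2
      subst h2
      exact ⟨v, subset_convexHull ℝ _ (by exact hC), t • w, hdir hD ht,
        Prod.ext (by simpa using h0) (by simpa using h1)⟩
  | direction v =>
    cases D with
    | vertex w =>
      simp [Corner.homog] at h0 h1 h2
      subst h2
      exact ⟨w, subset_convexHull ℝ _ (by exact hD), s • v, hdir hC hs,
        Prod.ext (by simp [h0, add_comm]) (by simp [h1, add_comm])⟩
    | direction w => simp [Corner.homog] at h2

/-! ### A change of coordinates -/

/-- The map from the coordinates in which the lines of slope `s` are vertical to the original
coordinates: `(0, 1)` is mapped to a direction of slope `s`. Its determinant is `1`. -/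
def shear (s : ℝ) : Plane →ₗ[ℝ] Plane where
  toFun p := (-p.2, p.1 - s * p.2)
  map_add' p q := by ext <;> simp <;> ring
  map_smul' r p := by ext <;> simp; ring

/-- The image of a corner; the map is meant to be linear, so that it acts on directions, too. -/
def Corner.map (f : Plane → Plane) : Corner → Corner
  | .vertex p => .vertex (f p)
  | .direction u => .direction (f u)

theorem shear_injective (s : ℝ) : Function.Injective (shear s) := by
  intro p q h
  simp only [shear, LinearMap.coe_mk, AddHom.coe_mk, Prod.mk.injEq, neg_inj] at h
  refine Prod.ext ?_ h.1
  have := h.2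
  rw [h.1] at this
  linarith

theorem vertex_mem_map {f : Plane → Plane} {l : List Corner} {v : Plane} :
    Corner.vertex v ∈ l.map (Corner.map f) ↔ v ∈ f '' {v | Corner.vertex v ∈ l} := by
  simp only [List.mem_map, Set.mem_image, Set.mem_ofPred_eq]
  constructor
  · rintro ⟨C, hC, h⟩
    cases C with
    | vertex p => exact ⟨p, hC, by simpa [Corner.map] using h⟩
    | direction p => simp [Corner.map] at h
  · rintro ⟨p, hp, rfl⟩
    exact ⟨_, hp, rfl⟩

theorem direction_mem_map {f : Plane → Plane} {l : List Corner} {v : Plane} :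
    Corner.direction v ∈ l.map (Corner.map f) ↔ v ∈ f '' {v | Corner.direction v ∈ l} := by
  simp only [List.mem_map, Set.mem_image, Set.mem_ofPred_eq]
  constructor
  · rintro ⟨C, hC, h⟩
    cases C with
    | direction p => exact ⟨p, hC, by simpa [Corner.map] using h⟩
    | vertex p => simp [Corner.map] at h
  · rintro ⟨p, hp, rfl⟩
    exact ⟨_, hp, rfl⟩

theorem regionSet_map (f : Plane →ₗ[ℝ] Plane) (l : List Corner) :
    regionSet (l.map (Corner.map f)) = f '' regionSet l := by
  have e1 : {v : Plane | Corner.vertex v ∈ l.map (Corner.map f)} =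
      f '' {v | Corner.vertex v ∈ l} := Set.ext fun _ => vertex_mem_map
  have e2 : {v : Plane | Corner.direction v ∈ l.map (Corner.map f)} =
      f '' {v | Corner.direction v ∈ l} := Set.ext fun _ => direction_mem_map
  have e3 : ∀ u, u ∈ PointedCone.hull ℝ (f '' {v | Corner.direction v ∈ l}) ↔
      ∃ v ∈ PointedCone.hull ℝ {v | Corner.direction v ∈ l}, f v = u := by
    intro u
    have := Submodule.map_span (f.restrictScalars {c : ℝ // 0 ≤ c})
      {v | Corner.direction v ∈ l}
    change PointedCone.map f (PointedCone.hull ℝ _) = PointedCone.hull ℝ (f '' _) at this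
    rw [← this, PointedCone.mem_map]
  ext p
  simp only [regionSet, e1, e2, e3, ← LinearMap.image_convexHull, Set.mem_ofPred_eq, Set.mem_image]
  constructor
  · rintro ⟨_, ⟨q, hq, rfl⟩, _, ⟨u, hu, rfl⟩, rfl⟩
    exact ⟨q + u, ⟨q, hq, u, hu, rfl⟩, by simp⟩
  · rintro ⟨_, ⟨q, hq, u, hu, rfl⟩, rfl⟩
    exact ⟨f q, ⟨q, hq, rfl⟩, f u, ⟨u, hu, rfl⟩, by simp⟩

theorem homog_map_shear (s : ℝ) (C : Corner) : (C.map (shear s)).homog =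
    ![-C.homog 1, C.homog 0 - s * C.homog 1, C.homog 2] := by
  cases C <;> simp [Corner.map, Corner.homog, shear]

theorem IsConvexPolygon.map_shear {l : List Corner} (h : IsConvexPolygon l) (s : ℝ) :
    IsConvexPolygon (l.map (Corner.map (shear s))) := by
  obtain ⟨⟨v, hv⟩, h2, h3⟩ := h
  refine ⟨⟨shear s v, vertex_mem_map.2 ⟨v, hv, rfl⟩⟩, ?_, ?_⟩
  · rw [List.pairwise_map]
    refine h2.imp fun {C D} hCD => ?_
    rw [LinearIndependent.pair_iff] at hCD ⊢
    intro a b hab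
    refine hCD a b ?_
    rw [homog_map_shear, homog_map_shear] at hab
    have e0 := congrFun hab 0
    have e1 := congrFun hab 1
    have e2 := congrFun hab 2
    simp at e0 e1 e2
    funext i
    fin_cases i
    · simp; linear_combination e1 - s * e0
    · simp; linear_combination -e0
    · simpa using e2
  · rw [List.triplewise_map]
    refine h3.imp fun {A B C} hABC => ?_
    rw [homog_map_shear, homog_map_shear, homog_map_shear]
    rw [Matrix.det_fin_three] at hABC ⊢
    simp at hABC ⊢
    linarith

theorem Describes.map_shear {Ls : List (List Corner)} {A : Set Plane} (h : Describes Ls A)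
    (s : ℝ) : Describes (Ls.map (List.map (Corner.map (shear s)))) (shear s '' A) := by
  obtain ⟨h1, h2, h3⟩ := h
  refine ⟨?_, ?_, ?_⟩
  · intro l hl
    obtain ⟨l', hl', rfl⟩ := List.mem_map.1 hl
    exact (h1 l' hl').map_shear s
  · rw [List.pairwise_map]
    refine h2.imp fun {l l'} hll => ?_
    rw [regionSet_map, regionSet_map, ← Set.image_inter (shear_injective s)]
    exact hll.image _
  · rw [← h3, Set.image_iUnion₂]
    ext p
    simp [regionSet_map]

theorem triplewise_of_pairwise {α : Type*} {R : α → α → Prop} {T : α → α → α → Prop} {l : List α}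
    (hl : l.Pairwise R)
    (h : ∀ x ∈ l, ∀ y ∈ l, ∀ z ∈ l, R x y → R y z → R x z → T x y z) : l.Triplewise T := by
  induction l with
  | nil => exact .nil
  | cons a l ih =>
    rw [List.pairwise_cons] at hl
    rw [List.triplewise_cons]
    refine ⟨?_, ih hl.2 fun x hx y hy z hz =>
      h x (.tail _ hx) y (.tail _ hy) z (.tail _ hz)⟩
    refine hl.2.imp_of_mem fun {x y} hx hy hxy => ?_
    exact h a (.head _) x (.tail _ hx) y (.tail _ hy) (hl.1 x hx) hxy (hl.1 y hy)

/-! ### Left turns -/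

/-- The orientation of a triple of corners. -/
def turn (A B C : Corner) : ℝ := Matrix.det (Matrix.of ![A.homog, B.homog, C.homog])

theorem turn_eq (A B C : Corner) : turn A B C =
    A.homog 0 * (B.homog 1 * C.homog 2 - B.homog 2 * C.homog 1) -
    A.homog 1 * (B.homog 0 * C.homog 2 - B.homog 2 * C.homog 0) +
    A.homog 2 * (B.homog 0 * C.homog 1 - B.homog 1 * C.homog 0) := by
  rw [turn, Matrix.det_fin_three]
  simp
  ring

theorem turn_rotate (A B C : Corner) : turn A B C = turn B C A := by
  rw [turn_eq, turn_eq]; ring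

/-- The corner `A` lies to the left of `B`, in homogeneous coordinates. A direction of positive
`x`-coordinate lies to the right of all vertices. -/
def LeftOf (A B : Corner) : Prop := A.homog 0 * B.homog 2 < B.homog 0 * A.homog 2

/-- The turn at the crossing `M` of two lines of slopes `s₁ < s₂` from a corner `A` above the first
line to a corner `B` above the second line. -/
theorem turn_pos_of_above {A M B : Corner} {s₁ s₂ c₁ c₂ : ℝ} (hs : s₁ < s₂)
    (hM : M.homog 2 = 1) (h₁ : M.homog 1 = s₁ * M.homog 0 + c₁)
    (h₂ : M.homog 1 = s₂ * M.homog 0 + c₂) (hAM : LeftOf A M) (hMB : LeftOf M B)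
    (hA : s₁ * A.homog 0 + c₁ * A.homog 2 ≤ A.homog 1)
    (hB : s₂ * B.homog 0 + c₂ * B.homog 2 ≤ B.homog 1) : 0 < turn A M B := by
  rw [turn_eq]
  simp only [LeftOf, hM, mul_one] at *
  have e : A.homog 0 * (M.homog 1 * B.homog 2 - 1 * B.homog 1) -
      A.homog 1 * (M.homog 0 * B.homog 2 - 1 * B.homog 0) +
      A.homog 2 * (M.homog 0 * B.homog 1 - M.homog 1 * B.homog 0) =
      (A.homog 1 - (s₁ * A.homog 0 + c₁ * A.homog 2)) * (B.homog 0 - M.homog 0 * B.homog 2) +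
      (M.homog 0 * A.homog 2 - A.homog 0) * (B.homog 1 - (s₂ * B.homog 0 + c₂ * B.homog 2)) +
      (s₂ - s₁) * ((M.homog 0 * A.homog 2 - A.homog 0) *
        (B.homog 0 - M.homog 0 * B.homog 2)) := by
    have e1 : c₁ = M.homog 1 - s₁ * M.homog 0 := by linarith
    have e2 : c₂ = M.homog 1 - s₂ * M.homog 0 := by linarith
    rw [e1, e2]
    ring
  rw [e]
  have p1 : 0 < B.homog 0 - M.homog 0 * B.homog 2 := by linarith
  have p2 : 0 < M.homog 0 * A.homog 2 - A.homog 0 := by linarith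
  have p3 : 0 < s₂ - s₁ := by linarith
  have p4 := mul_nonneg (sub_nonneg.2 hA) p1.le
  have p5 := mul_nonneg p2.le (sub_nonneg.2 hB)
  have p6 := mul_pos p3 (mul_pos p2 p1)
  linarith

theorem turn_pos_of_below {A M B : Corner} {s₁ s₂ c₁ c₂ : ℝ} (hs : s₂ < s₁)
    (hM : M.homog 2 = 1) (h₁ : M.homog 1 = s₁ * M.homog 0 + c₁)
    (h₂ : M.homog 1 = s₂ * M.homog 0 + c₂) (hAM : LeftOf A M) (hMB : LeftOf M B)
    (hA : A.homog 1 ≤ s₁ * A.homog 0 + c₁ * A.homog 2)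
    (hB : B.homog 1 ≤ s₂ * B.homog 0 + c₂ * B.homog 2) : 0 < turn B M A := by
  rw [turn_eq]
  simp only [LeftOf, hM, mul_one] at *
  have e : B.homog 0 * (M.homog 1 * A.homog 2 - 1 * A.homog 1) -
      B.homog 1 * (M.homog 0 * A.homog 2 - 1 * A.homog 0) +
      B.homog 2 * (M.homog 0 * A.homog 1 - M.homog 1 * A.homog 0) =
      (s₁ * A.homog 0 + c₁ * A.homog 2 - A.homog 1) * (B.homog 0 - M.homog 0 * B.homog 2) +
      (M.homog 0 * A.homog 2 - A.homog 0) * (s₂ * B.homog 0 + c₂ * B.homog 2 - B.homog 1) +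
      (s₁ - s₂) * ((M.homog 0 * A.homog 2 - A.homog 0) *
        (B.homog 0 - M.homog 0 * B.homog 2)) := by
    have e1 : c₁ = M.homog 1 - s₁ * M.homog 0 := by linarith
    have e2 : c₂ = M.homog 1 - s₂ * M.homog 0 := by linarith
    rw [e1, e2]
    ring
  rw [e]
  have p1 : 0 < B.homog 0 - M.homog 0 * B.homog 2 := by linarith
  have p2 : 0 < M.homog 0 * A.homog 2 - A.homog 0 := by linarith
  have p3 : 0 < s₁ - s₂ := by linarith
  have p4 := mul_nonneg (sub_nonneg.2 hA) p1.le
  have p5 := mul_nonneg p2.le (sub_nonneg.2 hB)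
  have p6 := mul_pos p3 (mul_pos p2 p1)
  linarith

/-- Three corners, two of which lie on a vertical line. -/
theorem turn_pos_of_vertical {A B Z : Corner} (h0 : A.homog 0 = B.homog 0)
    (h2 : A.homog 2 = B.homog 2) (h1 : A.homog 1 < B.homog 1) :
    (LeftOf Z A → 0 < turn A B Z) ∧ (LeftOf A Z → 0 < turn B A Z) := by
  simp only [turn_eq, LeftOf, h0, h2]
  constructor
  · intro h
    nlinarith [mul_pos (sub_pos.2 h1) (sub_pos.2 h)]
  · intro h
    nlinarith [mul_pos (sub_pos.2 h1) (sub_pos.2 h)]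

theorem linearIndependent_of_leftOf {A B : Corner} (h : LeftOf A B ∨ LeftOf B A) :
    LinearIndependent ℝ ![A.homog, B.homog] := by
  have h : A.homog 0 * B.homog 2 - B.homog 0 * A.homog 2 ≠ 0 := by
    rcases h with h | h <;> simp only [LeftOf] at h
    · exact (by linarith : _ < (0 : ℝ)).ne
    · exact (by linarith : (0 : ℝ) < _).ne'
  rw [LinearIndependent.pair_iff]
  intro s t hst
  have e0 := congrFun hst 0
  have e2 := congrFun hst 2
  simp at e0 e2
  constructor
  · refine (mul_eq_zero.1 (?_ : s * _ = 0)).resolve_right h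
    linear_combination B.homog 2 * e0 - B.homog 0 * e2
  · refine (mul_eq_zero.1 (?_ : t * _ = 0)).resolve_right h
    linear_combination A.homog 0 * e2 - A.homog 2 * e0

theorem linearIndependent_of_vertical {A B : Corner} (h0 : A.homog 0 = B.homog 0)
    (h2 : A.homog 2 = B.homog 2) (h : A.homog 0 ≠ 0 ∨ A.homog 2 ≠ 0)
    (h1 : A.homog 1 ≠ B.homog 1) : LinearIndependent ℝ ![A.homog, B.homog] := by
  rw [LinearIndependent.pair_iff]
  intro s t hst
  have e0 := congrFun hst 0
  have e1 := congrFun hst 1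
  have e2 := congrFun hst 2
  simp only [Pi.add_apply, Pi.smul_apply, smul_eq_mul, Pi.zero_apply, ← h0, ← h2] at e0 e1 e2
  have hst : s + t = 0 := by
    rcases h with h | h
    · exact (mul_eq_zero.1 (by linear_combination e0 : (s + t) * _ = 0)).resolve_right h
    · exact (mul_eq_zero.1 (by linear_combination e2 : (s + t) * _ = 0)).resolve_right h
  have hs : s = 0 := by
    refine (mul_eq_zero.1 (?_ : s * (A.homog 1 - B.homog 1) = 0)).resolve_right (sub_ne_zero.2 h1)
    linear_combination e1 - B.homog 1 * hst
  exact ⟨hs, by linarith⟩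

/-! ### The regions between two piecewise linear functions -/

/-- Corner `j` of the graph of a piecewise linear function with `K` pieces: the left end of piece
`j`, or the right end of piece `j - 1`. The corners `0` and `K` are the directions of the unbounded
pieces. -/
def chain (K : ℕ) (m c e : ℕ → ℝ) (j : ℕ) : Corner :=
  if j = 0 then .direction (-1, -m 0)
  else if j < K then .vertex (e j, m j * e j + c j)
  else .direction (1, m (K - 1))

theorem chain_homog (K : ℕ) (m c e : ℕ → ℝ) (j : ℕ) :
    (j = 0 → (chain K m c e j).homog = ![-1, -m 0, 0]) ∧
    (0 < j → j < K → (chain K m c e j).homog = ![e j, m j * e j + c j, 1]) ∧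
    (0 < j → K ≤ j → (chain K m c e j).homog = ![1, m (K - 1), 0]) := by
  refine ⟨fun h => ?_, fun h h' => ?_, fun h h' => ?_⟩
  · simp [chain, h, Corner.homog]
  · simp [chain, h.ne', h', Corner.homog]
  · simp [chain, h.ne', h'.not_gt, Corner.homog]

theorem chain_neg (K : ℕ) (m c e : ℕ → ℝ) (j : ℕ) :
    (chain K (fun k => -m k) (fun k => -c k) e j).homog 0 = (chain K m c e j).homog 0 ∧
    (chain K (fun k => -m k) (fun k => -c k) e j).homog 1 = -(chain K m c e j).homog 1 ∧
    (chain K (fun k => -m k) (fun k => -c k) e j).homog 2 = (chain K m c e j).homog 2 := by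
  unfold chain
  split_ifs <;> simp [Corner.homog]
  ring

theorem chain_same (K : ℕ) (m c m' c' e : ℕ → ℝ) (j : ℕ) :
    (chain K m c e j).homog 0 = (chain K m' c' e j).homog 0 ∧
    (chain K m c e j).homog 2 = (chain K m' c' e j).homog 2 := by
  unfold chain
  split_ifs <;> simp [Corner.homog]

theorem IsPL.neg {s e : ℕ} {m c x : ℕ → ℝ} {F : ℝ → ℝ} (h : IsPL s e m c x F) :
    IsPL s e (fun k => -m k) (fun k => -c k) x (fun t => -F t) :=
  ⟨h.lt, h.mono, fun k h1 h2 t h3 h4 h5 => by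
    simp only [h.eval k h1 h2 t h3 h4 h5]; ring⟩

section chain

variable {K : ℕ} {m c e m' c' : ℕ → ℝ} {F : ℝ → ℝ}

theorem IsPL.leftOf (h : IsPL 0 K m c e F) {i j : ℕ} (hij : i < j) (hj : j ≤ K)
    (hne : ¬ (i = 0 ∧ j = K)) (m₁ c₁ m₂ c₂ : ℕ → ℝ) :
    LeftOf (chain K m₁ c₁ e i) (chain K m₂ c₂ e j) := by
  have hi := chain_homog K m₁ c₁ e i
  have hj' := chain_homog K m₂ c₂ e j
  unfold LeftOf
  rcases Nat.eq_zero_or_pos i with h0 | h0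
  · rw [hi.1 h0, hj'.2.1 (by omega) (by omega)]
    simp
  · rw [hi.2.1 h0 (by omega)]
    rcases hj.eq_or_lt with hK | hK
    · rw [hj'.2.2 (by omega) hK.ge]
      simp
    · rw [hj'.2.1 (by omega) hK]
      simpa using h.mono_lt h0 hij hK

/-- Slopes increase along the pieces `a, …, b`. -/
def ConvexOnPieces (m : ℕ → ℝ) (a b : ℕ) : Prop := ∀ k, a < k → k ≤ b → m (k - 1) ≤ m k

theorem ConvexOnPieces.le {a b : ℕ} (hm : ConvexOnPieces m a b) {i j : ℕ} (hi : a ≤ i)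
    (hij : i ≤ j) (hj : j ≤ b) : m i ≤ m j := by
  induction j, hij using Nat.le_induction with
  | base => exact le_rfl
  | succ j hij ih => exact (ih (by omega)).trans (hm (j + 1) (by omega) hj)

theorem IsPL.line_le (h : IsPL 0 K m c e F) {a b : ℕ} (hb : b < K) (hm : ConvexOnPieces m a b)
    {j k : ℕ} (hj : a ≤ j) (hj' : j ≤ b) (hk : a ≤ k) (hk' : k ≤ b) {t : ℝ}
    (ht : 0 < k → e k ≤ t) (ht' : k + 1 < K → t ≤ e (k + 1)) :
    m j * t + c j ≤ m k * t + c k := by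
  rcases le_total j k with hjk | hjk
  · clear ht'
    induction k, hjk using Nat.le_induction with
    | base => exact le_rfl
    | succ k hjk ih =>
      have hek := ht (by omega)
      have h1 := ih (by omega) (by omega) fun h0 => (h.mono k h0 (by omega)).le.trans hek
      have h2 := h.meet (Nat.zero_le k) (by omega : k + 1 < K)
      have h3 := hm (k + 1) (by omega) (by omega)
      rw [Nat.add_sub_cancel] at h3
      nlinarith [mul_nonneg (sub_nonneg.2 h3) (sub_nonneg.2 hek)]
  · clear ht
    induction j, hjk using Nat.le_induction with
    | base => exact le_rfl
    | succ j hjk ih =>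
      have h1 := ih (by omega) (by omega)
      have h2 := h.meet (Nat.zero_le j) (by omega : j + 1 < K)
      have h3 := hm (j + 1) (by omega) (by omega)
      rw [Nat.add_sub_cancel] at h3
      have h4 : t ≤ e (j + 1) := by
        refine (ht' (by omega)).trans ?_
        rcases hjk.eq_or_lt with rfl | h5
        · exact le_rfl
        · exact (h.mono_lt (by omega) (by omega : k + 1 < j + 1) (by omega)).le
      nlinarith [mul_nonneg (sub_nonneg.2 h3) (sub_nonneg.2 h4)]

theorem IsPL.le_chain (h : IsPL 0 K m c e F) {a b : ℕ} (hb : b < K) (hm : ConvexOnPieces m a b)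
    {i k : ℕ} (hi : a ≤ i) (hi' : i ≤ b + 1) (hk : a ≤ k) (hk' : k ≤ b) :
    m k * (chain K m c e i).homog 0 + c k * (chain K m c e i).homog 2 ≤
      (chain K m c e i).homog 1 := by
  have hc := chain_homog K m c e i
  rcases Nat.eq_zero_or_pos i with h0 | h0
  · rw [hc.1 h0]
    have := hm.le (by omega : a ≤ 0) (Nat.zero_le k) hk'
    simpa using this
  rcases lt_or_ge i K with hK | hK
  · rw [hc.2.1 h0 hK]
    rcases hi'.eq_or_lt with rfl | hlt
    · have := h.line_le hb hm hk hk' (by omega : a ≤ b) le_rfl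
        (fun h0 => (h.mono b h0 hK).le) fun _ => le_rfl
      rw [h.meet (Nat.zero_le b) hK] at this
      simpa using this
    · have := h.line_le hb hm hk hk' hi (by omega) (fun _ => le_rfl)
        fun h' => (h.mono i h0 h').le
      simpa using this
  · rw [hc.2.2 h0 hK]
    have := hm.le hk (by omega : k ≤ K - 1) (by omega)
    simpa using this

theorem IsPL.chain_le (h : IsPL 0 K m c e F) {a b : ℕ} (hb : b < K)
    (hm : ConvexOnPieces (fun k => -m k) a b)
    {i k : ℕ} (hi : a ≤ i) (hi' : i ≤ b + 1) (hk : a ≤ k) (hk' : k ≤ b) :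
    (chain K m c e i).homog 1 ≤
      m k * (chain K m c e i).homog 0 + c k * (chain K m c e i).homog 2 := by
  have := h.neg.le_chain hb hm hi hi' hk hk'
  rw [(chain_neg K m c e i).1, (chain_neg K m c e i).2.1, (chain_neg K m c e i).2.2] at this
  linarith

theorem IsPL.chain_eq (h : IsPL 0 K m c e F) {i : ℕ} (h0 : 0 < i) (hK : i < K) :
    (chain K m c e i).homog 1 = m i * (chain K m c e i).homog 0 + c i ∧
    (chain K m c e i).homog 1 = m (i - 1) * (chain K m c e i).homog 0 + c (i - 1) ∧
    (chain K m c e i).homog 2 = 1 ∧ (chain K m c e i).homog 0 = e i ∧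
    (chain K m c e i).homog 1 = F (e i) := by
  rw [(chain_homog K m c e i).2.1 h0 hK]
  have hm := h.meet (Nat.zero_le (i - 1)) (by omega)
  rw [Nat.sub_add_cancel h0] at hm
  have := h.eval i (Nat.zero_le _) hK (e i) (fun _ => le_rfl) (fun h' => (h.mono i h0 h').le)
    fun _ => trivial
  simp [this, hm]

/-- A ray of the plane below another one. -/
theorem slope_le_of_le_left {a b a' b' T : ℝ} (h : ∀ t ≤ T, a * t + b ≤ a' * t + b') :
    a' ≤ a := by
  by_contra hlt
  have hd : 0 < a' - a := by linarith
  have h1 := h (min T ((b - b' - 1) / (a' - a))) (min_le_left _ _)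
  have h2 := mul_le_mul_of_nonneg_left (min_le_right T ((b - b' - 1) / (a' - a))) hd.le
  rw [mul_div_cancel₀ _ hd.ne'] at h2
  linarith

theorem slope_le_of_le_right {a b a' b' T : ℝ} (h : ∀ t, T ≤ t → a * t + b ≤ a' * t + b') :
    a ≤ a' := by
  have := slope_le_of_le_left (a := -a) (b := b) (a' := -a') (b' := b') (T := -T)
    fun t ht => by linarith [h (-t) (by linarith)]
  linarith

end chain

/-- The indices among `i, …, i + n - 1` at which the slope changes. -/
noncomputable def kinks (m : ℕ → ℝ) (i n : ℕ) : List ℕ :=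
  (List.range' i n).filter fun k => m (k - 1) ≠ m k

theorem mem_kinks {m : ℕ → ℝ} {i n k : ℕ} :
    k ∈ kinks m i n ↔ (i ≤ k ∧ k < i + n) ∧ m (k - 1) ≠ m k := by
  simp [kinks]

theorem pairwise_kinks (m : ℕ → ℝ) (i n : ℕ) : (kinks m i n).Pairwise (· < ·) :=
  List.Pairwise.filter _ (List.pairwise_lt_range' ..)

/-- Two piecewise linear functions `U` and `L` on a common subdivision into `K` cells. Wherever `U`
is below `L`, it is convex at the breakpoints, and `L` is concave there. The arrays `e`, `um`, `uc`,
`lm`, `lc` hold the left ends of the cells, and slopes and intercepts of `U` and of `L`. -/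
structure Strip where
  K : ℕ
  e : ℕ → ℝ
  um : ℕ → ℝ
  uc : ℕ → ℝ
  lm : ℕ → ℝ
  lc : ℕ → ℝ
  U : ℝ → ℝ
  L : ℝ → ℝ
  plU : IsPL 0 K um uc e U
  plL : IsPL 0 K lm lc e L
  kink : ∀ k, 0 < k → k < K → U (e k) < L (e k) → um (k - 1) ≤ um k ∧ lm k ≤ lm (k - 1)

namespace Strip

variable (S : Strip)

/-- The points between the two graphs. -/
def set : Set Plane := {p | S.U p.1 ≤ p.2 ∧ p.2 ≤ S.L p.1}

/-- The corners of the graph of `U`, which bounds the strip from below. -/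
def lower (j : ℕ) : Corner := chain S.K S.um S.uc S.e j
/-- The corners of the graph of `L`. -/
def upper (j : ℕ) : Corner := chain S.K S.lm S.lc S.e j

/-- The indices of the lower corners of the region over the cells `a, …, b`, from left to right. -/
noncomputable def lowerIdx (a b : ℕ) : List ℕ := a :: (kinks S.um (a + 1) (b - a) ++ [b + 1])

/-- The indices of the upper corners of the region over the cells `a, …, b`, from left to right.
The extreme corners are left out if they agree with lower corners: at a finite end, the two graphs
meet, and at infinity, they have the same direction if their slopes agree. -/
noncomputable def upperIdx (a b : ℕ) : List ℕ :=
  (if a = 0 ∧ S.um 0 ≠ S.lm 0 then [0] else []) ++ (kinks S.lm (a + 1) (b - a) ++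
    (if b + 1 = S.K ∧ S.um b ≠ S.lm b then [b + 1] else []))

/-- The corners of the region over the cells `a, …, b`, in counterclockwise order. -/
noncomputable def poly (a b : ℕ) : List Corner :=
  (S.lowerIdx a b).map S.lower ++ (S.upperIdx a b).reverse.map S.upper

/-- The cells `a, …, b` form a maximal run over which the interior of the region between the two
graphs is connected. It does not extend over the whole line. -/
structure Run (a b : ℕ) : Prop where
  le : a ≤ b
  lt : b < S.K
  proper : ¬ (a = 0 ∧ b + 1 = S.K)
  below : ∀ t, (0 < a → S.e a ≤ t) → (b + 1 < S.K → t ≤ S.e (b + 1)) → S.U t ≤ S.L t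
  pos : ∀ k, a < k → k ≤ b → S.U (S.e k) < S.L (S.e k)
  left : 0 < a → S.U (S.e a) = S.L (S.e a)
  right : b + 1 < S.K → S.U (S.e (b + 1)) = S.L (S.e (b + 1))

theorem mem_lowerIdx {a b k : ℕ} (hab : a ≤ b) : k ∈ S.lowerIdx a b ↔
    k = a ∨ (a < k ∧ k ≤ b ∧ S.um (k - 1) ≠ S.um k) ∨ k = b + 1 := by
  simp only [lowerIdx, List.mem_cons, List.mem_append, mem_kinks, List.not_mem_nil, or_false]
  constructor
  · rintro (h | ⟨h, h'⟩ | h)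
    · exact .inl h
    · exact .inr (.inl ⟨by omega, by omega, h'⟩)
    · exact .inr (.inr h)
  · rintro (h | ⟨h, h', h''⟩ | h)
    · exact .inl h
    · exact .inr (.inl ⟨⟨by omega, by omega⟩, h''⟩)
    · exact .inr (.inr h)

theorem mem_upperIdx {a b k : ℕ} (hab : a ≤ b) : k ∈ S.upperIdx a b ↔
    (k = 0 ∧ a = 0 ∧ S.um 0 ≠ S.lm 0) ∨ (a < k ∧ k ≤ b ∧ S.lm (k - 1) ≠ S.lm k) ∨
      (k = b + 1 ∧ b + 1 = S.K ∧ S.um b ≠ S.lm b) := by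
  simp only [upperIdx, List.mem_append, mem_kinks]
  constructor
  · rintro (h | ⟨h, h'⟩ | h)
    · split_ifs at h with h1
      · exact .inl ⟨by simpa using h, h1⟩
      · simp at h
    · exact .inr (.inl ⟨by omega, by omega, h'⟩)
    · split_ifs at h with h1
      · exact .inr (.inr ⟨by simpa using h, h1⟩)
      · simp at h
  · rintro (⟨h, h'⟩ | ⟨h, h', h''⟩ | ⟨h, h'⟩)
    · exact .inl (by simp [h, h'])
    · exact .inr (.inl ⟨⟨by omega, by omega⟩, h''⟩)
    · exact .inr (.inr (by rw [if_pos h']; simp [h]))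

variable {S} {a b : ℕ}

theorem pairwise_lowerIdx (hab : a ≤ b) : (S.lowerIdx a b).Pairwise (· < ·) := by
  rw [lowerIdx, List.pairwise_cons, List.pairwise_append]
  refine ⟨fun k hk => ?_, pairwise_kinks _ _ _, by simp, fun k hk l hl => ?_⟩
  · rcases List.mem_append.1 hk with h | h
    · have := (mem_kinks.1 h).1; omega
    · have : k = b + 1 := by simpa using h
      omega
  · have := (mem_kinks.1 hk).1
    have : l = b + 1 := by simpa using hl
    omega

theorem pairwise_upperIdx (hab : a ≤ b) : (S.upperIdx a b).Pairwise (· < ·) := by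
  rw [upperIdx, List.pairwise_append, List.pairwise_append]
  refine ⟨by split_ifs <;> simp, ⟨pairwise_kinks _ _ _, by split_ifs <;> simp,
    fun k hk l hl => ?_⟩, fun k hk l hl => ?_⟩
  · have := (mem_kinks.1 hk).1
    split_ifs at hl
    · have : l = b + 1 := by simpa using hl
      omega
    · simp at hl
  · split_ifs at hk
    · have : k = 0 := by simpa using hk
      rcases List.mem_append.1 hl with h | h
      · have := (mem_kinks.1 h).1; omega
      · split_ifs at h
        · have : l = b + 1 := by simpa using h
          omega
        · simp at h
    · simp at hk

theorem Run.convex (h : S.Run a b) : ConvexOnPieces S.um a b := fun k h1 h2 =>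
  (S.kink k (by omega) (by have := h.lt; omega) (h.pos k h1 h2)).1

theorem Run.concave (h : S.Run a b) : ConvexOnPieces (fun k => -S.lm k) a b := fun k h1 h2 =>
  neg_le_neg (S.kink k (by omega) (by have := h.lt; omega) (h.pos k h1 h2)).2

theorem lower_eq_upper (j : ℕ) : (S.lower j).homog 0 = (S.upper j).homog 0 ∧
    (S.lower j).homog 2 = (S.upper j).homog 2 := chain_same ..

theorem Run.lower_le_upper (h : S.Run a b) {j : ℕ} (hj : a ≤ j) (hj' : j ≤ b + 1) :
    (S.lower j).homog 1 ≤ (S.upper j).homog 1 := by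
  have hb := h.lt
  have hp := h.proper
  have hab := h.le
  have hl := chain_homog S.K S.um S.uc S.e j
  have hu := chain_homog S.K S.lm S.lc S.e j
  unfold lower upper
  rcases Nat.eq_zero_or_pos j with h0 | h0
  · obtain rfl : a = 0 := by omega
    rw [hl.1 h0, hu.1 h0]
    have hK : 0 + 1 < S.K := by omega
    have : S.lm 0 ≤ S.um 0 := by
      refine slope_le_of_le_left (T := S.e (0 + 1)) (b := S.uc 0) (b' := S.lc 0) fun t ht => ?_
      rw [← S.plU.eval 0 le_rfl (by omega) t (by simp) (fun _ => ht) fun _ => trivial,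
        ← S.plL.eval 0 le_rfl (by omega) t (by simp) (fun _ => ht) fun _ => trivial]
      refine h.below t (by simp) fun hb' => ?_
      rcases Nat.eq_zero_or_pos b with rfl | hb0
      · exact ht
      · exact ht.trans (S.plU.mono_lt (by omega) (by omega) hb').le
    simpa using this
  rcases lt_or_ge j S.K with hK | hK
  · rw [(S.plU.chain_eq h0 hK).2.2.2.2, (S.plL.chain_eq h0 hK).2.2.2.2]
    rcases hj.eq_or_lt with rfl | h1
    · exact (h.left h0).le
    rcases hj'.eq_or_lt with rfl | h2
    · exact (h.right hK).le
    · exact (h.pos j h1 (by omega)).le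
  · rw [hl.2.2 h0 hK, hu.2.2 h0 hK]
    have ha : 0 < a := by omega
    have hbK : S.K - 1 = b := by omega
    have : S.um b ≤ S.lm b := by
      refine slope_le_of_le_right (T := S.e b) (b := S.uc b) (b' := S.lc b) fun t ht => ?_
      rw [← S.plU.eval b (by omega) (by omega) t (fun _ => ht) (by omega) fun _ => trivial,
        ← S.plL.eval b (by omega) (by omega) t (fun _ => ht) (by omega) fun _ => trivial]
      refine h.below t (fun _ => ?_) (by omega)
      rcases hab.eq_or_lt with rfl | hlt
      · exact ht
      · exact (S.plU.mono_lt ha hlt (by omega)).le.trans ht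
    simpa [hbK] using this

/-- Strict separation of the two corners with the same index, where the upper one is listed. -/
theorem Run.lower_lt_upper (h : S.Run a b) {j : ℕ} (hj : j ∈ S.upperIdx a b) :
    (S.lower j).homog 1 < (S.upper j).homog 1 := by
  have hb := h.lt
  have hab := h.le
  have hm := (S.mem_upperIdx hab).1 hj
  refine (h.lower_le_upper (by omega) (by omega)).lt_of_ne ?_
  have hl := chain_homog S.K S.um S.uc S.e j
  have hu := chain_homog S.K S.lm S.lc S.e j
  unfold lower upper
  rcases hm with ⟨h0, -, h1⟩ | ⟨h1, h2, -⟩ | ⟨h0, hK, h1⟩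
  · rw [hl.1 h0, hu.1 h0]
    simpa using h1
  · rw [(S.plU.chain_eq (by omega) (by omega)).2.2.2.2,
      (S.plL.chain_eq (by omega) (by omega)).2.2.2.2]
    exact (h.pos j h1 h2).ne
  · rw [hl.2.2 (by omega) (by omega), hu.2.2 (by omega) (by omega)]
    simpa [← hK] using h1

/-- A corner of the strip: the side (`true` for the upper one) and the index. -/
def corner (S : Strip) (x : Bool × ℕ) : Corner := if x.1 then S.upper x.2 else S.lower x.2

theorem Run.above (h : S.Run a b) {x : Bool × ℕ} {k : ℕ} (hx : a ≤ x.2) (hx' : x.2 ≤ b + 1)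
    (hk : a ≤ k) (hk' : k ≤ b) :
    S.um k * (S.corner x).homog 0 + S.uc k * (S.corner x).homog 2 ≤ (S.corner x).homog 1 := by
  have h1 := S.plU.le_chain h.lt h.convex hx hx' hk hk'
  obtain ⟨s, j⟩ := x
  cases s
  · exact h1
  · have h2 := h.lower_le_upper hx hx'
    have h3 := S.lower_eq_upper j
    simp only [corner, if_true, ← h3.1, ← h3.2]
    exact h1.trans h2

theorem Run.below_line (h : S.Run a b) {x : Bool × ℕ} {k : ℕ} (hx : a ≤ x.2)
    (hx' : x.2 ≤ b + 1) (hk : a ≤ k) (hk' : k ≤ b) :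
    (S.corner x).homog 1 ≤ S.lm k * (S.corner x).homog 0 + S.lc k * (S.corner x).homog 2 := by
  have h1 := S.plL.chain_le h.lt h.concave hx hx' hk hk'
  obtain ⟨s, j⟩ := x
  cases s
  · have h2 := h.lower_le_upper hx hx'
    have h3 := S.lower_eq_upper j
    change (S.lower j).homog 1 ≤ S.lm k * (S.lower j).homog 0 + S.lc k * (S.lower j).homog 2
    rw [h3.1, h3.2]
    exact h2.trans h1
  · exact h1

theorem Run.leftOf (h : S.Run a b) {x y : Bool × ℕ} (hx : a ≤ x.2) (hxy : x.2 < y.2)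
    (hy : y.2 ≤ b + 1) : LeftOf (S.corner x) (S.corner y) := by
  have hp := h.proper
  have hlt := h.lt
  obtain ⟨s, i⟩ := x
  obtain ⟨s', j⟩ := y
  dsimp only at hx hxy hy
  have := S.plU.leftOf hxy (by omega) (by omega)
  cases s <;> cases s' <;> exact this ..

/-- The listed corners, labelled by side and index. -/
noncomputable def labels (S : Strip) (a b : ℕ) : List (Bool × ℕ) :=
  (S.lowerIdx a b).map (Prod.mk false) ++ (S.upperIdx a b).reverse.map (Prod.mk true)

theorem poly_eq : S.poly a b = (S.labels a b).map S.corner := by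
  simp only [poly, labels, List.map_append, List.map_map]
  rfl

/-- The counterclockwise order. -/
def Before (x y : Bool × ℕ) : Prop :=
  (x.1 = false ∧ y.1 = true) ∨ (x.1 = false ∧ y.1 = false ∧ x.2 < y.2) ∨
    (x.1 = true ∧ y.1 = true ∧ y.2 < x.2)

theorem pairwise_labels (hab : a ≤ b) : (S.labels a b).Pairwise Before := by
  rw [labels, List.pairwise_append, List.pairwise_map, List.pairwise_map, List.pairwise_reverse]
  refine ⟨(pairwise_lowerIdx hab).imp fun h => .inr (.inl ⟨rfl, rfl, h⟩),
    (pairwise_upperIdx hab).imp fun h => .inr (.inr ⟨rfl, rfl, h⟩), fun x hx y hy => ?_⟩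
  obtain ⟨i, -, rfl⟩ := List.mem_map.1 hx
  obtain ⟨j, -, rfl⟩ := List.mem_map.1 hy
  exact .inl ⟨rfl, rfl⟩

theorem mem_labels {x : Bool × ℕ} : x ∈ S.labels a b ↔
    (x.1 = false ∧ x.2 ∈ S.lowerIdx a b) ∨ (x.1 = true ∧ x.2 ∈ S.upperIdx a b) := by
  obtain ⟨s, j⟩ := x
  cases s <;> simp [labels]

theorem bounds_of_mem_labels (hab : a ≤ b) {x : Bool × ℕ} (hx : x ∈ S.labels a b) :
    a ≤ x.2 ∧ x.2 ≤ b + 1 := by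
  rcases mem_labels.1 hx with ⟨-, h⟩ | ⟨-, h⟩
  · have := (S.mem_lowerIdx hab).1 h
    omega
  · have := (S.mem_upperIdx hab).1 h
    omega

theorem Run.turn_lower (h : S.Run a b) {x y : Bool × ℕ} {j : ℕ} (hx : x ∈ S.labels a b)
    (hj : (false, j) ∈ S.labels a b) (hy : y ∈ S.labels a b) (hxj : x.2 < j) (hjy : j < y.2) :
    0 < turn (S.corner x) (S.corner (false, j)) (S.corner y) := by
  have hlt := h.lt
  have bx := bounds_of_mem_labels h.le hx
  have by' := bounds_of_mem_labels h.le hy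
  have hj : j ∈ S.lowerIdx a b := by simpa [mem_labels] using hj
  obtain ⟨h1, h2, h3⟩ : a < j ∧ j ≤ b ∧ S.um (j - 1) ≠ S.um j :=
    (((S.mem_lowerIdx h.le).1 hj).resolve_left (by omega)).resolve_right (by omega)
  obtain ⟨e1, e2, e3, -, -⟩ := S.plU.chain_eq (by omega : 0 < j) (by omega)
  exact turn_pos_of_above (c₁ := S.uc (j - 1)) (c₂ := S.uc j) ((h.convex j h1 h2).lt_of_ne h3)
    e3 e2 e1 (h.leftOf bx.1 hxj (by omega : j ≤ b + 1)) (h.leftOf h1.le hjy by'.2)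
    (h.above bx.1 bx.2 (by omega) (by omega)) (h.above by'.1 by'.2 h1.le h2)

theorem Run.turn_upper (h : S.Run a b) {x y : Bool × ℕ} {j : ℕ} (hx : x ∈ S.labels a b)
    (hj : (true, j) ∈ S.labels a b) (hy : y ∈ S.labels a b) (hxj : x.2 < j) (hjy : j < y.2) :
    0 < turn (S.corner y) (S.corner (true, j)) (S.corner x) := by
  have hlt := h.lt
  have bx := bounds_of_mem_labels h.le hx
  have by' := bounds_of_mem_labels h.le hy
  have hj : j ∈ S.upperIdx a b := by simpa [mem_labels] using hj
  obtain ⟨h1, h2, h3⟩ : a < j ∧ j ≤ b ∧ S.lm (j - 1) ≠ S.lm j :=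
    (((S.mem_upperIdx h.le).1 hj).resolve_left (by omega)).resolve_right (by omega)
  obtain ⟨e1, e2, e3, -, -⟩ := S.plL.chain_eq (by omega : 0 < j) (by omega)
  exact turn_pos_of_below (c₁ := S.lc (j - 1)) (c₂ := S.lc j)
    ((neg_le_neg_iff.1 (h.concave j h1 h2)).lt_of_ne h3.symm)
    e3 e2 e1 (h.leftOf bx.1 hxj (by omega : j ≤ b + 1)) (h.leftOf h1.le hjy by'.2)
    (h.below_line bx.1 bx.2 (by omega) (by omega)) (h.below_line by'.1 by'.2 h1.le h2)

theorem Run.turn_vertical (h : S.Run a b) {z : Bool × ℕ} {j : ℕ} (hz : z ∈ S.labels a b)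
    (hj : (true, j) ∈ S.labels a b) :
    (z.2 < j → 0 < turn (S.corner (false, j)) (S.corner (true, j)) (S.corner z)) ∧
    (j < z.2 → 0 < turn (S.corner (true, j)) (S.corner (false, j)) (S.corner z)) := by
  have bz := bounds_of_mem_labels h.le hz
  have bj := bounds_of_mem_labels h.le hj
  have hj : j ∈ S.upperIdx a b := by simpa [mem_labels] using hj
  obtain ⟨h1, h2⟩ := turn_pos_of_vertical (Z := S.corner z) (S.lower_eq_upper j).1
    (S.lower_eq_upper j).2 (h.lower_lt_upper hj)
  exact ⟨fun h' => h1 (h.leftOf (y := (false, j)) bz.1 h' bj.2),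
    fun h' => h2 (h.leftOf (x := (false, j))
    bj.1 h' bz.2)⟩

theorem Run.turn_pos (h : S.Run a b) {x y z : Bool × ℕ} (hx : x ∈ S.labels a b)
    (hy : y ∈ S.labels a b) (hz : z ∈ S.labels a b) (hxy : Before x y) (hyz : Before y z)
    (hxz : Before x z) : 0 < turn (S.corner x) (S.corner y) (S.corner z) := by
  obtain ⟨s, i⟩ := x
  obtain ⟨s', j⟩ := y
  obtain ⟨s'', k⟩ := z
  cases s <;> cases s' <;> cases s'' <;> simp [Before] at hxy hyz hxz
  · exact h.turn_lower hx hy hz hxy hyz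
  · rcases lt_trichotomy k i with h1 | rfl | h1
    · rw [← turn_rotate]
      exact h.turn_lower hz hx hy h1 hxy
    · rw [← turn_rotate]
      exact (h.turn_vertical hy hz).2 hxy
    rcases lt_trichotomy k j with h2 | rfl | h2
    · rw [turn_rotate]
      exact h.turn_upper hx hz hy h1 h2
    · rw [turn_rotate]
      exact (h.turn_vertical hx hz).1 hxy
    · exact h.turn_lower hx hy hz hxy h2
  · rcases lt_trichotomy i k with h1 | rfl | h1
    · rw [turn_rotate]
      exact h.turn_upper hx hz hy h1 hyz
    · rw [← turn_rotate]
      exact (h.turn_vertical hy hz).2 hyz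
    rcases lt_trichotomy i j with h2 | rfl | h2
    · rw [← turn_rotate]
      exact h.turn_lower hz hx hy h1 h2
    · exact (h.turn_vertical hz hy).1 hyz
    · exact h.turn_upper hz hy hx hyz h2
  · exact h.turn_upper hz hy hx hyz hxy

theorem Run.exists_vertex (h : S.Run a b) : ∃ v, Corner.vertex v ∈ S.poly a b := by
  have hlt := h.lt
  have hp := h.proper
  have key : ∀ j, j ∈ S.lowerIdx a b → 0 < j → j < S.K → ∃ v, Corner.vertex v ∈ S.poly a b := by
    intro j hj h0 hK
    refine ⟨(S.e j, S.um j * S.e j + S.uc j), List.mem_append_left _ (List.mem_map.2 ⟨j, hj, ?_⟩)⟩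
    simp [lower, chain, h0.ne', hK]
  rcases Nat.eq_zero_or_pos a with h0 | h0
  · exact key (b + 1) ((S.mem_lowerIdx h.le).2 (.inr (.inr rfl))) (by omega) (by omega)
  · exact key a ((S.mem_lowerIdx h.le).2 (.inl rfl)) h0 (h.le.trans_lt hlt)

theorem homog_ne_zero (S : Strip) (j : ℕ) :
    (S.lower j).homog 0 ≠ 0 ∨ (S.lower j).homog 2 ≠ 0 := by
  simp only [lower, chain]
  split_ifs <;> simp [Corner.homog]

theorem Run.isConvexPolygon (h : S.Run a b) : IsConvexPolygon (S.poly a b) := by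
  refine ⟨h.exists_vertex, ?_, ?_⟩
  · rw [poly_eq, List.pairwise_map]
    refine (pairwise_labels h.le).imp_of_mem fun {x y} hx hy hxy => ?_
    have bx := bounds_of_mem_labels h.le hx
    have by' := bounds_of_mem_labels h.le hy
    rcases lt_trichotomy x.2 y.2 with h1 | h1 | h1
    · exact linearIndependent_of_leftOf (.inl (h.leftOf bx.1 h1 by'.2))
    · obtain ⟨s, i⟩ := x
      obtain ⟨s', j⟩ := y
      obtain rfl : i = j := h1
      have : s = false ∧ s' = true := by
        rcases hxy with h | ⟨-, -, h⟩ | ⟨-, -, h⟩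
        · exact h
        · exact absurd h (lt_irrefl _)
        · exact absurd h (lt_irrefl _)
      obtain ⟨rfl, rfl⟩ := this
      have hj : i ∈ S.upperIdx a b := by simpa [mem_labels] using hy
      exact linearIndependent_of_vertical (S.lower_eq_upper i).1 (S.lower_eq_upper i).2
        (S.homog_ne_zero i) (h.lower_lt_upper hj).ne
    · exact linearIndependent_of_leftOf (.inr (h.leftOf by'.1 h1 bx.2))
  · rw [poly_eq, List.triplewise_map]
    exact triplewise_of_pairwise (pairwise_labels h.le) fun x hx y hy z hz hxy hyz hxz =>
      h.turn_pos hx hy hz hxy hyz hxz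

end Strip

/-! ### The region over a run of cells -/

/-- A point on the line through two corners and between them. -/
theorem mem_regionSet_of_between {K : ℕ} {m c e : ℕ → ℝ} {F : ℝ → ℝ} (h : IsPL 0 K m c e F)
    {i j : ℕ} (hij : i < j) (hj : j ≤ K) (hne : ¬ (i = 0 ∧ j = K)) {l : List Corner} {a b t : ℝ}
    (hi : chain K m c e i ∈ l) (hj' : chain K m c e j ∈ l)
    (ei : (chain K m c e i).homog 1 = a * (chain K m c e i).homog 0 +
      b * (chain K m c e i).homog 2)
    (ej : (chain K m c e j).homog 1 = a * (chain K m c e j).homog 0 +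
      b * (chain K m c e j).homog 2)
    (ht : 0 < i → e i ≤ t) (ht' : j < K → t ≤ e j) : (t, a * t + b) ∈ regionSet l := by
  obtain ⟨s, s', hs, hs', h0, h2⟩ : ∃ s s' : ℝ, 0 ≤ s ∧ 0 ≤ s' ∧
      t = s * (chain K m c e i).homog 0 + s' * (chain K m c e j).homog 0 ∧
      1 = s * (chain K m c e i).homog 2 + s' * (chain K m c e j).homog 2 := by
    have ci := chain_homog K m c e i
    have cj := chain_homog K m c e j
    rcases Nat.eq_zero_or_pos i with hi0 | hi0
    · rw [ci.1 hi0, cj.2.1 (by omega) (by omega)]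
      exact ⟨e j - t, 1, by linarith [ht' (by omega)], zero_le_one, by simp, by simp⟩
    · rw [ci.2.1 hi0 (by omega)]
      rcases hj.eq_or_lt with hK | hK
      · rw [cj.2.2 (by omega) hK.ge]
        exact ⟨1, t - e i, zero_le_one, by linarith [ht hi0], by simp, by simp⟩
      · rw [cj.2.1 (by omega) hK]
        have hlt := sub_pos.2 (h.mono_lt hi0 hij hK)
        refine ⟨(e j - t) / (e j - e i), (t - e i) / (e j - e i),
          div_nonneg (by linarith [ht' hK]) hlt.le, div_nonneg (by linarith [ht hi0]) hlt.le,
          ?_, ?_⟩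
        · simp
          field_simp
          ring
        · simp
          rw [← add_div, eq_comm, div_eq_one_iff_eq hlt.ne']
          ring
  refine mem_regionSet_of_homog hi hj' hs hs' h0 ?_ h2
  rw [ei, ej]
  dsimp only
  linear_combination a * h0 + b * h2

/-- The maximal run of pieces on the same line around piece `j`. -/
theorem IsPL.exists_kinks {K : ℕ} {m c e : ℕ → ℝ} {F : ℝ → ℝ} (h : IsPL 0 K m c e F)
    {a b j : ℕ} (hb : b < K) (ha : a ≤ j) (hj : j ≤ b) :
    ∃ i i', a ≤ i ∧ i ≤ j ∧ j < i' ∧ i' ≤ b + 1 ∧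
      (i = a ∨ (a < i ∧ i ≤ b ∧ m (i - 1) ≠ m i)) ∧
      (i' = b + 1 ∨ (a < i' ∧ i' ≤ b ∧ m (i' - 1) ≠ m i')) ∧
      ∀ k, i ≤ k → k < i' → m k = m j ∧ c k = c j := by
  have same : ∀ k, k + 1 < K → m k = m (k + 1) → c k = c (k + 1) := fun k hk hm => by
    have := h.meet (Nat.zero_le k) hk
    rw [hm] at this
    linarith
  have left : ∃ i, a ≤ i ∧ i ≤ j ∧ (i = a ∨ (a < i ∧ i ≤ b ∧ m (i - 1) ≠ m i)) ∧
      ∀ k, i ≤ k → k ≤ j → m k = m j ∧ c k = c j := by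
    induction j, ha using Nat.le_induction with
    | base =>
      refine ⟨a, le_rfl, le_rfl, .inl rfl, fun k h1 h2 => ?_⟩
      rw [le_antisymm h2 h1]
      exact ⟨rfl, rfl⟩
    | succ j ha ih =>
      by_cases hm : m j = m (j + 1)
      · obtain ⟨i, h1, h2, h3, h4⟩ := ih (by omega)
        refine ⟨i, h1, by omega, h3, fun k h5 h6 => ?_⟩
        rcases h6.eq_or_lt with rfl | h7
        · exact ⟨rfl, rfl⟩
        · rw [← hm, ← same j (by omega) hm]
          exact h4 k h5 (by omega)
      · refine ⟨j + 1, by omega, le_rfl, .inr ⟨by omega, hj, hm⟩, fun k h1 h2 => ?_⟩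
        rw [le_antisymm h2 h1]
        exact ⟨rfl, rfl⟩
  have right : ∃ i', j < i' ∧ i' ≤ b + 1 ∧
      (i' = b + 1 ∨ (a < i' ∧ i' ≤ b ∧ m (i' - 1) ≠ m i')) ∧
      ∀ k, j ≤ k → k < i' → m k = m j ∧ c k = c j := by
    clear left
    obtain ⟨d, hd⟩ : ∃ d, b = j + d := ⟨b - j, by omega⟩
    induction d generalizing j with
    | zero =>
      refine ⟨b + 1, by omega, le_rfl, .inl rfl, fun k h1 h2 => ?_⟩
      rw [show k = j by omega]
      exact ⟨rfl, rfl⟩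
    | succ d ih =>
      by_cases hm : m j = m (j + 1)
      · obtain ⟨i, h1, h2, h3, h4⟩ := ih (by omega : a ≤ j + 1) (by omega) (by omega)
        refine ⟨i, by omega, h2, h3, fun k h5 h6 => ?_⟩
        rcases h5.eq_or_lt with rfl | h7
        · exact ⟨rfl, rfl⟩
        · rw [hm, same j (by omega) hm]
          exact h4 k h7 h6
      · refine ⟨j + 1, by omega, by omega, .inr ⟨by omega, by omega, by simpa using hm⟩,
          fun k h1 h2 => ?_⟩
        rw [show k = j by omega]
        exact ⟨rfl, rfl⟩
  obtain ⟨i, h1, h2, h3, h4⟩ := left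
  obtain ⟨i', h5, h6, h7, h8⟩ := right
  refine ⟨i, i', h1, h2, h5, h6, h3, h7, fun k h9 h10 => ?_⟩
  rcases le_total k j with h11 | h11
  · exact h4 k h9 h11
  · exact h8 k h11 h10

/-- Two corners on the line of piece `j`, on both sides of this piece. -/
theorem IsPL.exists_corners {K : ℕ} {m c e : ℕ → ℝ} {F : ℝ → ℝ} (h : IsPL 0 K m c e F)
    {a b j : ℕ} (hb : b < K) (hp : ¬ (a = 0 ∧ b + 1 = K)) (ha : a ≤ j) (hj : j ≤ b)
    {l : List Corner} (hl : ∀ i, i = a ∨ (a < i ∧ i ≤ b ∧ m (i - 1) ≠ m i) ∨ i = b + 1 →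
      chain K m c e i ∈ l) {t : ℝ} (ht : 0 < j → e j ≤ t) (ht' : j + 1 < K → t ≤ e (j + 1)) :
    (t, F t) ∈ regionSet l := by
  obtain ⟨i, i', h1, h2, h3, h4, h5, h6, h7⟩ := h.exists_kinks hb ha hj
  rw [h.eval j (Nat.zero_le _) (by omega) t ht ht' fun _ => trivial]
  have on : ∀ k, (0 < k → k < K → k ≤ i' ∧ i ≤ k) → (k = 0 → i = 0) → (K ≤ k → i' = K) →
      (chain K m c e k).homog 1 = m j * (chain K m c e k).homog 0 +
      c j * (chain K m c e k).homog 2 := by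
    intro k hk hk0 hkK
    rcases Nat.eq_zero_or_pos k with h0 | h0
    · rw [(chain_homog K m c e k).1 h0]
      simp [(h7 0 (by rw [hk0 h0]) (by omega)).1]
    rcases lt_or_ge k K with hK | hK
    · obtain ⟨e1, e2, e3, -, -⟩ := h.chain_eq h0 hK
      obtain ⟨g1, g2⟩ := hk h0 hK
      rw [e3, mul_one]
      rcases g2.eq_or_lt with rfl | g2
      · rw [e1, (h7 i le_rfl (by omega)).1, (h7 i le_rfl (by omega)).2]
      · rw [e2, (h7 (k - 1) (by omega) (by omega)).1, (h7 (k - 1) (by omega) (by omega)).2]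
    · rw [(chain_homog K m c e k).2.2 h0 hK]
      have := hkK hK
      simp [(h7 (K - 1) (by omega) (by omega)).1]
  refine mem_regionSet_of_between h (by omega : i < i') (by omega) (by omega)
    (hl i (by tauto)) (hl i' (by tauto)) (on i (by omega) (by omega) (by omega))
    (on i' (by omega) (by omega) (by omega)) (fun h0 => ?_) (fun hK => ?_)
  · have := ht (by omega)
    rcases h2.eq_or_lt with rfl | hlt
    · exact this
    · exact (h.mono_lt h0 hlt (by omega)).le.trans this
  · have := ht' (by omega)
    rcases (by omega : j + 1 ≤ i').eq_or_lt with rfl | hlt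
    · exact this
    · exact this.trans (h.mono_lt (by omega) hlt hK).le

namespace Strip

variable {S : Strip} {a b : ℕ}

theorem lower_mem (hab : a ≤ b) {i : ℕ}
    (hi : i = a ∨ (a < i ∧ i ≤ b ∧ S.um (i - 1) ≠ S.um i) ∨ i = b + 1) :
    S.lower i ∈ S.poly a b :=
  List.mem_append_left _ (List.mem_map.2 ⟨i, (S.mem_lowerIdx hab).2 hi, rfl⟩)

theorem Run.upper_mem (h : S.Run a b) {i : ℕ}
    (hi : i = a ∨ (a < i ∧ i ≤ b ∧ S.lm (i - 1) ≠ S.lm i) ∨ i = b + 1) :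
    S.upper i ∈ S.poly a b := by
  have hlt := h.lt
  have hab := h.le
  have vert : ∀ i, 0 < i → i < S.K → S.U (S.e i) = S.L (S.e i) → S.upper i = S.lower i := by
    intro i h0 hK hUL
    have e1 := (S.plU.eval i (Nat.zero_le _) hK (S.e i) (fun _ => le_rfl)
      (fun h' => (S.plU.mono i h0 h').le) fun _ => trivial)
    have e2 := (S.plL.eval i (Nat.zero_le _) hK (S.e i) (fun _ => le_rfl)
      (fun h' => (S.plU.mono i h0 h').le) fun _ => trivial)
    simp only [upper, lower, chain, h0.ne', hK, if_true, if_false]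
    rw [← e1, ← e2, hUL]
  have mem : i ∈ S.upperIdx a b → S.upper i ∈ S.poly a b := fun hi =>
    List.mem_append_right _ (List.mem_map.2 ⟨i, List.mem_reverse.2 hi, rfl⟩)
  rcases hi with rfl | hi | rfl
  · rcases Nat.eq_zero_or_pos i with rfl | h0
    · by_cases hm : S.um 0 = S.lm 0
      · have : S.upper 0 = S.lower 0 := by simp [upper, lower, chain, hm]
        rw [this]
        exact lower_mem hab (.inl rfl)
      · exact mem ((S.mem_upperIdx hab).2 (.inl ⟨rfl, rfl, hm⟩))
    · rw [vert i h0 (by omega) (h.left h0)]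
      exact lower_mem hab (.inl rfl)
  · exact mem ((S.mem_upperIdx hab).2 (.inr (.inl hi)))
  · rcases (by omega : b + 1 ≤ S.K).eq_or_lt with hK | hK
    · by_cases hm : S.um b = S.lm b
      · have : S.upper (b + 1) = S.lower (b + 1) := by
          simp only [upper, lower, chain, ← hK, lt_irrefl, Nat.succ_ne_zero, if_false]
          simp [hm]
        rw [this]
        exact lower_mem hab (.inr (.inr rfl))
      · exact mem ((S.mem_upperIdx hab).2 (.inr (.inr ⟨rfl, hK, hm⟩)))
    · rw [vert _ (Nat.succ_pos _) hK (h.right hK)]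
      exact lower_mem hab (.inr (.inr rfl))

/-- A cell of the run that contains `t`. -/
theorem Run.exists_cell (h : S.Run a b) {t : ℝ} (ht : 0 < a → S.e a ≤ t)
    (ht' : b + 1 < S.K → t ≤ S.e (b + 1)) :
    ∃ k, a ≤ k ∧ k ≤ b ∧ (0 < k → S.e k ≤ t) ∧ (k + 1 < S.K → t ≤ S.e (k + 1)) := by
  have hlt := h.lt
  have hab := h.le
  obtain ⟨k, -, hk, h1, h2⟩ := S.plU.exists_piece t
  rcases lt_or_ge k a with h3 | h3
  · exfalso
    have h4 := h2 (by omega)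
    have h5 := ht (by omega)
    rcases (by omega : k + 1 ≤ a).eq_or_lt with h6 | h6
    · rw [h6] at h4; linarith
    · have := S.plU.mono_lt (by omega) h6 (by omega : a < S.K)
      linarith
  rcases le_or_gt k b with h4 | h4
  · exact ⟨k, h3, h4, h1, fun h => (h2 h).le⟩
  · refine ⟨b, hab, le_rfl, fun h0 => ?_, ht'⟩
    exact (S.plU.mono_lt h0 h4 hk).le.trans (h1 (by omega))

theorem Run.regionSet_eq (h : S.Run a b) : regionSet (S.poly a b) =
    {p | p ∈ S.set ∧ (0 < a → S.e a ≤ p.1) ∧ (b + 1 < S.K → p.1 ≤ S.e (b + 1))} := by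
  have hlt := h.lt
  have hab := h.le
  have ofLabels : ∀ {C}, C ∈ S.poly a b → ∃ x ∈ S.labels a b, S.corner x = C := fun hC => by
    rw [poly_eq] at hC
    exact List.mem_map.1 hC
  refine Set.Subset.antisymm (fun p hp => ?_) ?_
  · have hl : 0 < a → S.e a ≤ p.1 := fun h0 => by
      have := le_of_mem_regionSet (a := 1) (b := 0) (c := -S.e a) (fun C hC => ?_) hp
      · linarith
      obtain ⟨x, hx, rfl⟩ := ofLabels hC
      have bx := bounds_of_mem_labels hab hx
      obtain ⟨-, -, g1, g2, -⟩ := S.plU.chain_eq h0 (by omega : a < S.K)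
      rcases bx.1.eq_or_lt with h1 | h1
      · have : (S.corner x).homog 0 = S.e a ∧ (S.corner x).homog 2 = 1 := by
          have := S.lower_eq_upper a
          have e1 : (S.lower a).homog 0 = S.e a := g2
          have e2 : (S.lower a).homog 2 = 1 := g1
          simp only [corner, ← h1]
          split_ifs
          · rw [← this.1, ← this.2]
            exact ⟨e1, e2⟩
          · exact ⟨e1, e2⟩
        rw [this.1, this.2]
        linarith
      · have := h.leftOf (x := (false, a)) (y := x) le_rfl h1 bx.2
        simp only [LeftOf] at this
        have e1 : (S.corner (false, a)).homog 0 = S.e a := g2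
        have e2 : (S.corner (false, a)).homog 2 = 1 := g1
        rw [e1, e2] at this
        linarith
    have hr : b + 1 < S.K → p.1 ≤ S.e (b + 1) := fun hK => by
      have := le_of_mem_regionSet (a := -1) (b := 0) (c := S.e (b + 1)) (fun C hC => ?_) hp
      · linarith
      obtain ⟨x, hx, rfl⟩ := ofLabels hC
      have bx := bounds_of_mem_labels hab hx
      obtain ⟨-, -, g1, g2, -⟩ := S.plU.chain_eq (Nat.succ_pos b) hK
      rcases bx.2.eq_or_lt with h1 | h1
      · have : (S.corner x).homog 0 = S.e (b + 1) ∧ (S.corner x).homog 2 = 1 := by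
          have := S.lower_eq_upper (b + 1)
          have e1 : (S.lower (b + 1)).homog 0 = S.e (b + 1) := g2
          have e2 : (S.lower (b + 1)).homog 2 = 1 := g1
          simp only [corner, h1]
          split_ifs
          · rw [← this.1, ← this.2]
            exact ⟨e1, e2⟩
          · exact ⟨e1, e2⟩
        rw [this.1, this.2]
        linarith
      · have := h.leftOf (x := x) (y := (false, b + 1)) bx.1 h1 le_rfl
        simp only [LeftOf] at this
        have e1 : (S.corner (false, b + 1)).homog 0 = S.e (b + 1) := g2
        have e2 : (S.corner (false, b + 1)).homog 2 = 1 := g1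
        rw [e1, e2] at this
        linarith
    refine ⟨?_, hl, hr⟩
    obtain ⟨k, h1, h2, h3, h4⟩ := h.exists_cell hl hr
    constructor
    · rw [S.plU.eval k (Nat.zero_le _) (by omega) p.1 h3 h4 fun _ => trivial]
      have := le_of_mem_regionSet (a := -S.um k) (b := 1) (c := -S.uc k) (fun C hC => ?_) hp
      · linarith
      obtain ⟨x, hx, rfl⟩ := ofLabels hC
      have bx := bounds_of_mem_labels hab hx
      linarith [h.above bx.1 bx.2 h1 h2]
    · rw [S.plL.eval k (Nat.zero_le _) (by omega) p.1 h3 h4 fun _ => trivial]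
      have := le_of_mem_regionSet (a := S.lm k) (b := -1) (c := S.lc k) (fun C hC => ?_) hp
      · linarith
      obtain ⟨x, hx, rfl⟩ := ofLabels hC
      have bx := bounds_of_mem_labels hab hx
      linarith [h.below_line bx.1 bx.2 h1 h2]
  · rintro ⟨t, y⟩ ⟨⟨hU, hL⟩, hl, hr⟩
    dsimp only at hU hL hl hr
    obtain ⟨k, h1, h2, h3, h4⟩ := h.exists_cell hl hr
    have mU := S.plU.exists_corners hlt h.proper h1 h2 (fun i hi => lower_mem hab hi) h3 h4
    have mL := S.plL.exists_corners hlt h.proper h1 h2 (fun i hi => h.upper_mem hi) h3 h4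
    have := (convex_regionSet (S.poly a b)).segment_subset mU mL
    refine this ?_
    have hy : y ∈ segment ℝ (S.U t) (S.L t) := by
      rw [segment_eq_Icc (hU.trans hL)]
      exact ⟨hU, hL⟩
    rw [← Prod.image_mk_segment_right]
    exact ⟨y, hy, rfl⟩

end Strip

/-! ### Sweeping over the cells -/

theorem kinks_zero (m : ℕ → ℝ) (i : ℕ) : kinks m i 0 = [] := rfl

theorem kinks_succ (m : ℕ → ℝ) (i n : ℕ) : kinks m i (n + 1) =
    kinks m i n ++ if m (i + n - 1) ≠ m (i + n) then [i + n] else [] := by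
  rw [kinks, List.range'_1_concat, List.filter_append, ← kinks, List.filter_singleton]
  by_cases h : m (i + n - 1) = m (i + n) <;> simp [h]

theorem kinks_succ' (m : ℕ → ℝ) (i n : ℕ) : kinks m i (n + 1) =
    (if m (i - 1) ≠ m i then [i] else []) ++ kinks m (i + 1) n := by
  rw [kinks, List.range'_succ, List.filter_cons, ← kinks]
  by_cases h : m (i - 1) = m i <;> simp [h]

theorem Describes.append {Ls : List (List Corner)} {A B : Set Plane} (h : Describes Ls A)
    {l : List Corner} (hl : IsConvexPolygon l) (hB : regionSet l = B)
    (hAB : (A ∩ B).Subsingleton) : Describes (Ls ++ [l]) (A ∪ B) := by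
  obtain ⟨h1, h2, h3⟩ := h
  refine ⟨?_, ?_, ?_⟩
  · intro l' hl'
    rcases List.mem_append.1 hl' with h | h
    · exact h1 l' h
    · rw [List.mem_singleton.1 h]; exact hl
  · rw [List.pairwise_append]
    refine ⟨h2, List.pairwise_singleton _ _, fun l' hl' l'' hl'' => ?_⟩
    rw [List.mem_singleton.1 hl'', hB]
    refine hAB.anti (Set.inter_subset_inter_left _ ?_)
    rw [← h3]
    exact Set.subset_biUnion_of_mem (u := fun l => regionSet l) hl'
  · ext p
    rw [← h3, ← hB]
    simp only [Set.mem_iUnion, List.mem_append, List.mem_singleton, Set.mem_union, exists_prop]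
    constructor
    · rintro ⟨l', hl' | rfl, hp⟩
      · exact .inl ⟨l', hl', hp⟩
      · exact .inr hp
    · rintro (⟨l', hl', hp⟩ | hp)
      · exact ⟨l', .inl hl', hp⟩
      · exact ⟨l, .inr rfl, hp⟩

theorem regionSet_singleton (p : Plane) : regionSet [Corner.vertex p] = {p} := by
  have e1 : {v : Plane | Corner.vertex v ∈ [Corner.vertex p]} = {p} := by ext; simp
  have e2 : {v : Plane | Corner.direction v ∈ [Corner.vertex p]} = ∅ := by ext; simp
  ext q
  simp only [regionSet, e1, e2, convexHull_singleton, Set.mem_ofPred_eq, Set.mem_singleton_iff]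
  constructor
  · rintro ⟨_, rfl, u, hu, rfl⟩
    have : u = 0 := by simpa using hu
    simp [this]
  · rintro rfl
    exact ⟨q, rfl, 0, zero_mem _, by simp⟩

theorem isConvexPolygon_singleton (p : Plane) : IsConvexPolygon [Corner.vertex p] :=
  ⟨⟨p, by simp⟩, List.pairwise_singleton _ _, List.triplewise_singleton _ _⟩

namespace Strip

variable {S : Strip}

/-- The part of the strip over the first `k` cells. -/
def upTo (S : Strip) (k : ℕ) : Set Plane :=
  {p | p ∈ S.set ∧ k ≠ 0 ∧ (k < S.K → p.1 ≤ S.e k)}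

theorem describes_upTo_zero : Describes [] (S.upTo 0) :=
  ⟨by simp, .nil, by simp [upTo]⟩

theorem upTo_last : S.upTo S.K = S.set := by
  have := S.plU.lt
  ext p
  simp [upTo, this.ne']

theorem le_of_lt {i j : ℕ} (hi : 0 < i) (hij : i ≤ j) (hj : j < S.K) : S.e i ≤ S.e j := by
  rcases hij.eq_or_lt with rfl | h
  · exact le_rfl
  · exact (S.plU.mono_lt hi h hj).le

theorem Run.describes {a b : ℕ} (h : S.Run a b) {Ls : List (List Corner)}
    (hLs : Describes Ls (S.upTo a)) : Describes (Ls ++ [S.poly a b]) (S.upTo (b + 1)) := by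
  have hlt := h.lt
  have hab := h.le
  have := hLs.append h.isConvexPolygon h.regionSet_eq ?_
  · convert this using 1
    ext p
    simp only [upTo, Set.mem_union, Set.mem_ofPred_eq]
    constructor
    · rintro ⟨h1, -, h2⟩
      by_cases ha : 0 < a → S.e a ≤ p.1
      · exact .inr ⟨h1, ha, h2⟩
      · push Not at ha
        exact .inl ⟨h1, ha.1.ne', fun _ => ha.2.le⟩
    · rintro (⟨h1, h2, h3⟩ | ⟨h1, -, h2⟩)
      · exact ⟨h1, by omega, fun hb => (h3 (by omega)).trans (le_of_lt (by omega) (by omega) hb)⟩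
      · exact ⟨h1, by omega, h2⟩
  · rintro ⟨t, y⟩ ⟨⟨⟨h1, h2⟩, h3, h4⟩, -, h5, -⟩ ⟨t', y'⟩ ⟨⟨⟨h1', h2'⟩, -, h4'⟩, -, h5', -⟩
    dsimp only at *
    obtain rfl : t = S.e a := le_antisymm (h4 (by omega)) (h5 (by omega))
    obtain rfl : t' = S.e a := le_antisymm (h4' (by omega)) (h5' (by omega))
    rw [h.left (by omega)] at h1 h1'
    rw [le_antisymm h2 h1, le_antisymm h2' h1']

/-- A cell over whose interior the strip has no points. -/
structure Gap (S : Strip) (k : ℕ) : Prop where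
  lt : k < S.K
  above : ∀ t, (0 < k → S.e k < t) → (k + 1 < S.K → t < S.e (k + 1)) → S.L t < S.U t

theorem Gap.mem_upTo {k : ℕ} (h : S.Gap k) {p : Plane} : p ∈ S.upTo (k + 1) ↔
    p ∈ S.upTo k ∨ (k + 1 < S.K ∧ p ∈ S.set ∧ p.1 = S.e (k + 1)) := by
  have hlt := h.lt
  constructor
  · rintro ⟨h1, -, h2⟩
    by_cases h3 : 0 < k → S.e k < p.1
    · by_cases h4 : k + 1 < S.K → p.1 < S.e (k + 1)
      · exact absurd (h1.1.trans h1.2) (h.above _ h3 h4).not_ge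
      · push Not at h4
        exact .inr ⟨h4.1, h1, le_antisymm (h2 h4.1) h4.2⟩
    · push Not at h3
      exact .inl ⟨h1, h3.1.ne', fun _ => h3.2⟩
  · rintro (⟨h1, h2, h3⟩ | ⟨h1, h2, h3⟩)
    · exact ⟨h1, by omega, fun hk => (h3 (by omega)).trans (le_of_lt (by omega) (by omega) hk)⟩
    · exact ⟨h2, by omega, fun _ => h3.le⟩

theorem Gap.describes {k : ℕ} (h : S.Gap k) {Ls : List (List Corner)}
    (hLs : Describes Ls (S.upTo k)) (hne : k + 1 < S.K → S.L (S.e (k + 1)) < S.U (S.e (k + 1))) :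
    Describes Ls (S.upTo (k + 1)) := by
  convert hLs using 1
  ext ⟨t, y⟩
  rw [h.mem_upTo, or_iff_left]
  rintro ⟨h1, ⟨h2, h3⟩, h4⟩
  dsimp only at h2 h3 h4
  rw [h4] at h2 h3
  exact (hne h1).not_ge (h2.trans h3)

theorem Gap.describes_point {k : ℕ} (h : S.Gap k) {Ls : List (List Corner)}
    (hLs : Describes Ls (S.upTo k)) (hk : k + 1 < S.K)
    (heq : S.L (S.e (k + 1)) = S.U (S.e (k + 1))) :
    Describes (Ls ++ [[S.lower (k + 1)]]) (S.upTo (k + 1)) := by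
  have hl : S.lower (k + 1) = Corner.vertex (S.e (k + 1), S.U (S.e (k + 1))) := by
    rw [S.plU.eval (k + 1) (Nat.zero_le _) hk _ (fun _ => le_rfl)
      (fun h' => (S.plU.mono (k + 1) (by omega) h').le) fun _ => trivial]
    simp [lower, chain, hk]
  rw [hl]
  have := hLs.append (isConvexPolygon_singleton (S.e (k + 1), S.U (S.e (k + 1))))
    (regionSet_singleton _) (Set.subsingleton_singleton.anti Set.inter_subset_right)
  convert this using 1
  ext ⟨t, y⟩
  rw [h.mem_upTo, Set.mem_union, Set.mem_singleton_iff, Prod.mk.injEq]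
  refine or_congr_right ⟨?_, ?_⟩
  · rintro ⟨-, ⟨h2, h3⟩, h4⟩
    dsimp only at h2 h3 h4
    subst h4
    exact ⟨rfl, le_antisymm (h3.trans_eq heq) h2⟩
  · rintro ⟨rfl, rfl⟩
    exact ⟨hk, ⟨le_rfl, heq.ge⟩, rfl⟩

section signs

variable {w : ℕ → ℕ}

theorem gap_of_ne (hw : SignsTo S.K w S.e (fun _ => True) S.L S.U) {k : ℕ} (hk : k < S.K)
    (h : w k ≠ 0) : S.Gap k :=
  ⟨hk, fun t h1 h2 => (hw k hk).2 h t h1 h2 fun _ => trivial⟩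

theorem le_of_ne (hw : SignsTo S.K w S.e (fun _ => True) S.L S.U) {k : ℕ} (hk : k + 1 < S.K)
    (h : w k ≠ 0) :
    S.L (S.e (k + 1)) ≤ S.U (S.e (k + 1)) :=
  hw.le_of_ne S.plL S.plU (by omega) h (fun h0 => (S.plU.mono k h0 hk).le) fun _ => le_rfl

/-- A run found by scanning the cells from left to right. -/
theorem run_of_scan (hw : SignsTo S.K w S.e (fun _ => True) S.L S.U) {a b : ℕ} (h2 : 2 ≤ S.K)
    (ht : ∃ t, S.L t ≤ S.U t) (hab : a ≤ b)
    (hb : b < S.K) (ha : w a = 0) (hpos : ∀ k, a < k → k ≤ b → S.U (S.e k) < S.L (S.e k))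
    (hl : 0 < a → S.L (S.e a) ≤ S.U (S.e a))
    (hr : b + 1 < S.K → ¬ S.U (S.e (b + 1)) < S.L (S.e (b + 1))) : S.Run a b := by
  have hwk : ∀ k, a ≤ k → k ≤ b → w k = 0 := by
    intro k h1 h3
    rcases h1.eq_or_lt with rfl | h1
    · exact ha
    by_contra hne
    have := hw.le_of_ne S.plL S.plU (by omega : k < S.K) hne (t := S.e k) (fun _ => le_rfl)
      fun h => (S.plU.mono k (by omega) h).le
    exact (hpos k h1 h3).not_ge this
  have cell : ∀ k, a ≤ k → k ≤ b → ∀ t, (0 < k → S.e k ≤ t) → (k + 1 < S.K → t ≤ S.e (k + 1)) →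
      S.U t ≤ S.L t := fun k h1 h3 t h4 h5 =>
    (hw k (by omega)).1 (hwk k h1 h3) t h4 h5 fun _ => trivial
  refine ⟨hab, hb, ?_, ?_, hpos, ?_, ?_⟩
  · rintro ⟨rfl, hbK⟩
    obtain ⟨t, ht⟩ := ht
    obtain ⟨k, -, hk, h3, h4⟩ := S.plU.exists_piece t
    have h4 := fun h => (h4 h).le
    have evU := fun u h h' => S.plU.eval k (Nat.zero_le _) hk u h h' fun _ => trivial
    have evL := fun u h h' => S.plL.eval k (Nat.zero_le _) hk u h h' fun _ => trivial
    have hc := fun u h h' => cell k (Nat.zero_le _) (by omega) u h h'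
    rw [evU t h3 h4, evL t h3 h4] at ht
    rcases Nat.eq_zero_or_pos k with rfl | h0
    · have h5 := hpos 1 one_pos (by omega)
      have h6 := h4 (by omega)
      rw [zero_add] at h6
      rw [evU _ (by simp) (fun _ => le_rfl), evL _ (by simp) (fun _ => le_rfl)] at h5
      have h7 := hc (t - 1) (by simp) (fun h => by linarith)
      rw [evU _ (by simp) (fun _ => by rw [zero_add]; linarith),
        evL _ (by simp) (fun _ => by rw [zero_add]; linarith)] at h7
      nlinarith
    · have h5 := hpos k h0 (by omega)
      have h6 := h3 h0
      have hm : k + 1 < S.K → S.e k ≤ S.e (k + 1) := fun h => (S.plU.mono k h0 h).le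
      rw [evU _ (fun _ => le_rfl) hm, evL _ (fun _ => le_rfl) hm] at h5
      by_cases hK : k + 1 < S.K
      · have h7 := hpos (k + 1) (by omega) (by omega)
        rw [evU _ (fun _ => hm hK) (fun _ => le_rfl),
          evL _ (fun _ => hm hK) (fun _ => le_rfl)] at h7
        rcases le_total (S.um k) (S.lm k) with h8 | h8
        · nlinarith
        · nlinarith [h4 hK]
      · have h7 := hc (t + 1) (fun _ => by linarith) (fun h => absurd h hK)
        rw [evU _ (fun _ => by linarith) (fun h => absurd h hK),
          evL _ (fun _ => by linarith) (fun h => absurd h hK)] at h7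
        nlinarith
  · intro t h3 h4
    obtain ⟨k, -, hk, h5, h6⟩ := S.plU.exists_piece t
    rcases lt_or_ge k a with h7 | h7
    · have h8 := h6 (by omega)
      have h9 := le_of_lt (Nat.succ_pos k) h7 (by omega : a < S.K)
      have h10 := h3 (by omega)
      linarith
    rcases le_or_gt k b with h8 | h8
    · exact cell k h7 h8 t h5 fun h => (h6 h).le
    · exact cell b hab le_rfl t
        (fun h0 => (le_of_lt h0 h8.le hk).trans (h5 (by omega))) h4
  · exact fun h0 => le_antisymm (cell a le_rfl hab _ (fun _ => le_rfl)
      fun h => (S.plU.mono a h0 h).le) (hl h0)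
  · exact fun hK => le_antisymm (cell b hab le_rfl _
      (fun h0 => (S.plU.mono b h0 hK).le) fun _ => le_rfl) (not_lt.1 (hr hK))

end signs

end Strip

/-! ### Writing the output -/

namespace RealRAM

/-!
The variables `vPos` and `vStart` hold the number of corners that have been written, in all regions
and in the completed ones, and `vFirst` is the first cell of the current run.
-/

@[simp] abbrev vPos : ℕ := 30
@[simp] abbrev vStart : ℕ := 31
@[simp] abbrev vFirst : ℕ := 32

/-- The regions `Ls` have been written, and after them the corners `cur` of an unfinished region. -/
structure Output (σ : State) (Ls : List (List Corner)) (cur : List Corner) : Prop where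
  count : σ.nat 0 0 = Ls.length
  sizes : (List.range Ls.length).map (σ.nat 1) = Ls.map List.length
  pos : σ.nat vPos 0 = (Ls.flatten ++ cur).length
  start : σ.nat vStart 0 = Ls.flatten.length
  corners : (List.range (σ.nat vPos 0)).map σ.corner = Ls.flatten ++ cur

theorem corner_congr {σ τ : State} (h : τ.nat 2 = σ.nat 2) (h0 : τ.real 0 = σ.real 0)
    (h1 : τ.real 1 = σ.real 1) : τ.corner = σ.corner := by
  funext i
  simp only [State.corner, h, h0, h1]

theorem Output.congr {σ τ : State} {Ls : List (List Corner)} {cur : List Corner}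
    (h : Output σ Ls cur) (h0 : τ.nat 0 = σ.nat 0) (h1 : τ.nat 1 = σ.nat 1)
    (h2 : τ.nat 2 = σ.nat 2) (h3 : τ.nat vPos = σ.nat vPos) (h4 : τ.nat vStart = σ.nat vStart)
    (h5 : τ.real 0 = σ.real 0) (h6 : τ.real 1 = σ.real 1) : Output τ Ls cur := by
  obtain ⟨e1, e2, e3, e4, e5⟩ := h
  constructor
  · rw [h0, e1]
  · rw [h1, e2]
  · rw [h3, e3]
  · rw [h4, e4]
  · rw [h3, corner_congr h2 h5 h6, e5]

theorem Output.push {σ τ : State} {Ls : List (List Corner)} {cur : List Corner}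
    (h : Output σ Ls cur) {C : Corner} (h0 : τ.nat 0 = σ.nat 0) (h1 : τ.nat 1 = σ.nat 1)
    (h3 : τ.nat vPos 0 = σ.nat vPos 0 + 1) (h4 : τ.nat vStart = σ.nat vStart)
    (hk : ∀ i < σ.nat vPos 0, τ.corner i = σ.corner i) (hC : τ.corner (σ.nat vPos 0) = C) :
    Output τ Ls (cur ++ [C]) := by
  obtain ⟨e1, e2, e3, e4, e5⟩ := h
  constructor
  · rw [h0, e1]
  · rw [h1, e2]
  · rw [h3, e3]; simp; omega
  · rw [h4, e4]
  · rw [h3, List.range_succ, List.map_append, ← List.append_assoc, ← e5]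
    refine congrArg₂ _ (List.map_congr_left fun i hi => hk i (List.mem_range.1 hi)) ?_
    simp [hC]

theorem regions_eq {Ls : List (List Corner)} {sz : ℕ → ℕ} {cor : ℕ → Corner}
    (hs : (List.range Ls.length).map sz = Ls.map List.length)
    (hc : (List.range Ls.flatten.length).map cor = Ls.flatten) :
    ((List.range Ls.length).map fun j => (List.range (sz j)).map fun k =>
      cor ((∑ i ∈ Finset.range j, sz i) + k)) = Ls := by
  induction Ls using List.reverseRecOn with
  | nil => rfl
  | append_singleton Ls l ih =>
    have hlen : (Ls ++ [l]).length = Ls.length + 1 := by simp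
    have hflat : (Ls ++ [l]).flatten = Ls.flatten ++ l := by simp
    rw [hlen, List.range_succ, List.map_append, List.map_append] at hs
    obtain ⟨hs1, hs2⟩ := List.append_inj hs (by simp)
    have hs2 : sz Ls.length = l.length := by simpa using hs2
    rw [hflat, List.length_append, List.range_add, List.map_append] at hc
    obtain ⟨hc1, hc2⟩ := List.append_inj hc (by simp)
    have hsum : ∑ i ∈ Finset.range Ls.length, sz i = Ls.flatten.length := by
      rw [List.length_flatten, ← hs1]
      simp [Finset.sum, Finset.range, Multiset.range]
    rw [hlen, List.range_succ, List.map_append, ih hs1 hc1]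
    congr 1
    simp only [List.map_cons, List.map_nil, hsum, hs2]
    rw [List.map_map] at hc2
    exact congrArg (fun x => [x]) hc2

theorem Output.regions {σ : State} {Ls : List (List Corner)} (h : Output σ Ls []) :
    σ.regions = Ls := by
  obtain ⟨e1, e2, e3, e4, e5⟩ := h
  rw [e3, List.append_nil] at e5
  rw [State.regions, e1]
  exact regions_eq e2 e5

/-- Close the current region. -/
def finish : Prog :=
  .setNat 1 (nv 0) (nv vPos -ₙ nv vStart) ;; setN vStart (nv vPos) ;; setN 0 (nv 0 +ₙ one)

theorem wp_finish {σ : State} {Ls : List (List Corner)} {cur : List Corner}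
    (h : Output σ Ls cur) : wp finish (fun τ => Output τ (Ls ++ [cur]) []) σ := by
  obtain ⟨e1, e2, e3, e4, e5⟩ := h
  simp only [vPos, vStart] at *
  simp [finish]
  constructor
  · simp [e1]
  · simp only [List.length_append, List.length_singleton, List.range_succ, List.map_append]
    refine congrArg₂ _ ?_ ?_
    · rw [← e2]
      refine List.map_congr_left fun i hi => ?_
      have := List.mem_range.1 hi
      simp
      rw [Function.update_of_ne (by omega)]
    · simp [e1, e3, e4]
  · simpa using e3
  · simp [e3]
  · have : ∀ τ : State, (τ.nat 2 = σ.nat 2) → τ.real = σ.real → τ.corner = σ.corner :=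
      fun τ h h' => corner_congr h (by rw [h']) (by rw [h'])
    rw [this _ (by simp) (by simp)]
    simpa using e5

/-- Write a corner, given in sheared coordinates, in the original coordinates. -/
def write (x y : RExp) (kind : ℕ) : Prog :=
  .setReal 0 (nv vPos) (.const 0 -ᵣ y) ;; .setReal 1 (nv vPos) (x -ᵣ rv vS *ᵣ y) ;;
  .setNat 2 (nv vPos) (.const kind) ;; setN vPos (nv vPos +ₙ one)

/-- Write corner `v` of the graph of the piecewise linear function with slopes `M` and intercepts
`C`. -/
def emit (M C v : ℕ) : Prog :=
  .ite (nv v <ₙ one) (write (.const (-1)) (.const 0 -ᵣ .get M (.const 0)) 0)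
    (.ite (nv v <ₙ nv vK)
      (write (.get aE (nv v)) (.get M (nv v) *ᵣ .get aE (nv v) +ᵣ .get C (nv v)) 1)
      (write (.const 1) (.get M (nv vK -ₙ one)) 0))

theorem wp_emit {M C v : ℕ} (hM : M ≠ 0) (hC : C ≠ 0) {σ : State} {Ls : List (List Corner)}
    {cur : List Corner} (h : Output σ Ls cur) :
    wp (emit M C v) (fun τ => Output τ Ls (cur ++ [(chain (σ.nat vK 0) (σ.real M) (σ.real C)
      (σ.real aE) (σ.nat v 0)).map (shear (σ.real vS 0))])) σ := by
  simp only [vK, vS, aE] at *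
  simp [emit, write, hM, hC]
  have key : ∀ x y : ℝ, ∀ k : ℕ, ∀ Cr : Corner,
      (if k = 0 then Corner.direction (-y, x - σ.real 30 0 * y)
        else .vertex (-y, x - σ.real 30 0 * y)) = Cr →
      Output ((((σ.setReal 0 (σ.nat 30 0) (-y)).setReal 1 (σ.nat 30 0)
        (x - σ.real 30 0 * y)).setNat 2 (σ.nat 30 0) k).setNat 30 0 (σ.nat 30 0 + 1)) Ls
        (cur ++ [Cr]) := by
    intro x y k Cr hCr
    refine h.push (by simp) (by simp) (by simp) (by simp) (fun i hi => ?_) ?_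
    · have : i ≠ σ.nat 30 0 := hi.ne
      simp [State.corner, this]
    · rw [← hCr]
      simp [State.corner]
  refine ⟨fun h0 => ?_, fun h0 => ⟨fun hK => ?_, fun hK => ?_⟩⟩
  · have := key (-1) (-σ.real M 0) 0 _ rfl
    simpa [chain, h0, Corner.map, shear] using this
  · have := key (σ.real 13 (σ.nat v 0))
      (σ.real M (σ.nat v 0) * σ.real 13 (σ.nat v 0) + σ.real C (σ.nat v 0)) 1 _ rfl
    simpa [chain, h0, hK, Corner.map, shear] using this
  · have := key 1 (σ.real M (σ.nat 24 0 - 1)) 0 _ rfl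
    simpa [chain, h0, hK.not_gt, Corner.map, shear] using this

end RealRAM

/-! ### Tracing the regions of a strip -/

namespace RealRAM

/-- Started in `σ`, the program `P` halts in a state satisfying `Q`. For programs without loops, the
running time need not be tracked, by `Halts.ends`. -/
def Halts (P : Prog) (σ : State) (Q : State → Prop) : Prop := ∃ t τ, Runs P σ t τ ∧ Q τ

theorem Ends.halts {P : Prog} {σ : State} {T : ℕ} {Q : State → Prop} (h : Ends P σ T Q) :
    Halts P σ Q := by
  obtain ⟨t, τ, hr, -, hQ⟩ := h
  exact ⟨t, τ, hr, hQ⟩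

theorem Halts.mono {P : Prog} {σ : State} {Q Q' : State → Prop} (h : Halts P σ Q)
    (hQ : ∀ τ, Q τ → Q' τ) : Halts P σ Q' := by
  obtain ⟨t, τ, hr, h⟩ := h
  exact ⟨t, τ, hr, hQ τ h⟩

theorem Halts.seq {P P' : Prog} {σ : State} {R Q : State → Prop} (h : Halts P σ R)
    (h' : ∀ τ, R τ → Halts P' τ Q) : Halts (.seq P P') σ Q := by
  obtain ⟨s, τ, hr, hR⟩ := h
  obtain ⟨t, υ, hr', hQ⟩ := h' τ hR
  exact ⟨s + t, υ, .seq hr hr', hQ⟩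

theorem Halts.ite {b : Test} {P P' : Prog} {σ : State} {Q : State → Prop}
    (h : b.Holds σ → Halts P σ Q) (h' : ¬ b.Holds σ → Halts P' σ Q) :
    Halts (.ite b P P') σ Q := by
  by_cases hb : b.Holds σ
  · obtain ⟨t, τ, hr, hQ⟩ := h hb
    exact ⟨_, τ, .ite_true _ hb hr, hQ⟩
  · obtain ⟨t, τ, hr, hQ⟩ := h' hb
    exact ⟨_, τ, .ite_false _ hb hr, hQ⟩

theorem Runs.le_bound {P : Prog} {σ τ : State} {t : ℕ} (h : Runs P σ t τ)
    (hs : P.straight = true) : t ≤ P.bound := by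
  induction h with
  | skip => simp
  | setNat => simp
  | setReal => simp
  | seq _ _ h₁ h₂ =>
    simp only [Prog.straight, Bool.and_eq_true] at hs
    exact add_le_add (h₁ hs.1) (h₂ hs.2)
  | ite_true _ _ _ h =>
    simp only [Prog.straight, Bool.and_eq_true] at hs
    have := h hs.1
    simp only [Prog.bound]
    omega
  | ite_false _ _ _ h =>
    simp only [Prog.straight, Bool.and_eq_true] at hs
    have := h hs.2
    simp only [Prog.bound]
    omega
  | while_false => simp [Prog.straight] at hs
  | while_true => simp [Prog.straight] at hs

theorem Halts.ends {P : Prog} {σ : State} {Q : State → Prop} (h : Halts P σ Q)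
    (hs : P.straight = true) : Ends P σ P.bound Q := by
  obtain ⟨t, τ, hr, hQ⟩ := h
  exact ⟨t, τ, hr, hr.le_bound hs, hQ⟩

/-- The strip `S`, the signs `w` of its cells and the slope `s` are stored in the memory. -/
structure Loaded (S : Strip) (w : ℕ → ℕ) (s : ℝ) (σ : State) : Prop where
  K : σ.nat vK 0 = S.K
  e : σ.real aE = S.e
  um : σ.real aGM = S.um
  uc : σ.real aGC = S.uc
  lm : σ.real aFM = S.lm
  lc : σ.real aFC = S.lc
  w : σ.nat aW = w
  s : σ.real vS 0 = s

/-- The arrays of natural numbers used for the output. -/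
def traceNats : List ℕ := [0, 1, 2, vPos, vStart, vFirst, vI, vJ]

theorem Loaded.congr {S : Strip} {w : ℕ → ℕ} {s : ℝ} {σ τ : State} (h : Loaded S w s σ)
    (hf : Frame traceNats [0, 1] σ τ) : Loaded S w s τ := by
  obtain ⟨e1, e2, e3, e4, e5, e6, e7, e8⟩ := h
  constructor
  · rwa [hf.nat vK (by simp [traceNats])]
  · rwa [hf.real aE (by simp)]
  · rwa [hf.real aGM (by simp)]
  · rwa [hf.real aGC (by simp)]
  · rwa [hf.real aFM (by simp)]
  · rwa [hf.real aFC (by simp)]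
  · rwa [hf.nat aW (by simp [traceNats])]
  · rwa [hf.real vS (by simp)]

/-- Write corner `v` of `U`. -/
abbrev emitLower (v : ℕ) : Prog := emit aGM aGC v
/-- Write corner `v` of `L`. -/
abbrev emitUpper (v : ℕ) : Prog := emit aFM aFC v

/-! The values of `U` and `L` at the right end of the current cell. -/

abbrev cellU : RExp :=
  .get aGM (nv vJ +ₙ one) *ᵣ .get aE (nv vJ +ₙ one) +ᵣ .get aGC (nv vJ +ₙ one)
abbrev cellL : RExp :=
  .get aFM (nv vJ +ₙ one) *ᵣ .get aE (nv vJ +ₙ one) +ᵣ .get aFC (nv vJ +ₙ one)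

/-- Two real numbers are different. -/
abbrev Test.ne (x y : RExp) : Test := .or (x <ᵣ y) (y <ᵣ x)

/-- The run extends to the next cell. -/
abbrev contTest : Test := .and (nv vJ +ₙ one <ₙ nv vK) (cellU <ᵣ cellL)

/-- Go to the next cell, and write the kink of `U` in between, if there is one. -/
def lowerBody : Prog :=
  setN vJ (nv vJ +ₙ one) ;;
  .ite (.ne (.get aGM (nv vJ -ₙ one)) (.get aGM (nv vJ))) (emitLower vJ) .skip

def runStart : Prog := setN vFirst (nv vJ) ;; emitLower vJ

/-- Write the right end of a run. -/
def runEnd : Prog :=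
  setN vJ (nv vJ +ₙ one) ;; setN vI (nv vJ) ;; emitLower vJ ;;
  .ite (.and (.not (nv vJ <ₙ nv vK)) (.ne (.get aGM (nv vJ -ₙ one)) (.get aFM (nv vJ -ₙ one))))
    (emitUpper vJ) .skip

/-- Go to the previous cell, and write the kink of `L` in between, if there is one. -/
def upperBody : Prog :=
  setN vI (nv vI -ₙ one) ;;
  .ite (.ne (.get aFM (nv vI -ₙ one)) (.get aFM (nv vI))) (emitUpper vI) .skip

/-- Write the left end of `L`, if it is unbounded and different from that of `U`. -/
def runFinish : Prog :=
  .ite (.and (nv vFirst <ₙ one) (.ne (.get aGM (.const 0)) (.get aFM (.const 0))))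
    (setN vI (.const 0) ;; emitUpper vI) .skip ;; finish

/-- Write the region that starts with the current cell. -/
def traceRun : Prog :=
  runStart ;; .while contTest lowerBody ;; runEnd ;;
  .while (nv vFirst +ₙ one <ₙ nv vI) upperBody ;; runFinish

/-- Skip a cell; if its right end is an isolated point, then write it. -/
def traceGap : Prog :=
  .ite (.and (nv vJ +ₙ one <ₙ nv vK) (.not (cellL <ᵣ cellU)))
    (setN vJ (nv vJ +ₙ one) ;; emitLower vJ ;; finish) (setN vJ (nv vJ +ₙ one))

def traceInit : Prog :=
  setN 0 (.const 0) ;; setN vPos (.const 0) ;; setN vStart (.const 0) ;; setN vJ (.const 0)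

/-- Write all regions. -/
def trace : Prog :=
  traceInit ;; .while (nv vJ <ₙ nv vK) (.ite (.get aW (nv vJ) <ₙ one) traceRun traceGap)

/-- The regions `Ls` and the corners `l` have been written in the original coordinates. -/
abbrev Traced (s : ℝ) (σ : State) (Ls : List (List Corner)) (l : List Corner) : Prop :=
  Output σ (Ls.map (List.map (Corner.map (shear s)))) (l.map (Corner.map (shear s)))

section trace

variable {S : Strip} {w : ℕ → ℕ} {s : ℝ} {σ : State} {Ls : List (List Corner)}
  {l : List Corner} {a b : ℕ}

theorem holds_ne (x y : RExp) : (Test.ne x y).Holds σ ↔ x.eval σ ≠ y.eval σ := by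
  rw [Test.holds_or]
  exact lt_or_lt_iff_ne

theorem wp_emitLower {v : ℕ} (hl : Loaded S w s σ) (h : Traced s σ Ls l) :
    wp (emitLower v) (fun τ => Traced s τ Ls (l ++ [S.lower (σ.nat v 0)])) σ := by
  have := wp_emit (M := aGM) (C := aGC) (v := v) (by simp) (by simp) h
  rw [hl.K, hl.e, hl.um, hl.uc, hl.s] at this
  simp only [Traced, List.map_append]
  exact this

theorem wp_emitUpper {v : ℕ} (hl : Loaded S w s σ) (h : Traced s σ Ls l) :
    wp (emitUpper v) (fun τ => Traced s τ Ls (l ++ [S.upper (σ.nat v 0)])) σ := by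
  have := wp_emit (M := aFM) (C := aFC) (v := v) (by simp) (by simp) h
  rw [hl.K, hl.e, hl.lm, hl.lc, hl.s] at this
  simp only [Traced, List.map_append]
  exact this

theorem frame_emit {M C v : ℕ} {Q : State → Prop} (h : wp (emit M C v) Q σ) :
    Halts (emit M C v) σ fun τ => Q τ ∧ Frame [2, vPos] [0, 1] σ τ :=
  (Ends.of_wp h).frame.halts.mono fun _ h =>
    ⟨h.1, h.2.weaken (by simp [emit, write]) (by simp [emit, write])⟩

theorem halts_emitIf {M C v j : ℕ} {T : Test} {P : Prop} [Decidable P] {f : ℕ → Corner}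
    (hT : T.Holds σ ↔ P) (hO : Traced s σ Ls l)
    (hf : wp (emit M C v) (fun τ => Traced s τ Ls (l ++ [f j])) σ) :
    Halts (.ite T (emit M C v) .skip) σ (fun τ =>
      Traced s τ Ls (l ++ (if P then [j] else []).map f) ∧ Frame [2, vPos] [0, 1] σ τ) := by
  refine Halts.ite (fun h => ?_) (fun h => ?_)
  · rw [if_pos (hT.1 h)]
    exact frame_emit hf
  · rw [if_neg fun h' => h (hT.2 h')]
    exact ⟨_, σ, .skip σ, by simpa using hO, .refl _ _ _⟩

theorem holds_contTest (hl : Loaded S w s σ) : contTest.Holds σ ↔ σ.nat vJ 0 + 1 < S.K ∧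
    S.U (S.e (σ.nat vJ 0 + 1)) < S.L (S.e (σ.nat vJ 0 + 1)) := by
  obtain ⟨e1, e2, e3, e4, e5, e6, e7, e8⟩ := hl
  simp only [vK, vJ, aE, aGM, aGC, aFM, aFC] at *
  simp [e1, e2, e3, e4, e5, e6]
  intro h
  rw [S.plU.eval _ (Nat.zero_le _) h _ (fun _ => le_rfl)
      (fun h' => (S.plU.mono _ (Nat.succ_pos _) h').le) fun _ => trivial,
    S.plL.eval _ (Nat.zero_le _) h _ (fun _ => le_rfl)
      (fun h' => (S.plU.mono _ (Nat.succ_pos _) h').le) fun _ => trivial]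

/-- The invariant of the loop over the lower corners. -/
structure LowerInv (S : Strip) (s : ℝ) (Ls : List (List Corner)) (a b : ℕ) (τ : State) :
    Prop where
  first : τ.nat vFirst 0 = a
  le : a ≤ τ.nat vJ 0
  le' : τ.nat vJ 0 ≤ b
  out : Traced s τ Ls ((a :: kinks S.um (a + 1) (τ.nat vJ 0 - a)).map S.lower)

/-- The invariant of the loop over the upper corners. -/
structure UpperInv (S : Strip) (s : ℝ) (Ls : List (List Corner)) (a b : ℕ) (τ : State) :
    Prop where
  first : τ.nat vFirst 0 = a
  cur : τ.nat vJ 0 = b + 1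
  lt : a < τ.nat vI 0
  le : τ.nat vI 0 ≤ b + 1
  out : Traced s τ Ls ((S.lowerIdx a b).map S.lower ++
    (kinks S.lm (τ.nat vI 0) (b + 1 - τ.nat vI 0) ++
      (if b + 1 = S.K ∧ S.um b ≠ S.lm b then [b + 1] else [])).reverse.map S.upper)

theorem traced_congr {τ : State} (h : Traced s σ Ls l)
    (hf : Frame [vFirst, vI, vJ] [] σ τ) : Traced s τ Ls l :=
  h.congr (hf.nat 0 (by simp)) (hf.nat 1 (by simp)) (hf.nat 2 (by simp)) (hf.nat vPos (by simp))
    (hf.nat vStart (by simp)) (hf.real 0 (by simp)) (hf.real 1 (by simp))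

theorem frame_setN (v : ℕ) (x : ℕ) : Frame [v] [] σ (σ.setNat v 0 x) :=
  ⟨fun a ha => by simp at ha; simp [ha], fun a ha => by simp⟩

theorem halts_setN {v : ℕ} {x : NExp} : Halts (setN v x) σ fun τ =>
    τ.nat v 0 = x.eval σ ∧ Frame [v] [] σ τ :=
  ⟨_, _, .setNat _ _ _ σ, by simp, frame_setN v _⟩

theorem ends_runStart (hl : Loaded S w s σ) (hO : Traced s σ Ls []) (hJ : σ.nat vJ 0 = a)
    (hab : a ≤ b) : Ends runStart σ runStart.bound fun τ => LowerInv S s Ls a b τ := by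
  refine (halts_setN.seq fun τ ⟨h1, h2⟩ => ?_).ends rfl
  have hl' : Loaded S w s τ := hl.congr (h2.weaken (by simp [traceNats]) (by simp))
  have hO' := traced_congr hO (h2.weaken (by simp) (by simp))
  refine (frame_emit (wp_emitLower hl' hO')).mono fun υ ⟨h3, h4⟩ => ?_
  have g1 : υ.nat vFirst 0 = a := by
    rw [h4.nat vFirst (by simp), h1]
    exact hJ
  have g2 : τ.nat vJ 0 = a := by rw [h2.nat vJ (by simp), hJ]
  have g3 : υ.nat vJ 0 = a := by rw [h4.nat vJ (by simp), g2]
  refine ⟨g1, g3.ge, g3.trans_le hab, ?_⟩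
  rw [g2] at h3
  simpa [g3, kinks_zero] using h3

theorem ends_lowerBody (hl : Loaded S w s σ) (h : LowerInv S s Ls a b σ)
    (hlt : σ.nat vJ 0 < b) : Ends lowerBody σ lowerBody.bound fun τ =>
      LowerInv S s Ls a b τ ∧ τ.nat vJ 0 = σ.nat vJ 0 + 1 := by
  obtain ⟨i1, i2, i3, i4⟩ := h
  refine (halts_setN.seq fun τ ⟨h1, h2⟩ => ?_).ends rfl
  · have hl' : Loaded S w s τ := hl.congr (h2.weaken (by simp [traceNats]) (by simp))
    have hO' := traced_congr i4 (h2.weaken (by simp) (by simp))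
    have hJ : τ.nat vJ 0 = σ.nat vJ 0 + 1 := h1
    refine (halts_emitIf (P := S.um (σ.nat vJ 0) ≠ S.um (σ.nat vJ 0 + 1)) ?_ hO'
      (wp_emitLower hl' hO')).mono fun υ ⟨h3, h4⟩ => ?_
    · rw [holds_ne]
      simp only [RExp.eval, NExp.eval, hl'.um]
      rw [hJ, Nat.add_sub_cancel]
    have g1 : υ.nat vJ 0 = σ.nat vJ 0 + 1 := by rw [h4.nat vJ (by simp), hJ]
    refine ⟨⟨?_, by omega, by omega, ?_⟩, g1⟩
    · rw [h4.nat vFirst (by simp), h2.nat vFirst (by simp), i1]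
    · rw [g1, show σ.nat vJ 0 + 1 - a = (σ.nat vJ 0 - a) + 1 by omega, kinks_succ,
        show a + 1 + (σ.nat vJ 0 - a) = σ.nat vJ 0 + 1 by omega, Nat.add_sub_cancel]
      rw [hJ] at h3
      simpa using h3

theorem ends_runEnd (hl : Loaded S w s σ) (h : LowerInv S s Ls a b σ) (hb : b < S.K)
    (hJ : σ.nat vJ 0 = b) : Ends runEnd σ runEnd.bound fun τ =>
      UpperInv S s Ls a b τ ∧ τ.nat vI 0 = b + 1 := by
  obtain ⟨i1, i2, i3, i4⟩ := h
  rw [hJ] at i4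
  refine (halts_setN.seq fun τ ⟨h1, h2⟩ => halts_setN.seq fun υ ⟨h3, h4⟩ => ?_).ends rfl
  · have fr : Frame [vFirst, vI, vJ] [] σ υ :=
      (h2.weaken (by simp) (by simp)).trans (h4.weaken (by simp) (by simp))
    have hl' : Loaded S w s υ := hl.congr (fr.weaken (by simp [traceNats]) (by simp))
    have hO' := traced_congr i4 fr
    have hJ1 : τ.nat vJ 0 = b + 1 := h1.trans (by simp only [NExp.eval]; rw [hJ])
    have hJ2 : υ.nat vJ 0 = b + 1 := by rw [h4.nat vJ (by simp), hJ1]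
    have hI2 : υ.nat vI 0 = b + 1 := h3.trans hJ1
    have hF2 : υ.nat vFirst 0 = a := by
      rw [h4.nat vFirst (by simp), h2.nat vFirst (by simp), i1]
    refine (frame_emit (wp_emitLower hl' hO')).seq fun ω ⟨h5, h6⟩ => ?_
    · have hl'' : Loaded S w s ω := hl'.congr (h6.weaken (by simp [traceNats]) (by simp))
      have hJ3 : ω.nat vJ 0 = b + 1 := by rw [h6.nat vJ (by simp), hJ2]
      rw [hJ2] at h5
      refine (halts_emitIf (P := b + 1 = S.K ∧ S.um b ≠ S.lm b) ?_ h5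
        (wp_emitUpper hl'' h5)).mono fun χ ⟨h7, h8⟩ => ?_
      · have hK : ω.nat vK 0 = S.K := hl''.K
        rw [Test.Holds, holds_ne]
        simp only [Test.Holds, RExp.eval, NExp.eval, hl''.um, hl''.lm]
        rw [hJ3, hK, Nat.add_sub_cancel]
        exact and_congr (by omega) Iff.rfl
      · have hI4 : χ.nat vI 0 = b + 1 := by rw [h8.nat vI (by simp), h6.nat vI (by simp), hI2]
        refine ⟨⟨?_, ?_, by omega, hI4.le, ?_⟩, hI4⟩
        · rw [h8.nat vFirst (by simp), h6.nat vFirst (by simp), hF2]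
        · rw [h8.nat vJ (by simp), hJ3]
        · rw [hJ3] at h7
          rw [hI4, Nat.sub_self, kinks_zero, Strip.lowerIdx]
          convert h7 using 1
          split_ifs <;> simp

theorem ends_upperBody (hl : Loaded S w s σ) (h : UpperInv S s Ls a b σ)
    (hlt : a + 1 < σ.nat vI 0) : Ends upperBody σ upperBody.bound fun τ =>
      UpperInv S s Ls a b τ ∧ τ.nat vI 0 = σ.nat vI 0 - 1 := by
  obtain ⟨i1, i2, i3, i4, i5⟩ := h
  refine (halts_setN.seq fun τ ⟨h1, h2⟩ => ?_).ends rfl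
  · have hl' : Loaded S w s τ := hl.congr (h2.weaken (by simp [traceNats]) (by simp))
    have hO' := traced_congr i5 (h2.weaken (by simp) (by simp))
    have hI : τ.nat vI 0 = σ.nat vI 0 - 1 := h1
    refine (halts_emitIf (P := S.lm (τ.nat vI 0 - 1) ≠ S.lm (τ.nat vI 0)) ?_ hO'
      (wp_emitUpper hl' hO')).mono fun υ ⟨h3, h4⟩ => ?_
    · rw [holds_ne]
      simp only [RExp.eval, NExp.eval, hl'.lm]
    have g1 : υ.nat vI 0 = τ.nat vI 0 := by rw [h4.nat vI (by simp)]
    refine ⟨⟨?_, ?_, by omega, by omega, ?_⟩, by omega⟩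
    · rw [h4.nat vFirst (by simp), h2.nat vFirst (by simp), i1]
    · rw [h4.nat vJ (by simp), h2.nat vJ (by simp), i2]
    · rw [g1, show b + 1 - τ.nat vI 0 = (b + 1 - σ.nat vI 0) + 1 by omega, kinks_succ',
        show τ.nat vI 0 + 1 = σ.nat vI 0 by omega]
      convert h3 using 1
      split_ifs <;> simp

theorem ends_runFinish (hl : Loaded S w s σ) (h : UpperInv S s Ls a b σ)
    (hI : σ.nat vI 0 = a + 1) : Ends runFinish σ runFinish.bound fun τ =>
      Traced s τ (Ls ++ [S.poly a b]) [] ∧ τ.nat vJ 0 = b + 1 := by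
  obtain ⟨i1, i2, i3, i4, i5⟩ := h
  rw [hI] at i5
  have test : (Test.and (nv vFirst <ₙ one)
      (.ne (.get aGM (.const 0)) (.get aFM (.const 0)))).Holds σ ↔ a = 0 ∧ S.um 0 ≠ S.lm 0 := by
    rw [Test.Holds, holds_ne]
    simp only [Test.Holds, RExp.eval, NExp.eval, hl.um, hl.lm, i1]
    simp
  have fin : ∀ {τ : State} {l}, Traced s τ Ls l → τ.nat vJ 0 = b + 1 →
      l = S.poly a b → Halts finish τ fun υ =>
        Traced s υ (Ls ++ [S.poly a b]) [] ∧ υ.nat vJ 0 = b + 1 := by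
    rintro τ _ h1 h2 rfl
    refine (Ends.of_wp (wp_finish h1)).frame.halts.mono fun υ ⟨h3, h4⟩ => ⟨?_, ?_⟩
    · simpa only [Traced, List.map_append, List.map_cons, List.map_nil] using h3
    · rw [h4.nat vJ (by simp [finish]), h2]
  have hpoly : S.poly a b = ((S.lowerIdx a b).map S.lower ++
      (kinks S.lm (a + 1) (b + 1 - (a + 1)) ++
      (if b + 1 = S.K ∧ S.um b ≠ S.lm b then [b + 1] else [])).reverse.map S.upper) ++
      (if a = 0 ∧ S.um 0 ≠ S.lm 0 then [0] else []).map S.upper := by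
    rw [Strip.poly, Strip.upperIdx, Nat.add_sub_add_right]
    split_ifs <;> simp
  refine ((Halts.ite (Q := fun τ => Traced s τ Ls (S.poly a b) ∧ τ.nat vJ 0 = b + 1)
    (fun hT => ?_) fun hT => ?_).seq fun τ ⟨h1, h2⟩ => fin h1 h2 rfl).ends rfl
  · have hT := test.1 hT
    refine halts_setN.seq fun τ ⟨h1, h2⟩ => ?_
    have hl' : Loaded S w s τ := hl.congr (h2.weaken (by simp [traceNats]) (by simp))
    have hO' := traced_congr i5 (h2.weaken (by simp) (by simp))
    refine (frame_emit (wp_emitUpper hl' hO')).mono fun υ ⟨h3, h4⟩ => ⟨?_, ?_⟩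
    · rw [hpoly, if_pos hT]
      rw [h1] at h3
      exact h3
    · rw [h4.nat vJ (by simp), h2.nat vJ (by simp), i2]
  · refine ⟨_, σ, .skip σ, ?_, i2⟩
    rw [hpoly, if_neg fun h => hT (test.2 h)]
    simpa using i5

theorem frame_traceNats {P : Prog} {Q : State → Prop} {T : ℕ} (h : Ends P σ T Q)
    (h1 : P.natWrites ⊆ traceNats) (h2 : P.realWrites ⊆ [0, 1]) :
    Ends P σ T fun τ => Q τ ∧ Frame traceNats [0, 1] σ τ :=
  h.frame.mono le_rfl fun _ h => ⟨h.1, h.2.weaken h1 h2⟩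

abbrev upperTest : Test := nv vFirst +ₙ one <ₙ nv vI

/-- The cost of tracing a region, per cell. -/
def runCost : ℕ := runStart.bound + 2 * contTest.cost + lowerBody.bound + runEnd.bound +
  2 * upperTest.cost + upperBody.bound + runFinish.bound

theorem ends_lowerLoop (hl : Loaded S w s σ) (h : LowerInv S s Ls a b σ) (hb : b < S.K)
    (hJ : σ.nat vJ 0 = a) (hpos : ∀ k, a < k → k ≤ b → S.U (S.e k) < S.L (S.e k))
    (hr : b + 1 < S.K → ¬ S.U (S.e (b + 1)) < S.L (S.e (b + 1))) :
    Ends (.while contTest lowerBody) σ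
      ((contTest.cost + lowerBody.bound) * (b - a) + contTest.cost)
      fun τ => LowerInv S s Ls a b τ ∧ τ.nat vJ 0 = b := by
  have sub1 : lowerBody.natWrites ⊆ traceNats := by simp [lowerBody, emit, write, traceNats]
  have sub2 : lowerBody.realWrites ⊆ [0, 1] := by simp [lowerBody, emit, write]
  refine (Ends.while (LowerInv S s Ls a b)
    (fun υ => (contTest.cost + lowerBody.bound) * (b - υ.nat vJ 0)) h
    fun υ hI hf hc => ⟨lowerBody.bound, ?_⟩).mono (by rw [hJ]) fun υ ⟨hI, hc, hf⟩ => ?_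
  · have hl' := hl.congr (hf.weaken sub1 sub2)
    have hc := (holds_contTest hl').1 hc
    have hlt : υ.nat vJ 0 < b := by
      refine hI.le'.lt_of_ne fun heq => ?_
      rw [heq] at hc
      exact hr hc.1 hc.2
    refine (ends_lowerBody hl' hI hlt).mono le_rfl fun ω ⟨h1, h2⟩ => ⟨h1, ?_⟩
    rw [h2]
    obtain ⟨d, hd⟩ : ∃ d, b - υ.nat vJ 0 = d + 1 := ⟨b - υ.nat vJ 0 - 1, by omega⟩
    rw [show b - (υ.nat vJ 0 + 1) = d by omega, hd, mul_add, mul_one]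
    exact (Nat.add_comm _ _).le
  · have hl' := hl.congr (hf.weaken sub1 sub2)
    rw [holds_contTest hl'] at hc
    refine ⟨hI, hI.le'.eq_or_lt.resolve_right fun hlt => hc ⟨by omega, ?_⟩⟩
    have := hI.le
    exact hpos _ (by omega) hlt

theorem ends_upperLoop (hl : Loaded S w s σ) (h : UpperInv S s Ls a b σ)
    (hI : σ.nat vI 0 = b + 1) :
    Ends (.while upperTest upperBody) σ
      ((upperTest.cost + upperBody.bound) * (b - a) + upperTest.cost)
      fun τ => UpperInv S s Ls a b τ ∧ τ.nat vI 0 = a + 1 := by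
  have sub1 : upperBody.natWrites ⊆ traceNats := by simp [upperBody, emit, write, traceNats]
  have sub2 : upperBody.realWrites ⊆ [0, 1] := by simp [upperBody, emit, write]
  refine (Ends.while (UpperInv S s Ls a b)
    (fun υ => (upperTest.cost + upperBody.bound) * (υ.nat vI 0 - (a + 1))) h
    fun υ hI hf hc => ⟨upperBody.bound, ?_⟩).mono (by rw [hI, Nat.add_sub_add_right])
    fun υ ⟨hI, hc, hf⟩ => ?_
  · have hl' := hl.congr (hf.weaken sub1 sub2)
    have hc : υ.nat vFirst 0 + 1 < υ.nat vI 0 := hc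
    rw [hI.first] at hc
    refine (ends_upperBody hl' hI hc).mono le_rfl fun ω ⟨h1, h2⟩ => ⟨h1, ?_⟩
    rw [h2]
    obtain ⟨d, hd⟩ : ∃ d, υ.nat vI 0 - (a + 1) = d + 1 := ⟨υ.nat vI 0 - (a + 1) - 1, by omega⟩
    rw [show υ.nat vI 0 - 1 - (a + 1) = d by omega, hd, mul_add, mul_one]
    exact (Nat.add_comm _ _).le
  · have hc : ¬ υ.nat vFirst 0 + 1 < υ.nat vI 0 := hc
    have h1 := hI.lt
    rw [hI.first] at hc
    exact ⟨hI, by omega⟩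

theorem ends_traceRun (hl : Loaded S w s σ) (hO : Traced s σ Ls []) (hJ : σ.nat vJ 0 = a)
    (hab : a ≤ b) (hb : b < S.K) (hpos : ∀ k, a < k → k ≤ b → S.U (S.e k) < S.L (S.e k))
    (hr : b + 1 < S.K → ¬ S.U (S.e (b + 1)) < S.L (S.e (b + 1))) :
    Ends traceRun σ (runCost * (b + 1 - a)) fun τ =>
      Traced s τ (Ls ++ [S.poly a b]) [] ∧ τ.nat vJ 0 = b + 1 := by
  have h0 : Ends runStart σ runStart.bound fun τ => (LowerInv S s Ls a b τ ∧ τ.nat vJ 0 = a) ∧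
      Frame traceNats [0, 1] σ τ := by
    refine frame_traceNats ((ends_runStart hl hO hJ hab).frame.mono le_rfl fun τ ⟨h1, h2⟩ =>
      ⟨h1, ?_⟩) (by simp [runStart, emit, write, traceNats]) (by simp [runStart, emit, write])
    rw [h2.nat vJ (by simp [runStart, emit, write]), hJ]
  refine (h0.seq (t := ((contTest.cost + lowerBody.bound) * (b - a) + contTest.cost) +
    (runEnd.bound + (((upperTest.cost + upperBody.bound) * (b - a) + upperTest.cost) +
    runFinish.bound))) fun τ ⟨⟨h1, h1'⟩, h2⟩ => ?_).mono ?_ fun _ h => h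
  · have hl1 := hl.congr h2
    refine (frame_traceNats (ends_lowerLoop hl1 h1 hb h1' hpos hr)
      (by simp [lowerBody, emit, write, traceNats]) (by simp [lowerBody, emit, write])).seq
      fun υ ⟨⟨h3, h3'⟩, h4⟩ => ?_
    have hl2 := hl1.congr h4
    refine (frame_traceNats (ends_runEnd hl2 h3 hb h3')
      (by simp [runEnd, emit, write, traceNats]) (by simp [runEnd, emit, write])).seq
      fun ω ⟨⟨h5, h5'⟩, h6⟩ => ?_
    have hl3 := hl2.congr h6
    refine (frame_traceNats (ends_upperLoop hl3 h5 h5')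
      (by simp [upperBody, emit, write, traceNats]) (by simp [upperBody, emit, write])).seq
      fun χ ⟨⟨h7, h7'⟩, h8⟩ => ?_
    exact ends_runFinish (hl3.congr h8) h7 h7'
  · have : runCost = runStart.bound + 2 * contTest.cost + lowerBody.bound + runEnd.bound +
      2 * upperTest.cost + upperBody.bound + runFinish.bound := rfl
    rw [this, show b + 1 - a = (b - a) + 1 by omega]
    generalize runStart.bound = c₁
    generalize contTest.cost = c₂
    generalize lowerBody.bound = c₃
    generalize runEnd.bound = c₄
    generalize upperTest.cost = c₅
    generalize upperBody.bound = c₆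
    generalize runFinish.bound = c₇
    generalize b - a = d
    have : (c₁ + 2 * c₂ + c₃ + c₄ + 2 * c₅ + c₆ + c₇) * (d + 1) =
        c₁ + ((c₂ + c₃) * d + c₂ + (c₄ + ((c₅ + c₆) * d + c₅ + c₇))) +
        ((c₁ + c₂ + c₄ + c₅ + c₇) * d + c₂ + c₃ + c₅ + c₆) := by ring
    omega

theorem holds_gapTest (hl : Loaded S w s σ) :
    (Test.and (nv vJ +ₙ one <ₙ nv vK) (.not (cellL <ᵣ cellU))).Holds σ ↔
    σ.nat vJ 0 + 1 < S.K ∧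
    S.U (S.e (σ.nat vJ 0 + 1)) ≤ S.L (S.e (σ.nat vJ 0 + 1)) := by
  obtain ⟨e1, e2, e3, e4, e5, e6, e7, e8⟩ := hl
  simp only [vK, vJ, aE, aGM, aGC, aFM, aFC] at *
  simp [e1, e2, e3, e4, e5, e6]
  intro h
  rw [S.plU.eval _ (Nat.zero_le _) h _ (fun _ => le_rfl)
      (fun h' => (S.plU.mono _ (Nat.succ_pos _) h').le) fun _ => trivial,
    S.plL.eval _ (Nat.zero_le _) h _ (fun _ => le_rfl)
      (fun h' => (S.plU.mono _ (Nat.succ_pos _) h').le) fun _ => trivial]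

/-- The invariant of the sweep: the regions over the cells before the current one have been written,
and the strip has at most one point at the start of the current cell. -/
structure TraceInv (S : Strip) (s : ℝ) (τ : State) : Prop where
  le : τ.nat vJ 0 ≤ S.K
  head : 0 < τ.nat vJ 0 → τ.nat vJ 0 < S.K →
    S.L (S.e (τ.nat vJ 0)) ≤ S.U (S.e (τ.nat vJ 0))
  out : ∃ Ls, Describes Ls (S.upTo (τ.nat vJ 0)) ∧ Traced s τ Ls []

theorem ends_traceGap (hl : Loaded S w s σ) (h : TraceInv S s σ)
    (hw : SignsTo S.K w S.e (fun _ => True) S.L S.U) (hK : σ.nat vJ 0 < S.K)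
    (hne : w (σ.nat vJ 0) ≠ 0) :
    Ends traceGap σ traceGap.bound fun τ => TraceInv S s τ ∧
      τ.nat vJ 0 = σ.nat vJ 0 + 1 := by
  obtain ⟨i1, i2, Ls, i3, i4⟩ := h
  have gap := Strip.gap_of_ne hw hK hne
  have head : ∀ k, k = σ.nat vJ 0 + 1 → k < S.K → S.L (S.e k) ≤ S.U (S.e k) := by
    rintro k rfl h
    exact Strip.le_of_ne hw h hne
  refine (Halts.ite (fun hT => ?_) fun hT => ?_).ends rfl
  · rw [holds_gapTest hl] at hT
    refine halts_setN.seq fun τ ⟨h1, h2⟩ => ?_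
    have h1 : τ.nat vJ 0 = σ.nat vJ 0 + 1 := h1
    have hl' : Loaded S w s τ := hl.congr (h2.weaken (by simp [traceNats]) (by simp))
    have hO' := traced_congr i4 (h2.weaken (by simp) (by simp))
    refine (frame_emit (wp_emitLower hl' hO')).seq fun υ ⟨h3, h4⟩ => ?_
    refine (Ends.of_wp (wp_finish h3)).frame.halts.mono fun ω ⟨h5, h6⟩ => ?_
    have hJ : ω.nat vJ 0 = σ.nat vJ 0 + 1 := by
      rw [h6.nat vJ (by simp [finish]), h4.nat vJ (by simp), h1]
    refine ⟨⟨by omega, fun _ h => head _ hJ h, Ls ++ [[S.lower (σ.nat vJ 0 + 1)]], ?_, ?_⟩, hJ⟩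
    · rw [hJ]
      exact gap.describes_point i3 hT.1 (le_antisymm (head _ rfl hT.1) hT.2)
    · rw [h1] at h5
      simpa only [Traced, List.map_append, List.map_cons, List.map_nil, List.nil_append] using h5
  · rw [holds_gapTest hl] at hT
    refine halts_setN.mono fun τ ⟨h1, h2⟩ => ?_
    have h1 : τ.nat vJ 0 = σ.nat vJ 0 + 1 := h1
    refine ⟨⟨by omega, fun _ h => head _ h1 h, Ls, ?_, ?_⟩, h1⟩
    · rw [h1]
      exact gap.describes i3 fun h => not_le.1 fun h' => hT ⟨h, h'⟩
    · exact traced_congr i4 (h2.weaken (by simp) (by simp))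

/-- The end of the run of cells that starts with cell `a`. -/
theorem exists_run_end (S : Strip) (ha : a < S.K) : ∃ b, a ≤ b ∧ b < S.K ∧
    (∀ k, a < k → k ≤ b → S.U (S.e k) < S.L (S.e k)) ∧
    (b + 1 < S.K → ¬ S.U (S.e (b + 1)) < S.L (S.e (b + 1))) := by
  obtain ⟨d, hd⟩ : ∃ d, S.K = a + d + 1 := ⟨S.K - a - 1, by omega⟩
  induction d generalizing a with
  | zero => exact ⟨a, le_rfl, ha, fun k h1 h2 => by omega, fun h => by omega⟩
  | succ d ih =>
    by_cases h : S.U (S.e (a + 1)) < S.L (S.e (a + 1))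
    · obtain ⟨b, h1, h2, h3, h4⟩ := ih (a := a + 1) (by omega) (by omega)
      refine ⟨b, by omega, h2, fun k h5 h6 => ?_, h4⟩
      rcases (by omega : a + 1 ≤ k).eq_or_lt with rfl | h7
      · exact h
      · exact h3 k h7 h6
    · exact ⟨a, le_rfl, ha, fun k h1 h2 => by omega, fun _ => h⟩

abbrev traceTest : Test := nv vJ <ₙ nv vK
abbrev signTest : Test := .get aW (nv vJ) <ₙ one

/-- The cost of tracing, per cell. -/
def traceCost : ℕ :=
  2 * traceTest.cost + signTest.cost + runCost + traceGap.bound + traceInit.bound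

/-- Tracing writes a description of the strip; `ht` excludes a run over the whole line. -/
theorem ends_trace (hl : Loaded S w s σ) (hw : SignsTo S.K w S.e (fun _ => True) S.L S.U)
    (h2 : 2 ≤ S.K) (ht : ∃ t, S.L t ≤ S.U t) :
    Ends trace σ (traceCost * (S.K + 1)) fun τ => Describes τ.regions (shear s '' S.set) := by
  have sub1 : (Prog.ite signTest traceRun traceGap).natWrites ⊆ traceNats := by decide
  have sub2 : (Prog.ite signTest traceRun traceGap).realWrites ⊆ [0, 1] := by decide
  have init : Ends traceInit σ traceInit.bound fun τ => (TraceInv S s τ ∧ τ.nat vJ 0 = 0) ∧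
        Frame traceNats [0, 1] σ τ := by
    refine frame_traceNats (Ends.of_wp ?_) (by decide) (by decide)
    simp [traceInit]
    refine ⟨by simp, by simp, [], ?_, ?_⟩
    · simpa using S.describes_upTo_zero
    · constructor <;> simp
  refine (init.seq (t := (traceTest.cost + (signTest.cost + runCost + traceGap.bound)) * S.K +
    traceTest.cost) fun τ ⟨⟨h1, h3⟩, h4⟩ => ?_).mono ?_ fun _ h => h
  · have hl1 := hl.congr h4
    refine (Ends.while (TraceInv S s)
      (fun υ => (traceTest.cost + (signTest.cost + runCost + traceGap.bound)) *
        (S.K - υ.nat vJ 0)) h1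
      fun υ hI hf hc => ?_).mono (by rw [h3, Nat.sub_zero]) fun υ ⟨hI, hc, hf⟩ => ?_
    · have hl2 := hl1.congr (hf.weaken sub1 sub2)
      have hK : υ.nat vJ 0 < S.K := by
        have h : υ.nat vJ 0 < υ.nat vK 0 := hc
        rwa [hl2.K] at h
      by_cases hW : w (υ.nat vJ 0) = 0
      · obtain ⟨b, hab, hb, hpos, hr⟩ := exists_run_end S hK
        obtain ⟨Ls, hD, hO⟩ := hI.out
        have run := Strip.run_of_scan hw h2 ht hab hb hW hpos (fun h => hI.head h hK) hr
        refine ⟨signTest.cost + runCost * (b + 1 - υ.nat vJ 0), (Ends.ite (fun _ =>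
          ends_traceRun hl2 hO rfl hab hb hpos hr) fun h => ?_).mono le_rfl fun ω ⟨g1, g2⟩ => ?_⟩
        · exfalso
          refine h ?_
          have := hl2.w
          simp only [aW, vJ] at this hW
          simp [this, hW]
        · refine ⟨⟨by omega, fun _ h => ?_, _, ?_, g1⟩, ?_⟩
          · rw [g2] at h ⊢
            exact (run.right h).ge
          · rw [g2]
            exact run.describes hD
          · rw [g2]
            obtain ⟨d, hd⟩ : ∃ d, b + 1 - υ.nat vJ 0 = d + 1 := ⟨b - υ.nat vJ 0, by omega⟩
            rw [show S.K - υ.nat vJ 0 = (S.K - (b + 1)) + (d + 1) by omega, hd]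
            generalize S.K - (b + 1) = r
            generalize traceTest.cost = c₁
            generalize signTest.cost = c₂
            generalize runCost = c₃
            generalize traceGap.bound = c₄
            nlinarith [Nat.zero_le (c₁ * d), Nat.zero_le (c₂ * d), Nat.zero_le (c₄ * d)]
      · refine ⟨signTest.cost + traceGap.bound, (Ends.ite (fun h => ?_) fun _ =>
          ends_traceGap hl2 hI hw hK hW).mono le_rfl fun ω ⟨g1, g2⟩ => ⟨g1, ?_⟩⟩
        · exfalso
          have := hl2.w
          simp only [aW, vJ] at this hW
          simp [this] at h
          exact hW h
        · rw [g2]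
          obtain ⟨d, hd⟩ : ∃ d, S.K - υ.nat vJ 0 = d + 1 := ⟨S.K - υ.nat vJ 0 - 1, by omega⟩
          rw [show S.K - (υ.nat vJ 0 + 1) = d by omega, hd, mul_add, mul_one]
          have : (nv vJ <ₙ nv vK).cost = traceTest.cost := rfl
          omega
    · have hl2 := hl1.congr (hf.weaken sub1 sub2)
      have hK : ¬ υ.nat vJ 0 < S.K := by
        have h : ¬ υ.nat vJ 0 < υ.nat vK 0 := hc
        rwa [hl2.K] at h
      obtain ⟨h5, h6, Ls, h7, h8⟩ := hI
      rw [h8.regions]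
      rw [show υ.nat vJ 0 = S.K by omega, Strip.upTo_last] at h7
      exact h7.map_shear s
  · have : traceCost = 2 * traceTest.cost + signTest.cost + runCost + traceGap.bound +
      traceInit.bound := rfl
    rw [this]
    generalize traceTest.cost = c₁
    generalize signTest.cost = c₂
    generalize runCost = c₃
    generalize traceGap.bound = c₄
    generalize traceInit.bound = c₅
    nlinarith [Nat.zero_le (c₁ * S.K), Nat.zero_le (c₅ * S.K)]

end trace

end RealRAM

/-! ### Double-wedges -/

open Filter Topology

/-- The vertical distance of a point from the bounding line of a half-plane. -/
def HalfPlane.height (h : HalfPlane) (p : Plane) : ℝ := p.2 - (h.slope * p.1 + h.icpt)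

theorem mem_closure_of_ray {A : Set Plane} {p v : Plane} (h : ∀ t : ℝ, 0 < t → p + t • v ∈ A) :
    p ∈ closure A := by
  have hc : Tendsto (fun t : ℝ => p + t • v) (𝓝[>] 0) (𝓝 p) := by
    have : Continuous fun t : ℝ => p + t • v := by fun_prop
    have := (this.tendsto 0).mono_left (nhdsWithin_le_nhds (s := Set.Ioi 0))
    simpa using this
  exact mem_closure_of_tendsto hc (eventually_mem_nhdsWithin.mono fun t ht => h t ht)

/-- The double-wedge consists of the points at which the two half-planes disagree, in the weak
sense. -/
theorem DoubleWedge.mem_toSet (d : DoubleWedge) (p : Plane) : p ∈ d.toSet ↔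
    ((d.h₁.above = d.h₂.above → d.h₁.height p * d.h₂.height p ≤ 0) ∧
      (d.h₁.above ≠ d.h₂.above → 0 ≤ d.h₁.height p * d.h₂.height p)) := by
  have mem : ∀ (h : HalfPlane) (p : Plane), p ∈ h.toSet ↔
      if h.above = true then 0 ≤ h.height p else h.height p ≤ 0 := by
    intro h p
    simp only [HalfPlane.toSet, HalfPlane.height, Set.mem_ofPred_eq]
    split_ifs <;> simp
  -- moving the two heights independently
  have move : ∀ α β : ℝ, ∃ v : Plane, ∀ t : ℝ,
      d.h₁.height (p + t • v) = d.h₁.height p + t * α ∧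
      d.h₂.height (p + t • v) = d.h₂.height p + t * β := by
    intro α β
    have hne := sub_ne_zero.2 d.not_parallel.symm
    refine ⟨((α - β) / (d.h₂.slope - d.h₁.slope),
      α + d.h₁.slope * ((α - β) / (d.h₂.slope - d.h₁.slope))), fun t => ?_⟩
    have e : (d.h₂.slope - d.h₁.slope) * ((α - β) / (d.h₂.slope - d.h₁.slope)) = α - β :=
      mul_div_cancel₀ _ hne
    simp only [HalfPlane.height, Prod.fst_add, Prod.snd_add, Prod.smul_fst, Prod.smul_snd,
      smul_eq_mul]
    constructor
    · ring
    · linear_combination -t * e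
  have c₁ : Continuous d.h₁.height := by unfold HalfPlane.height; fun_prop
  have c₂ : Continuous d.h₂.height := by unfold HalfPlane.height; fun_prop
  have near : ∀ α β : ℝ, (∀ t : ℝ, 0 < t → ∀ q : Plane,
      d.h₁.height q = d.h₁.height p + t * α → d.h₂.height q = d.h₂.height p + t * β →
        q ∈ symmDiff d.h₁.toSet d.h₂.toSet) → p ∈ d.toSet := by
    intro α β h
    obtain ⟨v, hv⟩ := move α β
    exact mem_closure_of_ray fun t ht => h t ht _ (hv t).1 (hv t).2
  constructor
  · intro hp
    constructor
    · intro hs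
      refine closure_minimal (fun q hq => ?_) (isClosed_le (c₁.mul c₂) continuous_const) hp
      rw [Set.mem_symmDiff, mem, mem, ← hs] at hq
      simp only [Set.mem_ofPred_eq, Pi.mul_apply]
      split_ifs at hq
      · rcases hq with ⟨h1, h2⟩ | ⟨h1, h2⟩ <;> nlinarith
      · rcases hq with ⟨h1, h2⟩ | ⟨h1, h2⟩ <;> nlinarith
    · intro hs
      refine closure_minimal (fun q hq => ?_) (isClosed_le continuous_const (c₁.mul c₂)) hp
      rw [Set.mem_symmDiff, mem, mem] at hq
      simp only [Set.mem_ofPred_eq, Pi.mul_apply]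
      cases h1 : d.h₁.above <;> cases h2 : d.h₂.above <;> simp [h1, h2] at hq hs
      · rcases hq with ⟨h1, h2⟩ | ⟨h1, h2⟩ <;> nlinarith
      · rcases hq with ⟨h1, h2⟩ | ⟨h1, h2⟩ <;> nlinarith
  · rintro ⟨hs, hd⟩
    by_cases h : d.h₁.above = d.h₂.above
    · rcases mul_nonpos_iff.1 (hs h) with ⟨h1, h2⟩ | ⟨h1, h2⟩
      · refine near 1 (-1) fun t ht q e1 e2 => ?_
        rw [Set.mem_symmDiff, mem, mem, ← h, e1, e2]
        split_ifs
        · exact .inl ⟨by linarith, by linarith⟩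
        · exact .inr ⟨by linarith, by linarith⟩
      · refine near (-1) 1 fun t ht q e1 e2 => ?_
        rw [Set.mem_symmDiff, mem, mem, ← h, e1, e2]
        split_ifs
        · exact .inr ⟨by linarith, by linarith⟩
        · exact .inl ⟨by linarith, by linarith⟩
    · rcases mul_nonneg_iff.1 (hd h) with ⟨h1, h2⟩ | ⟨h1, h2⟩
      · refine near 1 1 fun t ht q e1 e2 => ?_
        rw [Set.mem_symmDiff, mem, mem, e1, e2]
        cases h3 : d.h₁.above <;> cases h4 : d.h₂.above <;> simp [h3, h4] at h ⊢
        · exact .inr ⟨by linarith, by linarith⟩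
        · exact .inl ⟨by linarith, by linarith⟩
      · refine near (-1) (-1) fun t ht q e1 e2 => ?_
        rw [Set.mem_symmDiff, mem, mem, e1, e2]
        cases h3 : d.h₁.above <;> cases h4 : d.h₂.above <;> simp [h3, h4] at h ⊢
        · exact .inl ⟨by linarith, by linarith⟩
        · exact .inr ⟨by linarith, by linarith⟩

/-- The crossing point of the two lines. -/
theorem DoubleWedge.exists_apex (d : DoubleWedge) :
    ∃ q : Plane, d.h₁.height q = 0 ∧ d.h₂.height q = 0 := by
  have hne := sub_ne_zero.2 d.not_parallel
  set x := (d.h₂.icpt - d.h₁.icpt) / (d.h₁.slope - d.h₂.slope) with hx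
  have e : (d.h₁.slope - d.h₂.slope) * x = d.h₂.icpt - d.h₁.icpt := mul_div_cancel₀ _ hne
  refine ⟨(x, d.h₁.slope * x + d.h₁.icpt), by simp [HalfPlane.height], ?_⟩
  simp only [HalfPlane.height]
  linarith

theorem uncovered_of_not_covers {ι : Type*} {D : ι → DoubleWedge} {s : ℝ}
    (h : ¬ Covers D (some s : OnePoint ℝ)) (i : ι) :
    Uncovered ((D i).h₁.above = (D i).h₂.above) (D i).h₁.slope (D i).h₂.slope s := by
  obtain ⟨q, h1, h2⟩ := (D i).exists_apex
  have key : ∀ p ∈ lineThrough q (some s : OnePoint ℝ),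
      (D i).h₁.height p * (D i).h₂.height p =
        ((D i).h₁.slope - s) * ((D i).h₂.slope - s) * (p.1 - q.1) ^ 2 := by
    intro p hp
    have hp : p.2 - q.2 = s * (p.1 - q.1) := hp
    simp only [HalfPlane.height] at *
    rw [show p.2 = q.2 + s * (p.1 - q.1) by linarith,
      show q.2 + s * (p.1 - q.1) - ((D i).h₁.slope * p.1 + (D i).h₁.icpt) =
        (s - (D i).h₁.slope) * (p.1 - q.1) by linear_combination h1,
      show q.2 + s * (p.1 - q.1) - ((D i).h₂.slope * p.1 + (D i).h₂.icpt) =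
        (s - (D i).h₂.slope) * (p.1 - q.1) by linear_combination h2]
    ring
  constructor
  · intro hs
    by_contra hle
    refine h ⟨i, q, fun p hp => ((D i).mem_toSet p).2 ⟨fun _ => ?_, fun hd => absurd hs hd⟩⟩
    rw [key p hp]
    exact mul_nonpos_of_nonpos_of_nonneg (not_lt.1 hle) (sq_nonneg _)
  · intro hs
    by_contra hle
    refine h ⟨i, q, fun p hp => ((D i).mem_toSet p).2 ⟨fun hd => absurd hd hs, fun _ => ?_⟩⟩
    rw [key p hp]
    exact mul_nonneg (not_lt.1 hle) (sq_nonneg _)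

/-- If the vertical slope is not covered, then some finite slope is not covered either. -/
theorem exists_uncovered {n : ℕ} {D : Fin n → DoubleWedge} (h : ∃ a : OnePoint ℝ, ¬ Covers D a) :
    ∃ s : ℝ, ∀ i,
      Uncovered ((D i).h₁.above = (D i).h₂.above) (D i).h₁.slope (D i).h₂.slope s := by
  obtain ⟨a | s, h⟩ := h
  · have same : ∀ i, (D i).h₁.above = (D i).h₂.above := by
      intro i
      by_contra hd
      obtain ⟨q, h1, h2⟩ := (D i).exists_apex
      refine h ⟨i, q, fun p hp => ((D i).mem_toSet p).2 ⟨fun hs => absurd hs hd, fun _ => ?_⟩⟩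
      have hp : p.1 = q.1 := hp
      simp only [HalfPlane.height] at *
      rw [hp, show p.2 - ((D i).h₁.slope * q.1 + (D i).h₁.icpt) = p.2 - q.2 by linarith,
        show p.2 - ((D i).h₂.slope * q.1 + (D i).h₂.icpt) = p.2 - q.2 by linarith]
      exact mul_self_nonneg _
    refine ⟨∑ i, (|(D i).h₁.slope| + |(D i).h₂.slope|) + 1, fun i =>
      ⟨fun _ => ?_, fun hd => absurd (same i) hd⟩⟩
    have h1 : |(D i).h₁.slope| + |(D i).h₂.slope| ≤ ∑ i, (|(D i).h₁.slope| + |(D i).h₂.slope|) :=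
      Finset.single_le_sum (f := fun i => |(D i).h₁.slope| + |(D i).h₂.slope|)
        (fun j _ => by positivity) (Finset.mem_univ i)
    have h2 := le_abs_self (D i).h₁.slope
    have h3 := le_abs_self (D i).h₂.slope
    have h4 := abs_nonneg (D i).h₁.slope
    have h5 := abs_nonneg (D i).h₂.slope
    exact mul_pos_of_neg_of_neg (by linarith) (by linarith)
  · exact ⟨s, uncovered_of_not_covers h⟩

/-! ### Double-wedges in sheared coordinates -/

/-- The value at `t` of the line with slope `m` and intercept `c`, in the coordinates of
`shear s`. -/
noncomputable def sheared (s m c t : ℝ) : ℝ := -1 / (m - s) * t + c / (m - s)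

theorem height_shear (s : ℝ) (h : HalfPlane) (hs : h.slope - s ≠ 0) (p : Plane) :
    h.height (shear s p) = (h.slope - s) * (p.2 - sheared s h.slope h.icpt p.1) := by
  simp only [HalfPlane.height, shear, sheared, LinearMap.coe_mk, AddHom.coe_mk]
  field_simp
  ring

theorem Uncovered.ne {same : Prop} {m₁ m₂ s : ℝ} (h : Uncovered same m₁ m₂ s) :
    m₁ - s ≠ 0 ∧ m₂ - s ≠ 0 := by
  have : (m₁ - s) * (m₂ - s) ≠ 0 := by
    by_cases hs : same
    · exact (h.1 hs).ne'
    · exact (h.2 hs).ne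
  exact ⟨left_ne_zero_of_mul this, right_ne_zero_of_mul this⟩

theorem mem_toSet_shear {d : DoubleWedge} {s : ℝ}
    (h : Uncovered (d.h₁.above = d.h₂.above) d.h₁.slope d.h₂.slope s) (p : Plane) :
    shear s p ∈ d.toSet ↔
      min (sheared s d.h₁.slope d.h₁.icpt p.1) (sheared s d.h₂.slope d.h₂.icpt p.1) ≤ p.2 ∧
      p.2 ≤ max (sheared s d.h₁.slope d.h₁.icpt p.1) (sheared s d.h₂.slope d.h₂.icpt p.1) := by
  rw [DoubleWedge.mem_toSet, height_shear s _ h.ne.1, height_shear s _ h.ne.2]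
  set u := sheared s d.h₁.slope d.h₁.icpt p.1
  set v := sheared s d.h₂.slope d.h₂.icpt p.1
  have e : (d.h₁.slope - s) * (p.2 - u) * ((d.h₂.slope - s) * (p.2 - v)) =
      (d.h₁.slope - s) * (d.h₂.slope - s) * ((p.2 - u) * (p.2 - v)) := by ring
  have key : (p.2 - u) * (p.2 - v) ≤ 0 ↔ min u v ≤ p.2 ∧ p.2 ≤ max u v := by
    rw [mul_nonpos_iff, min_le_iff, le_max_iff]
    constructor
    · rintro (⟨h1, h2⟩ | ⟨h1, h2⟩)
      · exact ⟨.inl (by linarith), .inr (by linarith)⟩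
      · exact ⟨.inr (by linarith), .inl (by linarith)⟩
    · rintro ⟨h1 | h1, h2 | h2⟩
      · rcases le_total v p.2 with h3 | h3
        · exact .inr ⟨by linarith, by linarith⟩
        · exact .inl ⟨by linarith, by linarith⟩
      · exact .inl ⟨by linarith, by linarith⟩
      · exact .inr ⟨by linarith, by linarith⟩
      · rcases le_total u p.2 with h3 | h3
        · exact .inl ⟨by linarith, by linarith⟩
        · exact .inr ⟨by linarith, by linarith⟩
  rw [← key, e]
  by_cases hs : d.h₁.above = d.h₂.above
  · have h1 := h.1 hs
    simp only [hs, true_implies, ne_eq, not_true_eq_false, false_implies, and_true]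
    constructor
    · intro h2
      by_contra h3
      exact absurd h2 (mul_pos h1 (not_le.1 h3)).not_ge
    · intro h2
      exact mul_nonpos_of_nonneg_of_nonpos h1.le h2
  · have h1 := h.2 hs
    simp only [hs, false_implies, ne_eq, not_false_eq_true, true_implies, true_and]
    constructor
    · intro h2
      by_contra h3
      exact absurd h2 (mul_neg_of_neg_of_pos h1 (not_le.1 h3)).not_ge
    · intro h2
      exact mul_nonneg_of_nonpos_of_nonpos h1.le h2

theorem shear_surjective (s : ℝ) : Function.Surjective (shear s) := fun p =>
  ⟨(p.2 - s * p.1, -p.1), by simp [shear]⟩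

/-! ### Convexity at the breakpoints -/

theorem IsPL.slope_le_of_line_le {K : ℕ} {m c e : ℕ → ℝ} {F : ℝ → ℝ} (h : IsPL 0 K m c e F)
    {k : ℕ} (h0 : 0 < k) (hK : k < K) {a b : ℝ} (hle : ∀ᶠ t in 𝓝 (e k), a * t + b ≤ F t)
    (heq : a * e k + b = F (e k)) : m (k - 1) ≤ m k := by
  have hm := h.meet (Nat.zero_le (k - 1)) (by omega)
  rw [Nat.sub_add_cancel h0] at hm
  have ek := h.eval k (Nat.zero_le _) hK (e k) (fun _ => le_rfl)
    (fun h' => (h.mono k h0 h').le) fun _ => trivial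
  have h1 : m (k - 1) ≤ a := by
    have : Set.Ioo (if k = 1 then e k - 1 else e (k - 1)) (e k) ∈ 𝓝[<] (e k) := by
      refine Ioo_mem_nhdsLT ?_
      split_ifs with hk
      · linarith
      · exact h.mono_lt (by omega) (by omega) hK
    obtain ⟨t, h1, h2, h3⟩ := ((hle.filter_mono nhdsWithin_le_nhds).and this).exists
    rw [h.eval (k - 1) (Nat.zero_le _) (by omega) t
      (fun hk => by rw [if_neg (by omega)] at h2; exact h2.le)
      (fun _ => by rw [Nat.sub_add_cancel h0]; exact h3.le) fun _ => trivial] at h1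
    nlinarith
  have h2 : a ≤ m k := by
    have : Set.Ioo (e k) (if k + 1 = K then e k + 1 else e (k + 1)) ∈ 𝓝[>] (e k) := by
      refine Ioo_mem_nhdsGT ?_
      split_ifs with hk
      · linarith
      · exact h.mono k h0 (by omega)
    obtain ⟨t, h1, h2, h3⟩ := ((hle.filter_mono nhdsWithin_le_nhds).and this).exists
    rw [h.eval k (Nat.zero_le _) hK t (fun _ => h2.le)
      (fun hk => by rw [if_neg (by omega)] at h3; exact h3.le) fun _ => trivial] at h1
    nlinarith
  exact h1.trans h2

/-- A maximum of minima of two lines is convex at a breakpoint at which no two lines of a minimum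
cross. -/
theorem IsPL.slope_le_of_isMaxOf {K n : ℕ} {m c e : ℕ → ℝ} {F : ℝ → ℝ} (h : IsPL 0 K m c e F)
    {a b a' b' : ℕ → ℝ}
    (hF : IsMaxOf (Finset.range n) (fun i t => min (a i * t + b i) (a' i * t + b' i)) F)
    {k : ℕ} (h0 : 0 < k) (hK : k < K)
    (hne : ∀ i < n, F (e k) = a i * e k + b i → a i * e k + b i ≠ a' i * e k + b' i) :
    m (k - 1) ≤ m k := by
  obtain ⟨i, hi, hFi⟩ := (hF (e k)).2
  have hle : ∀ t, min (a i * t + b i) (a' i * t + b' i) ≤ F t := fun t => (hF t).1 i hi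
  dsimp only at hFi
  rcases lt_trichotomy (a i * e k + b i) (a' i * e k + b' i) with hlt | heq | hlt
  · rw [min_eq_left hlt.le] at hFi
    refine h.slope_le_of_line_le h0 hK (a := a i) (b := b i) ?_ hFi
    have : ∀ᶠ t in 𝓝 (e k), a i * t + b i < a' i * t + b' i :=
      (by fun_prop : ContinuousAt (fun t => a i * t + b i) (e k)).eventually_lt
        (by fun_prop : ContinuousAt (fun t => a' i * t + b' i) (e k)) hlt
    exact this.mono fun t ht => (min_eq_left ht.le).symm.trans_le (hle t)
  · rw [← heq, min_self] at hFi
    exact absurd heq (hne i (Finset.mem_range.1 hi) hFi.symm)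
  · rw [min_eq_right hlt.le] at hFi
    refine h.slope_le_of_line_le h0 hK (a := a' i) (b := b' i) ?_ hFi
    have : ∀ᶠ t in 𝓝 (e k), a' i * t + b' i < a i * t + b i :=
      (by fun_prop : ContinuousAt (fun t => a' i * t + b' i) (e k)).eventually_lt
        (by fun_prop : ContinuousAt (fun t => a i * t + b i) (e k)) hlt
    exact this.mono fun t ht => (min_eq_right ht.le).symm.trans_le (hle t)

/-! ### The envelopes of the sheared lines -/

open RealRAM

/-- For every double-wedge, the minimum of its two sheared lines multiplied by `r`. The line of
larger slope comes first. -/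
noncomputable def wedgeHats (r s : ℝ) (m₁ c₁ m₂ c₂ : ℕ → ℝ) : Hats where
  a i := if r * (-1 / (m₁ i - s)) < r * (-1 / (m₂ i - s)) then r * (-1 / (m₂ i - s))
    else r * (-1 / (m₁ i - s))
  b i := if r * (-1 / (m₁ i - s)) < r * (-1 / (m₂ i - s)) then r * (c₂ i / (m₂ i - s))
    else r * (c₁ i / (m₁ i - s))
  a' i := if r * (-1 / (m₁ i - s)) < r * (-1 / (m₂ i - s)) then r * (-1 / (m₁ i - s))
    else r * (-1 / (m₂ i - s))
  b' i := if r * (-1 / (m₁ i - s)) < r * (-1 / (m₂ i - s)) then r * (c₁ i / (m₁ i - s))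
    else r * (c₂ i / (m₂ i - s))
  le i := by split_ifs <;> linarith

section wedgeHats

variable {r s : ℝ} {m₁ c₁ m₂ c₂ : ℕ → ℝ} {n : ℕ} {U V : ℝ → ℝ}

theorem wedgeHats_lines (i : ℕ) (t : ℝ) :
    ((wedgeHats r s m₁ c₁ m₂ c₂).a i * t + (wedgeHats r s m₁ c₁ m₂ c₂).b i =
        r * sheared s (m₁ i) (c₁ i) t ∧
      (wedgeHats r s m₁ c₁ m₂ c₂).a' i * t + (wedgeHats r s m₁ c₁ m₂ c₂).b' i =
        r * sheared s (m₂ i) (c₂ i) t) ∨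
    ((wedgeHats r s m₁ c₁ m₂ c₂).a i * t + (wedgeHats r s m₁ c₁ m₂ c₂).b i =
        r * sheared s (m₂ i) (c₂ i) t ∧
      (wedgeHats r s m₁ c₁ m₂ c₂).a' i * t + (wedgeHats r s m₁ c₁ m₂ c₂).b' i =
        r * sheared s (m₁ i) (c₁ i) t) := by
  simp only [wedgeHats, sheared]
  split_ifs
  · exact .inr ⟨by ring, by ring⟩
  · exact .inl ⟨by ring, by ring⟩

theorem wedgeHats_fn (i : ℕ) (t : ℝ) : (wedgeHats r s m₁ c₁ m₂ c₂).fn i t =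
    min (r * sheared s (m₁ i) (c₁ i) t) (r * sheared s (m₂ i) (c₂ i) t) := by
  rw [Hats.fn]
  rcases wedgeHats_lines (r := r) (s := s) (m₁ := m₁) (c₁ := c₁) (m₂ := m₂) (c₂ := c₂) i t with
    ⟨h1, h2⟩ | ⟨h1, h2⟩
  · rw [h1, h2]
  · rw [h1, h2, min_comm]

/-- The points of the intersection, in sheared coordinates. -/
theorem iInter_eq_shear {D : Fin n → DoubleWedge}
    (hs : ∀ i, Uncovered ((D i).h₁.above = (D i).h₂.above) (D i).h₁.slope (D i).h₂.slope s)
    (h₁ : ∀ i : Fin n, m₁ i = (D i).h₁.slope ∧ c₁ i = (D i).h₁.icpt)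
    (h₂ : ∀ i : Fin n, m₂ i = (D i).h₂.slope ∧ c₂ i = (D i).h₂.icpt)
    (hU : IsMaxOf (Finset.range n) (wedgeHats 1 s m₁ c₁ m₂ c₂).fn U)
    (hV : IsMaxOf (Finset.range n) (wedgeHats (-1) s m₁ c₁ m₂ c₂).fn V) :
    ⋂ i, (D i).toSet = shear s '' {p | U p.1 ≤ p.2 ∧ p.2 ≤ -V p.1} := by
  have mem : ∀ p : Plane, shear s p ∈ ⋂ i, (D i).toSet ↔ U p.1 ≤ p.2 ∧ p.2 ≤ -V p.1 := by
    intro p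
    have fU : ∀ i : Fin n, (wedgeHats 1 s m₁ c₁ m₂ c₂).fn i p.1 =
        min (sheared s (D i).h₁.slope (D i).h₁.icpt p.1)
          (sheared s (D i).h₂.slope (D i).h₂.icpt p.1) := fun i => by
      rw [wedgeHats_fn, (h₁ i).1, (h₁ i).2, (h₂ i).1, (h₂ i).2, one_mul, one_mul]
    have fV : ∀ i : Fin n, (wedgeHats (-1) s m₁ c₁ m₂ c₂).fn i p.1 =
        -max (sheared s (D i).h₁.slope (D i).h₁.icpt p.1)
          (sheared s (D i).h₂.slope (D i).h₂.icpt p.1) := fun i => by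
      rw [wedgeHats_fn, (h₁ i).1, (h₁ i).2, (h₂ i).1, (h₂ i).2, neg_one_mul, neg_one_mul,
        min_neg_neg]
    simp only [Set.mem_iInter, mem_toSet_shear (hs _)]
    constructor
    · intro h
      constructor
      · obtain ⟨i, hi, he⟩ := (hU p.1).2
        rw [← he, fU ⟨i, Finset.mem_range.1 hi⟩]
        exact (h _).1
      · obtain ⟨i, hi, he⟩ := (hV p.1).2
        rw [← he, fV ⟨i, Finset.mem_range.1 hi⟩, neg_neg]
        exact (h _).2
    · rintro ⟨h3, h4⟩ i
      have h5 := (hU p.1).1 i (Finset.mem_range.2 i.2)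
      have h6 := (hV p.1).1 i (Finset.mem_range.2 i.2)
      rw [fU] at h5
      rw [fV] at h6
      exact ⟨h5.trans h3, by linarith⟩
  ext q
  obtain ⟨p, rfl⟩ := shear_surjective s q
  rw [mem, (shear_injective s).mem_set_image]
  rfl

theorem wedgeHats_kink {K : ℕ} {e um uc lm lc : ℕ → ℝ}
    (hU : IsMaxOf (Finset.range n) (wedgeHats 1 s m₁ c₁ m₂ c₂).fn U)
    (hV : IsMaxOf (Finset.range n) (wedgeHats (-1) s m₁ c₁ m₂ c₂).fn V)
    (plU : IsPL 0 K um uc e U) (plL : IsPL 0 K lm lc e fun t => -V t) {k : ℕ} (h0 : 0 < k)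
    (hK : k < K) (hlt : U (e k) < -V (e k)) : um (k - 1) ≤ um k ∧ lm k ≤ lm (k - 1) := by
  constructor
  · refine plU.slope_le_of_isMaxOf hU h0 hK fun i hi h1 h2 => ?_
    have h3 := (hV (e k)).1 i (Finset.mem_range.2 hi)
    rw [wedgeHats_fn] at h3
    rcases wedgeHats_lines (r := 1) (s := s) (m₁ := m₁) (c₁ := c₁) (m₂ := m₂) (c₂ := c₂) i (e k)
      with ⟨h4, h5⟩ | ⟨h4, h5⟩
    all_goals
      rcases min_le_iff.1 h3 with h6 | h6 <;> linarith
  · have plV : IsPL 0 K (fun k => -lm k) (fun k => -lc k) e V := by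
      have := plL.neg
      simpa only [neg_neg] using this
    refine neg_le_neg_iff.1 (plV.slope_le_of_isMaxOf hV h0 hK fun i hi h1 h2 => ?_)
    have h3 := (hU (e k)).1 i (Finset.mem_range.2 hi)
    rw [wedgeHats_fn] at h3
    rcases wedgeHats_lines (r := -1) (s := s) (m₁ := m₁) (c₁ := c₁) (m₂ := m₂) (c₂ := c₂) i (e k)
      with ⟨h4, h5⟩ | ⟨h4, h5⟩
    all_goals
      rcases min_le_iff.1 h3 with h6 | h6 <;> linarith

/-- The two envelopes do not bound a region of positive width at a crossing of two lines. -/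
theorem wedgeHats_touch (hn : 1 ≤ n) (hne : m₁ 0 ≠ m₂ 0) (hs₁ : m₁ 0 - s ≠ 0)
    (hs₂ : m₂ 0 - s ≠ 0) (hU : IsMaxOf (Finset.range n) (wedgeHats 1 s m₁ c₁ m₂ c₂).fn U)
    (hV : IsMaxOf (Finset.range n) (wedgeHats (-1) s m₁ c₁ m₂ c₂).fn V) :
    ∃ t, -V t ≤ U t := by
  obtain ⟨t, ht⟩ : ∃ t, sheared s (m₁ 0) (c₁ 0) t = sheared s (m₂ 0) (c₂ 0) t := by
    have h : -1 / (m₁ 0 - s) - -1 / (m₂ 0 - s) ≠ 0 := by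
      rw [div_sub_div _ _ hs₁ hs₂]
      refine div_ne_zero (fun h => hne ?_) (mul_ne_zero hs₁ hs₂)
      linarith
    refine ⟨(c₂ 0 / (m₂ 0 - s) - c₁ 0 / (m₁ 0 - s)) / (-1 / (m₁ 0 - s) - -1 / (m₂ 0 - s)), ?_⟩
    have := mul_div_cancel₀ (c₂ 0 / (m₂ 0 - s) - c₁ 0 / (m₁ 0 - s)) h
    simp only [sheared]
    linarith
  have h1 := (hU t).1 0 (Finset.mem_range.2 hn)
  have h2 := (hV t).1 0 (Finset.mem_range.2 hn)
  rw [wedgeHats_fn, ht, min_self] at h1 h2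
  exact ⟨t, by linarith⟩

end wedgeHats

/-! ### Computing the envelopes of the sheared lines -/

namespace RealRAM

/-- The lines of a double-wedge in sheared coordinates, multiplied by `r`. The line of larger slope
comes first, and the breakpoint is the crossing of the two lines. -/
def wedgeLeaf (r : ℚ) : Prog :=
  setR 25 (.const r *ᵣ (.const (-1) /ᵣ (.get 0 (nv vI) -ᵣ rv vS))) ;;
  setR 26 (.const r *ᵣ (.const (-1) /ᵣ (.get 2 (nv vI) -ᵣ rv vS))) ;;
  setR 27 (.const r *ᵣ (.get 1 (nv vI) /ᵣ (.get 0 (nv vI) -ᵣ rv vS))) ;;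
  setR 28 (.const r *ᵣ (.get 3 (nv vI) /ᵣ (.get 2 (nv vI) -ᵣ rv vS))) ;;
  .ite (rv 25 <ᵣ rv 26) (setR vA (rv 26) ;; setR vB (rv 28) ;; setR vA' (rv 25) ;; setR vB' (rv 27))
    (setR vA (rv 25) ;; setR vB (rv 27) ;; setR vA' (rv 26) ;; setR vB' (rv 28)) ;;
  setR vY ((rv vB' -ᵣ rv vB) /ᵣ (rv vA -ᵣ rv vA'))

/-- The sheared lines of the double-wedges in the memory. -/
noncomputable abbrev State.hats (σ : State) (r : ℝ) : Hats :=
  wedgeHats r (σ.real vS 0) (σ.real 0) (σ.real 1) (σ.real 2) (σ.real 3)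

theorem min_lines {a b a' b' : ℝ} (h : a' < a) :
    (∀ t ≤ (b' - b) / (a - a'), min (a * t + b) (a' * t + b') = a * t + b) ∧
    (∀ t, (b' - b) / (a - a') ≤ t → min (a * t + b) (a' * t + b') = a' * t + b') := by
  have hd : 0 < a - a' := sub_pos.2 h
  constructor
  · intro t ht
    rw [le_div_iff₀ hd] at ht
    exact min_eq_left (by linarith)
  · intro t ht
    rw [div_le_iff₀ hd] at ht
    exact min_eq_right (by linarith)

theorem wp_wedgeLeaf {r : ℚ} (hr : r ≠ 0) {τ : State}
    (hs₁ : τ.real 0 (τ.nat vI 0) - τ.real vS 0 ≠ 0)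
    (hs₂ : τ.real 2 (τ.nat vI 0) - τ.real vS 0 ≠ 0)
    (hne : τ.real 0 (τ.nat vI 0) ≠ τ.real 2 (τ.nat vI 0)) :
    wp (wedgeLeaf r) (fun υ =>
      (∀ t ≤ υ.real vY 0, (τ.hats r).fn (τ.nat vI 0) t = υ.real vA 0 * t + υ.real vB 0) ∧
      (∀ t, υ.real vY 0 ≤ t → (τ.hats r).fn (τ.nat vI 0) t =
        υ.real vA' 0 * t + υ.real vB' 0)) τ := by
  have hne' : (r : ℝ) * (-1 / (τ.real 0 (τ.nat vI 0) - τ.real vS 0)) ≠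
      r * (-1 / (τ.real 2 (τ.nat vI 0) - τ.real vS 0)) := by
    intro h
    have h := mul_left_cancel₀ (Rat.cast_ne_zero.2 hr) h
    rw [div_eq_div_iff hs₁ hs₂] at h
    exact hne (by linarith)
  simp only [Hats.fn, wedgeHats, vI, vS, vY, vA, vB, vA', vB'] at *
  simp [wedgeLeaf]
  constructor
  · intro hlt
    simp only [if_pos hlt]
    exact min_lines hlt
  · intro hle
    simp only [if_neg hle.not_gt]
    exact min_lines (hle.lt_of_ne hne'.symm)

/-- Append the envelope of the sheared lines, multiplied by `r`, to the array of pieces. -/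
def wedgeEnvelope (r : ℚ) : Prog := setN vN (.const 0) ;; load (wedgeLeaf r) ;; envelope

/-- The start of the last block after merging `n` functions, which is the root of the tree. -/
abbrev lastStart : NExp := .get aS (nv inN +ₙ nv inN -ₙ .const 2)

def envelopeCost (r : ℚ) (n : ℕ) : ℕ := 3 + (loadCost (wedgeLeaf r) * (n + 1) +
  (mergeCost * mergeWork n + (3 + (nv vT +ₙ one <ₙ nv vN).cost)))

theorem ends_wedgeEnvelope {r : ℚ} (hr : r ≠ 0) {σ : State} {n : ℕ} (hn : 1 ≤ n)
    (hin : σ.nat inN 0 = n)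
    (hs : ∀ i < n, σ.real 0 i - σ.real vS 0 ≠ 0 ∧ σ.real 2 i - σ.real vS 0 ≠ 0 ∧
      σ.real 0 i ≠ σ.real 2 i) :
    Ends (wedgeEnvelope r) σ (envelopeCost r n) (fun τ =>
      (∀ i < σ.nat vO 0, τ.real aM i = σ.real aM i ∧ τ.real aC i = σ.real aC i ∧
        τ.real aX i = σ.real aX i) ∧ σ.nat vO 0 ≤ τ.nat vO 0 ∧
      ∃ F, IsMaxOf (Finset.range n) (σ.hats r).fn F ∧
        IsPL (τ.nat aS (2 * n - 2)) (τ.nat vO 0) (τ.real aM) (τ.real aC) (τ.real aX) F ∧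
        τ.nat vO 0 - τ.nat aS (2 * n - 2) ≤ 8 * n + 2) := by
  refine Ends.seq (R := fun τ => τ = σ.setNat vN 0 0) ((Ends.of_wp (by simp)).mono (by simp)
    fun _ h => h) ?_
  rintro _ rfl
  set σ' := σ.setNat vN 0 0 with hσ'
  refine (ends_load (F := (σ.hats r).fn) (n := n) (by simpa [hσ'] using hin) rfl
    (by simp [wedgeLeaf, leafTemps]) ?_).seq fun τ ⟨g1, g2, g3, g4, g5, g6, g7⟩ => ?_
  · intro τ h1 h2 h3 h4
    have e0 : τ.real 0 = σ.real 0 := by rw [h2 0 (by simp)]; rfl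
    have e1 : τ.real 1 = σ.real 1 := by rw [h2 1 (by simp)]; rfl
    have e2 : τ.real 2 = σ.real 2 := by rw [h2 2 (by simp)]; rfl
    have e3 : τ.real 3 = σ.real 3 := by rw [h2 3 (by simp)]; rfl
    have e4 : τ.real vS = σ.real vS := by rw [h3]; rfl
    have := hs _ h4
    have := wp_wedgeLeaf hr (τ := τ) (by rw [e0, e4]; exact this.1) (by rw [e2, e4]; exact this.2.1)
      (by rw [e0, e2]; exact this.2.2)
    have hh : τ.hats r = σ.hats r := by simp only [State.hats, e0, e1, e2, e3, e4]
    rwa [hh] at this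
  · have n0 : σ'.nat vN 0 = 0 := by simp [hσ']
    have o0 : σ'.nat vO 0 = σ.nat vO 0 := by simp [hσ']
    simp only [n0, zero_add] at g1 g7
    rw [g1] at g2
    refine (ends_envelope hn g1 g2 g7).mono le_rfl fun υ ⟨k1, k2, k3, F, k4, k5, k6⟩ => ?_
    rw [o0] at g3 g6
    have e : 2 * n - 2 + 1 = 2 * n - 1 := by omega
    rw [Block, e, k2] at k5
    rw [e, k2] at k6
    refine ⟨fun i hi => ?_, by omega, F, k4, k5, k6⟩
    obtain ⟨a1, a2, a3⟩ := k1 i (by omega)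
    obtain ⟨b1, b2, b3⟩ := g6 i hi
    exact ⟨a1.trans b1, a2.trans b2, a3.trans b3⟩

/-! ### Computing a slope that is not covered -/

def slopeInit : Prog := setN vO (.const 0) ;; setN vN (.const 0)
/-- The functions of `slopeHats` with indices `i < n`. -/
abbrev leftLeaf : Prog := slopeLeaf (-1) (rv 27)
/-- The functions of `slopeHats` with indices `n + i`. -/
abbrev rightLeaf : Prog := slopeLeaf 1 (.const 0 -ᵣ rv 28)

/-- Find a slope that is not covered. -/
def findSlope : Prog := slopeInit ;; load leftLeaf ;; load rightLeaf ;; envelope ;; scan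

def findSlopeCost (n : ℕ) : ℕ := slopeInit.bound + (loadCost leftLeaf * (n + 1) +
  (loadCost rightLeaf * (n + 1) + ((mergeCost * mergeWork (n + n) +
    (3 + (nv vT +ₙ one <ₙ nv vN).cost)) + scanCost * (8 * (n + n) + 2 + 1))))

theorem ends_findSlope {σ : State} {n : ℕ} (hn : 1 ≤ n) (hin : σ.nat inN 0 = n)
    (h : ∃ s, ∀ i < n, Uncovered (σ.nat 1 i = σ.nat 2 i) (σ.real 0 i) (σ.real 2 i) s) :
    Ends findSlope σ (findSlopeCost n) (fun τ => ∀ i < n,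
      Uncovered (σ.nat 1 i = σ.nat 2 i) (σ.real 0 i) (σ.real 2 i) (τ.real vS 0)) := by
  obtain ⟨s, hs⟩ := h
  set H := slopeHats n (σ.real 0) (σ.real 2) (σ.nat 1) (σ.nat 2) with hH
  refine Ends.seq (R := fun τ => (τ.nat vO 0 = 0 ∧ τ.nat vN 0 = 0) ∧
    Frame slopeInit.natWrites slopeInit.realWrites σ τ)
    (Ends.of_wp (by simp [slopeInit])).frame fun τ ⟨⟨hO, hN⟩, hf⟩ => ?_
  have tn : ∀ a < 3, τ.nat a = σ.nat a := fun a ha => hf.nat a (by simp [slopeInit]; omega)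
  have tr : ∀ a, τ.real a = σ.real a := fun a => hf.real a (by simp [slopeInit])
  refine (ends_load (F := H.fn) (n := n) (by rw [tn 0 (by simp), hin]) rfl (by decide)
    ?_).frame.seq fun υ ⟨⟨g1, g2, g3, g4, g5, g6, g7⟩, hfu⟩ => ?_
  · intro υ h1 h2 h3 h4
    have e1 : υ.nat 1 = σ.nat 1 := by rw [h1 1 (by simp), tn 1 (by simp)]
    have e2 : υ.nat 2 = σ.nat 2 := by rw [h1 2 (by simp), tn 2 (by simp)]
    have e3 : υ.real 0 = σ.real 0 := by rw [h2 0 (by simp), tr]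
    have e4 : υ.real 2 = σ.real 2 := by rw [h2 2 (by simp), tr]
    refine wp_slopeLeaf ⟨fun x _ => x, fun _ => rfl, fun hd t => ?_⟩ fun hs t => ?_
    · rw [e1, e2] at hd
      rw [e3, e4, hH, (slopeHats_differ hd t).1 h4]
      push_cast
      ring
    · rw [e1, e2] at hs
      rw [e3, e4, hH, (slopeHats_same hs t).1 h4]
  simp only [hN, hO, zero_add] at g1 g3 g5 g6 g7
  have un : ∀ a < 3, υ.nat a = σ.nat a := fun a ha => by
    rw [hfu.nat a, tn a ha]
    interval_cases a <;> decide
  have ur : ∀ a < 4, υ.real a = σ.real a := fun a ha => by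
    rw [hfu.real a, tr a]
    interval_cases a <;> decide
  refine (ends_load (F := fun j => H.fn (n + j)) (n := n) (by rw [un 0 (by simp), hin]) rfl
    (by decide) ?_).seq fun ω ⟨k1, k2, k3, k4, k5, k6, k7⟩ => ?_
  · intro ω h1 h2 h3 h4
    have e1 : ω.nat 1 = σ.nat 1 := by rw [h1 1 (by simp), un 1 (by simp)]
    have e2 : ω.nat 2 = σ.nat 2 := by rw [h1 2 (by simp), un 2 (by simp)]
    have e3 : ω.real 0 = σ.real 0 := by rw [h2 0 (by simp), ur 0 (by simp)]
    have e4 : ω.real 2 = σ.real 2 := by rw [h2 2 (by simp), ur 2 (by simp)]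
    refine wp_slopeLeaf ⟨fun _ y => 0 - y, fun υ => by simp, fun hd t => ?_⟩ fun hs t => ?_
    · rw [e1, e2] at hd
      rw [e3, e4, hH, (slopeHats_differ hd t).2]
      push_cast
      ring
    · rw [e1, e2] at hs
      rw [e3, e4, hH, (slopeHats_same hs t).2]
  rw [g1] at g2 k1 k4 k5 k7
  rw [g3] at g2 k3 k6
  have size : ω.nat aS (n + n) = ω.nat vO 0 := by rw [← k1, k2]
  have start : ∀ b ≤ n, ω.nat aS b = υ.nat aS b := fun b hb => by
    rcases hb.eq_or_lt with rfl | hb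
    · rw [k5 (by omega), g2, g3]
    · exact k4 b hb
  have blocks : ∀ b < n + n, Block ω b (H.fn b) ∧ ω.nat aS (b + 1) = ω.nat aS b + 2 := by
    intro b hb
    rcases lt_or_ge b n with hbn | hbn
    · obtain ⟨b1, b2⟩ := g7 b hbn
      rw [start (b + 1) (by omega), start b hbn.le]
      refine ⟨?_, b2⟩
      rw [Block, start (b + 1) (by omega), start b hbn.le]
      refine b1.congr fun k _ hk => k6 k (hk.trans_le ?_)
      have : ∀ d, b + 1 + d ≤ n → υ.nat aS (b + 1) ≤ υ.nat aS (b + 1 + d) := by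
        intro d
        induction d with
        | zero => simp
        | succ d ih =>
          intro hd
          have := (g7 (b + 1 + d) (by omega)).2
          have := ih (by omega)
          rw [← add_assoc]
          omega
      have := this (n - (b + 1)) (by omega)
      rw [show b + 1 + (n - (b + 1)) = n by omega, g2] at this
      exact this
    · have := k7 (b - n) (by omega)
      rwa [Nat.add_sub_cancel' hbn] at this
  refine (ends_envelope (h := H) (N := n + n) (by omega) k1 size blocks).frame.seq
    fun χ ⟨⟨c1, c2, c3, F, c4, c5, c6⟩, hfx⟩ => ?_
  have e : 2 * (n + n) - 2 + 1 = 2 * (n + n) - 1 := by omega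
  rw [Block, e, c2] at c5
  rw [e, c2] at c6
  have xN : χ.nat vN 0 = n + n := by rw [hfx.nat vN (by decide), k1]
  refine (ends_scan xN c5 fun hm =>
    exists_neg_break c4 c5 (neg_of_uncovered c4 hs) hm).mono ?_ fun ψ hψ i hi =>
    uncovered_of_neg c4 hψ hi
  exact Nat.mul_le_mul_left _ (by omega)

/-! ### Negating a piecewise linear function -/

/-- Copy the negative of piece `vJ`. -/
def negateBody : Prog :=
  .setReal aM (nv vO) (.const 0 -ᵣ .get aM (nv vJ)) ;;
  .setReal aC (nv vO) (.const 0 -ᵣ .get aC (nv vJ)) ;;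
  .setReal aX (nv vO) (.get aX (nv vJ)) ;;
  setN vO (nv vO +ₙ one) ;; setN vJ (nv vJ +ₙ one)

abbrev negateTest : Test := nv vJ <ₙ nv vPE

def negateInit : Prog := setN vJ lastStart ;; setN vPE (nv vO)

/-- Append the negative of the last block to the array of pieces. -/
def negate : Prog := negateInit ;; .while negateTest negateBody

/-- The invariant of the copying loop: `d` pieces have been copied. -/
structure NegateInv (st en d : ℕ) (M C X : ℕ → ℝ) (σ : State) : Prop where
  src : σ.nat vJ 0 = st + d
  dst : σ.nat vO 0 = en + d
  last : σ.nat vPE 0 = en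
  keep : ∀ k < en, σ.real aM k = M k ∧ σ.real aC k = C k ∧ σ.real aX k = X k
  copy : ∀ k < d, σ.real aM (en + k) = -M (st + k) ∧ σ.real aC (en + k) = -C (st + k) ∧
    σ.real aX (en + k) = X (st + k)

theorem wp_negateBody {st en d : ℕ} {M C X : ℕ → ℝ} {σ : State}
    (h : NegateInv st en d M C X σ) (hd : st + d < en) :
    wp negateBody (NegateInv st en (d + 1) M C X) σ := by
  obtain ⟨h1, h2, h3, h4, h5⟩ := h
  obtain ⟨k1, k2, k3⟩ := h4 _ hd
  simp only [vJ, vO, vPE, aM, aC, aX] at *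
  simp only [negateBody, wp, NExp.eval, RExp.eval]
  refine ⟨by simp [h1, add_assoc], by simp [h2, add_assoc], by simp [h3], fun k hk => ?_,
    fun k hk => ?_⟩
  · have : k ≠ en + d := by omega
    simpa [h2, this] using h4 k hk
  · rcases Nat.lt_succ_iff_lt_or_eq.1 hk with hk | rfl
    · have : k ≠ d := by omega
      simpa [h2, this] using h5 k hk
    · simp [h1, h2, k1, k2, k3]

/-- The cost of negating a function, per piece. -/
def negateCost : ℕ := negateInit.bound + 2 * negateTest.cost + negateBody.bound

/-- The variables `vPE` and `vO` end up as the bounds of the negative of the last block. -/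
theorem ends_negate {σ : State} {n : ℕ} {V : ℝ → ℝ} (hin : σ.nat inN 0 = n)
    (h : IsPL (σ.nat aS (2 * n - 2)) (σ.nat vO 0) (σ.real aM) (σ.real aC) (σ.real aX) V) :
    Ends negate σ (negateCost * (σ.nat vO 0 - σ.nat aS (2 * n - 2) + 1)) fun τ =>
      (∀ k < σ.nat vO 0, τ.real aM k = σ.real aM k ∧ τ.real aC k = σ.real aC k ∧
        τ.real aX k = σ.real aX k) ∧
      τ.nat vPE 0 = σ.nat vO 0 ∧
      τ.nat vO 0 = σ.nat vO 0 + (σ.nat vO 0 - σ.nat aS (2 * n - 2)) ∧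
      IsPL (τ.nat vPE 0) (τ.nat vO 0) (τ.real aM) (τ.real aC) (τ.real aX) fun t => -V t := by
  set st := σ.nat aS (2 * n - 2) with hst
  set en := σ.nat vO 0 with hen
  have hlt := h.lt
  have init : wp negateInit (NegateInv st en 0 (σ.real aM) (σ.real aC) (σ.real aX)) σ := by
    simp only [vO, aM, aC, aX, aS, inN] at *
    simp only [negateInit, wp, NExp.eval]
    refine ⟨?_, ?_, ?_, fun k _ => ⟨rfl, rfl, rfl⟩, fun k hk => by omega⟩
    · simp [hst, hin, two_mul]
    · simp [hen]
    · simp [hen]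
  refine ((Ends.of_wp init).seq (t := (negateTest.cost + negateBody.bound) * (en - st) +
    negateTest.cost) fun τ hτ =>
    (Ends.while (fun υ => ∃ d, st + d ≤ en ∧
      NegateInv st en d (σ.real aM) (σ.real aC) (σ.real aX) υ)
      (fun υ => (negateTest.cost + negateBody.bound) * (en - υ.nat vJ 0)) ⟨0, by omega, hτ⟩
      fun υ ⟨d, hd, hI⟩ _ hb => ⟨_, (Ends.of_wp (wp_negateBody hI ?_)).mono le_rfl
        fun ω hω => ⟨⟨d + 1, ?_, hω⟩, ?_⟩⟩).mono ?_ ?_).mono ?_ fun _ h => h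
  · have hb : υ.nat vJ 0 < υ.nat vPE 0 := hb
    rwa [hI.src, hI.last] at hb
  · have hb : υ.nat vJ 0 < υ.nat vPE 0 := hb
    rw [hI.src, hI.last] at hb
    omega
  · have hb : υ.nat vJ 0 < υ.nat vPE 0 := hb
    rw [hI.src, hI.last] at hb
    rw [hω.src, hI.src]
    obtain ⟨r, hr⟩ : ∃ r, en - (st + d) = r + 1 := ⟨en - (st + d) - 1, by omega⟩
    rw [show en - (st + (d + 1)) = r by omega, hr, mul_add, mul_one]
    exact (Nat.add_comm _ _).le
  · rw [hτ.src, add_zero]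
  · rintro υ ⟨⟨d, hd, hI⟩, hb, -⟩
    have hb : ¬ υ.nat vJ 0 < υ.nat vPE 0 := hb
    rw [hI.src, hI.last] at hb
    obtain rfl : d = en - st := by omega
    refine ⟨hI.keep, hI.last, hI.dst, ?_⟩
    rw [hI.last, hI.dst]
    refine ⟨by omega, fun k h1 h2 => ?_, fun k h1 h2 t h3 h4 _ => ?_⟩
    · obtain ⟨j, rfl⟩ := Nat.exists_eq_add_of_le h1.le
      rw [(hI.copy j (by omega)).2.2, add_assoc, (hI.copy (j + 1) (by omega)).2.2]
      exact h.mono (st + j) (by omega) (by omega)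
    · obtain ⟨j, rfl⟩ := Nat.exists_eq_add_of_le h1
      obtain ⟨e1, e2, e3⟩ := hI.copy j (by omega)
      rw [e1, e2, h.eval (st + j) (by omega) (by omega) t (fun hj => ?_) (fun hj => ?_)
        fun _ => trivial]
      · ring
      · rw [← e3]; exact h3 (by omega)
      · rw [add_assoc, ← (hI.copy (j + 1) (by omega)).2.2]; exact h4 (by omega)
  · rw [negateCost, mul_add, mul_one]
    have : (negateTest.cost + negateBody.bound) * (en - st) ≤
      (negateInit.bound + 2 * negateTest.cost + negateBody.bound) * (en - st) :=
      Nat.mul_le_mul_right _ (by omega)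
    omega

/-! ### The cells between the two envelopes -/

end RealRAM

theorem IsPLTo.duplicate {m c x : ℕ → ℝ} {F : ℝ → ℝ} (h : IsPL 0 1 m c x F) (y : ℝ) :
    IsPL 0 2 (Function.update m 1 (m 0)) (Function.update c 1 (c 0)) (Function.update x 1 y) F := by
  have := fun t => h.eval 0 le_rfl one_pos t (by simp) (by simp) fun _ => trivial
  exact IsPL.pair (s := 0) (fun t _ => by simpa using this t) fun t _ => by simpa using this t

theorem SignsTo.duplicate {w : ℕ → ℕ} {x : ℕ → ℝ} {F G : ℝ → ℝ}
    (h : SignsTo 1 w x (fun _ => True) F G) (y : ℝ) :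
    SignsTo 2 (Function.update w 1 (w 0)) (Function.update x 1 y) (fun _ => True) F G := by
  obtain ⟨h1, h2⟩ := h 0 one_pos
  have h1 := fun hw t => h1 hw t (by simp) (by simp) fun _ => trivial
  have h2 := fun hw t => h2 hw t (by simp) (by simp) fun _ => trivial
  intro k hk
  obtain rfl | rfl : k = 0 ∨ k = 1 := by omega
  · exact ⟨fun hw t _ _ _ => h1 (by simpa using hw) t, fun hw t _ _ _ => h2 (by simpa using hw) t⟩
  · exact ⟨fun hw t _ _ _ => h1 (by simpa using hw) t, fun hw t _ _ _ => h2 (by simpa using hw) t⟩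

namespace RealRAM

/-- Make sure that there are at least two cells, by cutting a single cell at `0`. -/
def split : Prog :=
  setN vK (nv vK +ₙ one) ;;
  .ite (nv vK <ₙ .const 2)
    (.setReal aE one (.const 0) ;;
      .setReal aFM one (rv aFM) ;; .setReal aFC one (rv aFC) ;;
      .setReal aGM one (rv aGM) ;; .setReal aGC one (rv aGC) ;;
      .setNat aW one (nv aW) ;; setN vK (.const 2)) .skip

/-- The memory holds a common subdivision of `L` and `U` into at least two cells. -/
structure Cells (L U : ℝ → ℝ) (σ : State) : Prop where
  two_le : 2 ≤ σ.nat vK 0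
  plL : IsPL 0 (σ.nat vK 0) (σ.real aFM) (σ.real aFC) (σ.real aE) L
  plU : IsPL 0 (σ.nat vK 0) (σ.real aGM) (σ.real aGC) (σ.real aE) U
  signs : SignsTo (σ.nat vK 0) (σ.nat aW) (σ.real aE) (fun _ => True) L U

theorem wp_split {σ : State} {L U : ℝ → ℝ}
    (hL : IsPL 0 (σ.nat vK 0 + 1) (σ.real aFM) (σ.real aFC) (σ.real aE) L)
    (hU : IsPL 0 (σ.nat vK 0 + 1) (σ.real aGM) (σ.real aGC) (σ.real aE) U)
    (hw : SignsTo (σ.nat vK 0 + 1) (σ.nat aW) (σ.real aE) (fun _ => True) L U) :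
    wp split (fun τ => Cells L U τ ∧ τ.nat vK 0 ≤ σ.nat vK 0 + 2) σ := by
  simp only [split, wp, NExp.eval, RExp.eval, Test.Holds]
  simp only [vK, aW, aE, aFM, aFC, aGM, aGC] at *
  refine ⟨fun h => ?_, fun h => ?_⟩
  · have h0 : σ.nat 24 0 = 0 := by simpa using h
    rw [h0] at hL hU hw
    refine ⟨⟨?_, ?_, ?_, ?_⟩, ?_⟩
    · simp
    · simpa using hL.duplicate 0
    · simpa using hU.duplicate 0
    · simpa using SignsTo.duplicate hw 0
    · simp
  · have h0 : σ.nat 24 0 ≠ 0 := by simpa using h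
    refine ⟨⟨?_, ?_, ?_, ?_⟩, ?_⟩
    · simpa [Nat.one_le_iff_ne_zero] using h0
    · simpa using hL
    · simpa using hU
    · simpa using hw
    · simp

/-! ### The program -/

/-! The variables `vLo` and `vHi` hold the bounds of the block of `U`. -/

@[simp] abbrev vLo : ℕ := 33
@[simp] abbrev vHi : ℕ := 34

def saveBlock : Prog := setN vLo lastStart ;; setN vHi (nv vO)

/-- Set up the overlay of `L`, the last block, and `U`. -/
def overlayArgs : Prog :=
  setN vP (nv vPE) ;; setN vPE (nv vO) ;; setN vQ (nv vLo) ;; setN vQE (nv vHi)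

/-- Compute the common subdivision of the lower and of the upper boundary, in coordinates in which
the uncovered slope is vertical. -/
def findCells : Prog :=
  wedgeEnvelope 1 ;; saveBlock ;; wedgeEnvelope (-1) ;; negate ;; overlayArgs ;; overlay ;; split

def findCellsCost (n : ℕ) : ℕ :=
  envelopeCost 1 n + (saveBlock.bound + (envelopeCost (-1) n + (negateCost * (8 * n + 2 + 1) +
    (overlayArgs.bound + (overlayCost * (2 * (8 * n + 2) + 2 * (8 * n + 2)) + split.bound)))))

theorem ends_findCells {σ : State} {n : ℕ} (hn : 1 ≤ n) (hin : σ.nat inN 0 = n)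
    (hs : ∀ i < n, σ.real 0 i - σ.real vS 0 ≠ 0 ∧ σ.real 2 i - σ.real vS 0 ≠ 0 ∧
      σ.real 0 i ≠ σ.real 2 i) :
    Ends findCells σ (findCellsCost n) fun τ => ∃ U V,
      IsMaxOf (Finset.range n) (σ.hats 1).fn U ∧ IsMaxOf (Finset.range n) (σ.hats (-1)).fn V ∧
      Cells (fun t => -V t) U τ ∧ τ.nat vK 0 ≤ 32 * n + 9 := by
  refine (ends_wedgeEnvelope one_ne_zero hn hin hs).frame.seq
    fun τ ⟨⟨_, _, U, hU, plU, sizeU⟩, hfτ⟩ => ?_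
  have τr : ∀ a < 4, τ.real a = σ.real a := fun a ha => hfτ.real a (by
    interval_cases a <;> decide)
  have τS : τ.real vS = σ.real vS := hfτ.real vS (by decide)
  have τn : τ.nat inN 0 = n := by rw [hfτ.nat inN (by decide), hin]
  refine Ends.seq (R := fun υ => (υ.nat vLo 0 = τ.nat aS (2 * n - 2) ∧
      υ.nat vHi 0 = τ.nat vO 0) ∧ Frame saveBlock.natWrites saveBlock.realWrites τ υ)
    (Ends.of_wp ?_).frame fun υ ⟨⟨hlo, hhi⟩, hfυ⟩ => ?_
  · simp only [inN] at τn
    simp [saveBlock, τn, two_mul]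
  have υr : ∀ a, υ.real a = τ.real a := fun a => hfυ.real a (by simp [saveBlock])
  have υn : υ.nat inN 0 = n := by rw [hfυ.nat inN (by decide), τn]
  have υO : υ.nat vO = τ.nat vO := hfυ.nat vO (by decide)
  have υs : ∀ i < n, υ.real 0 i - υ.real vS 0 ≠ 0 ∧ υ.real 2 i - υ.real vS 0 ≠ 0 ∧
      υ.real 0 i ≠ υ.real 2 i := by
    rw [υr, υr, υr, τr 0 (by simp), τr 2 (by simp), τS]
    exact hs
  have υh : υ.hats (-1 : ℚ) = σ.hats (-1) := by
    simp only [State.hats, υr, τS, τr 0 (by simp), τr 1 (by simp), τr 2 (by simp), τr 3 (by simp)]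
    push_cast
    rfl
  refine (ends_wedgeEnvelope (r := -1) (by simp) hn υn υs).frame.seq
    fun φ ⟨⟨keepφ, leφ, V, hV, plV, sizeV⟩, hfφ⟩ => ?_
  rw [υh] at hV
  have φn : φ.nat inN 0 = n := by rw [hfφ.nat inN (by decide), υn]
  refine ((ends_negate φn plV).mono (T' := negateCost * (8 * n + 2 + 1))
    (Nat.mul_le_mul_left _ (by omega)) fun _ h => h).frame.seq
    fun χ ⟨⟨keepχ, χPE, χO, plL⟩, hfχ⟩ => ?_
  refine Ends.seq (R := fun ψ => (ψ.nat vP 0 = χ.nat vPE 0 ∧ ψ.nat vPE 0 = χ.nat vO 0 ∧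
      ψ.nat vQ 0 = χ.nat vLo 0 ∧ ψ.nat vQE 0 = χ.nat vHi 0) ∧
      Frame overlayArgs.natWrites overlayArgs.realWrites χ ψ)
    (Ends.of_wp (by simp [overlayArgs])).frame fun ψ ⟨⟨ψP, ψPE, ψQ, ψQE⟩, hfψ⟩ => ?_
  have ψr : ∀ a, ψ.real a = χ.real a := fun a => hfψ.real a (by simp [overlayArgs])
  have lo : χ.nat vLo 0 = τ.nat aS (2 * n - 2) := by
    rw [hfχ.nat vLo (by decide), hfφ.nat vLo (by decide), hlo]
  have hi : χ.nat vHi 0 = τ.nat vO 0 := by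
    rw [hfχ.nat vHi (by decide), hfφ.nat vHi (by decide), hhi]
  have plU' : IsPL (χ.nat vLo 0) (χ.nat vHi 0) (χ.real aM) (χ.real aC) (χ.real aX) U := by
    rw [lo, hi]
    refine plU.congr fun k _ hk => ?_
    rw [← υO] at hk
    obtain ⟨a1, a2, a3⟩ := keepφ k hk
    obtain ⟨b1, b2, b3⟩ := keepχ k (hk.trans_le leφ)
    rw [b1, b2, b3, a1, a2, a3, υr, υr, υr]
    exact ⟨rfl, rfl, rfl⟩
  have U1 : IsMaxOf (Finset.range n) (σ.hats 1).fn U := by simpa using hU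
  have sz1 : χ.nat vO 0 - χ.nat vPE 0 ≤ 8 * n + 2 := by omega
  have sz2 : χ.nat vHi 0 - χ.nat vLo 0 ≤ 8 * n + 2 := by omega
  refine ((ends_overlay plL plU' (ψr aM) (ψr aC) (ψr aX) ψP ψPE ψQ ψQE).mono
    (T' := overlayCost * (2 * (8 * n + 2) + 2 * (8 * n + 2))) (Nat.mul_le_mul_left _ (by omega))
    fun _ h => h).seq fun ω ⟨o1, o2, o3, o4⟩ => (Ends.of_wp (wp_split o1 o2 o3)).mono le_rfl
      fun ρ ⟨h1, h2⟩ => ⟨U, V, U1, hV, h1, by omega⟩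

/-- Compute the intersection of the double-wedges in the memory. -/
def intersect : Prog := findSlope ;; findCells ;; trace

def intersectCost (n : ℕ) : ℕ :=
  findSlopeCost n + (findCellsCost n + traceCost * (32 * n + 9 + 1))

theorem ends_intersect {n : ℕ} (hn : 1 ≤ n) (D : Fin n → DoubleWedge)
    (h : ∃ a : OnePoint ℝ, ¬ Covers D a) :
    Ends intersect (inputState D) (intersectCost n) fun τ =>
      Describes τ.regions (⋂ i, (D i).toSet) := by
  set σ := inputState D with hσ
  have hin : σ.nat inN 0 = n := by simp [hσ, inputState]
  have flag : ∀ i : Fin n, (σ.nat 1 i = σ.nat 2 i) = ((D i).h₁.above = (D i).h₂.above) := by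
    intro i
    simp only [hσ, inputState, i.2, dif_pos, Fin.eta]
    cases (D i).h₁.above <;> cases (D i).h₂.above <;> simp
  have m₁ : ∀ i : Fin n, σ.real 0 i = (D i).h₁.slope := fun i => by simp [hσ, inputState]
  have c₁ : ∀ i : Fin n, σ.real 1 i = (D i).h₁.icpt := fun i => by simp [hσ, inputState]
  have m₂ : ∀ i : Fin n, σ.real 2 i = (D i).h₂.slope := fun i => by simp [hσ, inputState]
  have c₂ : ∀ i : Fin n, σ.real 3 i = (D i).h₂.icpt := fun i => by simp [hσ, inputState]
  obtain ⟨s, hs⟩ := exists_uncovered h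
  refine (ends_findSlope hn hin ⟨s, fun i hi => ?_⟩).frame.seq fun τ ⟨hτ, hf⟩ => ?_
  · have := hs ⟨i, hi⟩
    rwa [← flag, ← m₁, ← m₂] at this
  have τr : ∀ a < 4, τ.real a = σ.real a := fun a ha => hf.real a (by
    interval_cases a <;> decide)
  have r0 := τr 0 (by simp)
  have r1 := τr 1 (by simp)
  have r2 := τr 2 (by simp)
  have r3 := τr 3 (by simp)
  have τn : τ.nat inN 0 = n := by rw [hf.nat inN (by decide), hin]
  have hU : ∀ i : Fin n, Uncovered ((D i).h₁.above = (D i).h₂.above) (D i).h₁.slope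
      (D i).h₂.slope (τ.real vS 0) := fun i => by
    have := hτ i i.2
    rwa [flag, m₁, m₂] at this
  have ne : ∀ i < n, τ.real 0 i - τ.real vS 0 ≠ 0 ∧ τ.real 2 i - τ.real vS 0 ≠ 0 ∧
      τ.real 0 i ≠ τ.real 2 i := fun i hi => by
    have := (hU ⟨i, hi⟩).ne
    have := (D ⟨i, hi⟩).not_parallel
    rw [r0, r2, m₁ ⟨i, hi⟩, m₂ ⟨i, hi⟩]
    tauto
  refine (ends_findCells hn τn ne).frame.seq fun υ ⟨⟨U, V, hmU, hmV, hC, hK⟩, hfυ⟩ => ?_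
  have υS : υ.real vS 0 = τ.real vS 0 := by rw [hfυ.real vS (by decide)]
  let S : Strip := {
    K := υ.nat vK 0
    e := υ.real aE
    um := υ.real aGM
    uc := υ.real aGC
    lm := υ.real aFM
    lc := υ.real aFC
    U := U
    L := fun t => -V t
    plU := hC.plU
    plL := hC.plL
    kink := fun k h0 hk hlt => wedgeHats_kink hmU hmV hC.plU hC.plL h0 hk hlt }
  have loaded : Loaded S (υ.nat aW) (τ.real vS 0) υ := ⟨rfl, rfl, rfl, rfl, rfl, rfl, rfl, υS⟩
  have := ne 0 hn
  refine (ends_trace loaded hC.signs hC.two_le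
    (wedgeHats_touch hn this.2.2 this.1 this.2.1 hmU hmV)).mono
    (Nat.mul_le_mul_left _ (Nat.succ_le_succ hK)) fun ρ hρ => ?_
  rwa [iInter_eq_shear hU (fun i => ⟨by rw [r0, m₁], by rw [r1, c₁]⟩)
    (fun i => ⟨by rw [r2, m₂], by rw [r3, c₂]⟩) hmU hmV]

end RealRAM

/-! ### The running time -/

open Asymptotics

/-- The functions that are `O(n log n)`. -/
def Quasilinear (f : ℕ → ℕ) : Prop :=
  Asymptotics.IsBigO atTop (fun n => (f n : ℝ)) fun n : ℕ => (n : ℝ) * Real.log n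

namespace Quasilinear

variable {f g : ℕ → ℕ}

theorem add (hf : Quasilinear f) (hg : Quasilinear g) : Quasilinear fun n => f n + g n := by
  simp only [Quasilinear, Nat.cast_add]
  exact Asymptotics.IsBigO.add hf hg

theorem const_mul (c : ℕ) (hf : Quasilinear f) : Quasilinear fun n => c * f n := by
  simp only [Quasilinear, Nat.cast_mul]
  exact Asymptotics.IsBigO.const_mul_left hf _

theorem id : Quasilinear fun n => n := by
  have : (fun _ : ℕ => (1 : ℝ)) =O[atTop] fun n : ℕ => Real.log n :=
    (Real.isLittleO_const_log_atTop (c := 1)).isBigO.comp_tendsto tendsto_natCast_atTop_atTop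
  simpa [Quasilinear] using (Asymptotics.isBigO_refl (fun n : ℕ => (n : ℝ)) atTop).mul this

theorem const (c : ℕ) : Quasilinear fun _ => c := by
  refine Asymptotics.IsBigO.trans (Asymptotics.IsBigO.of_bound c ?_) id
  filter_upwards [Filter.eventually_ge_atTop 1] with n hn
  have : (1 : ℝ) ≤ n := by exact_mod_cast hn
  simp only [Real.norm_natCast]
  nlinarith [(Nat.cast_nonneg c : (0 : ℝ) ≤ c)]

end Quasilinear

/-- The weights of the tree form a harmonic sum. -/
theorem mergeWork_le (N : ℕ) : (mergeWork N : ℝ) ≤ 2 * N * (1 + Real.log N) := by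
  have h1 : (mergeWork N : ℝ) ≤ 2 * N * (harmonic N : ℝ) := by
    rw [mergeWork, harmonic, Nat.cast_sum, Rat.cast_sum, Finset.mul_sum]
    refine (Finset.sum_le_sum fun j _ => ?_).trans
      (Finset.sum_le_sum_of_subset_of_nonneg (Finset.range_mono (Nat.sub_le N 1))
        fun j _ _ => ?_)
    · refine Nat.cast_div_le.trans ?_
      push_cast
      rw [div_eq_mul_inv]
    · push_cast
      positivity
  exact h1.trans (mul_le_mul_of_nonneg_left (harmonic_le_one_add_log N) (by positivity))

theorem quasilinear_mergeWork {k : ℕ} (hk : 1 ≤ k) : Quasilinear fun n => mergeWork (k * n) := by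
  have hlog : (fun n : ℕ => 2 * (k : ℝ) * (1 + Real.log k) * (n : ℝ) +
      2 * k * ((n : ℝ) * Real.log n)) =O[atTop] fun n : ℕ => (n : ℝ) * Real.log n :=
    (Asymptotics.IsBigO.const_mul_left Quasilinear.id _).add
      ((Asymptotics.isBigO_refl _ _).const_mul_left _)
  refine Asymptotics.IsBigO.trans (Asymptotics.IsBigO.of_bound 1 ?_) hlog
  filter_upwards [Filter.eventually_ge_atTop 1] with n hn
  rw [Real.norm_natCast, one_mul]
  refine (mergeWork_le (k * n)).trans (le_trans (le_of_eq ?_) (le_abs_self _))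
  have hk : (k : ℝ) ≠ 0 := by positivity
  have hn : (n : ℝ) ≠ 0 := by positivity
  rw [Nat.cast_mul, Real.log_mul hk hn]
  ring

namespace RealRAM

theorem quasilinear_intersectCost : Quasilinear intersectCost := by
  have w1 : Quasilinear fun n => mergeWork n := by simpa using quasilinear_mergeWork le_rfl
  have w2 : Quasilinear fun n => mergeWork (n + n) := by
    simpa only [two_mul] using quasilinear_mergeWork (k := 2) (by simp)
  have c := Quasilinear.const
  have lin : ∀ a b : ℕ, Quasilinear fun n => a * n + b :=
    fun a b => (Quasilinear.id.const_mul a).add (c b)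
  have succ : Quasilinear fun n => n + 1 := Quasilinear.id.add (c 1)
  have env : ∀ r, Quasilinear (envelopeCost r) := fun r =>
    (c _).add ((succ.const_mul _).add ((w1.const_mul _).add (c _)))
  have slope : Quasilinear findSlopeCost :=
    (c _).add ((succ.const_mul _).add ((succ.const_mul _).add (((w2.const_mul _).add (c _)).add
      ((((((Quasilinear.id.add .id).const_mul 8).add (c 2)).add (c 1)).const_mul _)))))
  have cells : Quasilinear findCellsCost :=
    (env 1).add ((c _).add ((env (-1)).add ((((lin 8 2).add (c 1)).const_mul _).add ((c _).add
      (((((lin 8 2).const_mul 2).add ((lin 8 2).const_mul 2)).const_mul _).add (c _))))))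
  exact slope.add (cells.add (((lin 32 9).add (c 1)).const_mul _))

end RealRAM

theorem theorem3 :
    ∃ (P : RealRAM.Prog) (T : ℕ → ℕ),
      Asymptotics.IsBigO Filter.atTop (fun n : ℕ => (T n : ℝ))
        (fun n : ℕ => (n : ℝ) * Real.log (n : ℝ)) ∧
      ∀ n : ℕ, 1 ≤ n → ∀ D : Fin n → DoubleWedge, (∃ a : OnePoint ℝ, ¬ Covers D a) →
        ∃ (t : ℕ) (σ : RealRAM.State),
          RealRAM.Runs P (RealRAM.inputState D) t σ ∧ t ≤ T n ∧
          Describes σ.regions (⋂ i, (D i).toSet) :=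
  ⟨RealRAM.intersect, RealRAM.intersectCost, RealRAM.quasilinear_intersectCost,
    fun _ hn D h => RealRAM.ends_intersect hn D h⟩
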